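/- **Mass conservation of components in the degenerate range.** Let $n\ge 2$, $k\ge 1$, $m>1$, $\lambda_j>0$, $\beta_j\ge 0$ $(1\le j\le k)$, and consider on $\mathbb{R}^n\times(0,\infty)$ the system $$(u^j)_t=\nabla\cdot\big(mU^{m-1}\mathcal A(\nabla u^j,u^j,x,t)+\mathcal B(u^j,x,t)\big),\qquad 1\le j\le k,\qquad U=U(u^1,\dots,u^k).$$ *Structure conditions.* $\mathcal A(p,z,x,t),\mathcal B(z,x,t)\in\mathbb{R}^n$ ($p\in\mathbb{R}^n$, $z\ge 0$) are measurable in $(x,t)$ and, for a.e. $(x,t)$, continuous in $(p,z)$. The function $U$ is continuous on the orthant $[0,\infty)^k$ and differentiable (relative to the orthant) at each of its nonzero points, with partial derivatives $U_{\xi^j}$. Let $0<\mathbf c\le 1\le \mathbf C_1,\mathbf C_2,\mathbf C_3,\mathbf C_4<\infty$ and assume, with $\nabla U=\sum_j U_{u^j}\nabla u^j$ and $\nabla U_{u^i}=\sum_j U_{u^iu^j}\nabla u^j$: - $u^j\ge 0$ and $\lambda_j(u^j)^{\beta_j}\le U$ a.e. for all $j$, also at $t=0$; - (A1) $U^mU_{u^j}\in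 L^2(0,T;H^1_0(\mathbb{R}^n))$ for all $T>0$ and all $j$; - (A2) $U(0)=0$, and $\sum_j|U_{\xi^j}(\xi)\xi^j|\le \mathbf C_1U(\xi)$, $U_{\xi^j}(\xi)\ge 0$ for all $0\ne\xi\in[0,\infty)^k$; - (A3) $\sum_j\big(mU^{m-1}\mathcal A(\nabla u^j,u^j,x,t)+\mathcal B(u^j,x,t)\big)\cdot\nabla U_{u^j}\ge 0$ a.e. (where the $U_{\xi^j}$ are differentiable at $(u^1,\dots,u^k)$); - (A4) $\nabla U\cdot\sum_jU_{u^j}\mathcal A(\nabla u^j,u^j,x,t)\ge \mathbf c|\nabla U|^2-\mathbf C_2U^2$ a.e.; - (A5)–(A7) for a.e. $(x,t)$ and all $p\in\mathbb{R}^n$, $z\ge 0$: $\mathcal A(p,z,x,t)\cdot p\ge \mathbf c|p|^2-\mathbf C_2z^2$, $|\mathcal A(p,z,x,t)|\le \mathbf C_3|p|+\mathbf C_4z$, $|\mathcal B(z,x,t)|\le \mathbf C_5z^q$, where $\mathbf C_5=0$ (that is, $\mathcal B=0$). *Weak solutions.* $\mathbf u=(u^1,\dots,u^k)$ is a weak solution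 with initial data $\mathbf u_0=(u_0^1,\dots,u_0^k)$, $u_0^j\ge 0$ locally integrable: each $u^j$ is locally integrable with a locally integrable weak spatial gradient $\nabla u^j$; $U^{m-1}\mathcal A(\nabla u^j,u^j,x,t)\in L^2(\mathbb{R}^n\times(0,T))$ for every $T>0$; $$\int_0^T\!\!\int_{\mathbb{R}^n}\big\{mU^{m-1}\mathcal A(\nabla u^j,u^j,x,t)\cdot\nabla\varphi+\mathcal B(u^j,x,t)\cdot\nabla\varphi \;-\;u^j\varphi_t\big\}\,dx\,dt=0$$ for all $\varphi\in C_c^\infty(\mathbb{R}^n\times(0,T))$ and all $T>0$; and $u^j(\cdot,t)$ is locally integrable for every $t>0$, depends continuously on $t>0$ in the sense of distributions and tends to $u^j_0$ in that sense as $t\to0^+$. *Claim.* Let $\mathbf K(t_0)=\operatorname{ess\,sup}_{x\in\mathbb{R}^n,\,t\ge t_0}|U(x,t)|\in[0,\infty]$ and $U_0=U(u_0^1,\dots,u_0^k)$. Fix $1\le i\le k$ with $\beta_i>0$ and suppose that $$m>\max\Big(1,\,2-\frac1{\beta_i}\Big),\qquad U_0\in L^{\frac1{\beta_i}}(\mathbb{R}^n)\cap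 L^{m-1+\frac1{\beta_i}}(\mathbb{R}^n),\qquad \int_0^t\mathbf K^{\,m-1}(\tau)\,d\tau\to0\ \text{ as } t\to0^+ .$$ Then $u_0^i\in L^1(\mathbb{R}^n)$ and, for every $t>0$, $u^i(\cdot,t)\in L^1(\mathbb{R}^n)$ and $$\int_{\mathbb{R}^n}u^i(x,t)\,dx=\int_{\mathbb{R}^n}u_0^i(x)\,dx .$$ -/

import Mathlib

open MeasureTheory Set Filter Topology
open scoped ContDiff ENNReal

noncomputable section

/-- `ℝⁿ` with the Euclidean norm. -/
abbrev Space (n : ℕ) : Type := EuclideanSpace ℝ (Fin n)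

/-- Space-time `ℝ × ℝⁿ`; a point is `(t, x)`. -/
abbrev SpaceTime (n : ℕ) : Type := ℝ × Space n

/-- The data of the system
`(uⁱ)ₜ = ∇ · (m U^(m-1) A(∇uⁱ, uⁱ, x, t) + B(uⁱ, x, t))`, `i = 1, …, k`,
and the constants that enter the structure conditions. No property is imposed here. -/
structure ParabolicSystem (n k : ℕ) where
  m : ℝ
  q : ℝ
  lam : Fin k → ℝ
  beta : Fin k → ℝ
  c : ℝ
  C₁ : ℝ
  C₂ : ℝ
  C₃ : ℝ
  C₄ : ℝ
  C₅ : ℝ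
  /-- `U(ξ¹, …, ξᵏ)`; only its values on the orthant `ξ ≥ 0` matter. -/
  U : (Fin k → ℝ) → ℝ
  /-- `A p z x t` -/
  A : Space n → ℝ → Space n → ℝ → Space n
  /-- `B z x t` -/
  B : ℝ → Space n → ℝ → Space n

/-! ### Test functions and weak derivatives -/

/-- Smooth functions with compact support in the open set `D` of space-time. -/
def IsTestFunction {n : ℕ} (D : Set (SpaceTime n)) (φ : SpaceTime n → ℝ) : Prop :=
  ContDiff ℝ ∞ φ ∧ HasCompactSupport φ ∧ tsupport φ ⊆ D

/-- `φₜ` -/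
def timeDeriv {n : ℕ} (φ : SpaceTime n → ℝ) (p : SpaceTime n) : ℝ :=
  deriv (fun s : ℝ => φ (s, p.2)) p.1

/-- `∇φ`, the gradient in the space variable. -/
def spaceGrad {n : ℕ} (φ : SpaceTime n → ℝ) (p : SpaceTime n) : Space n :=
  gradient (fun y : Space n => φ (p.1, y)) p.2

/-- `G` is the weak spatial gradient of `f` in the open set `D` of space-time. -/
structure IsWeakSpaceGrad {n : ℕ} (D : Set (SpaceTime n))
    (f : SpaceTime n → ℝ) (G : SpaceTime n → Space n) : Prop where
  locallyIntegrable : LocallyIntegrableOn f D volume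
  locallyIntegrable_grad : LocallyIntegrableOn G D volume
  integral_eq : ∀ φ : SpaceTime n → ℝ, IsTestFunction D φ →
    ∫ p in D, f p • spaceGrad φ p = - ∫ p in D, φ p • G p

/-- `f ∈ L²(0, T; H¹(ℝⁿ))` (which is also `L²(0, T; H¹₀(ℝⁿ))`). -/
def MemL2H1 {n : ℕ} (T : ℝ) (f : SpaceTime n → ℝ) : Prop :=
  MemLp f 2 (volume.restrict (Ioo 0 T ×ˢ univ)) ∧
  ∃ G : SpaceTime n → Space n,
    MemLp G 2 (volume.restrict (Ioo 0 T ×ˢ univ)) ∧ IsWeakSpaceGrad (Ioo 0 T ×ˢ univ) f G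

namespace ParabolicSystem

variable {n k : ℕ} (S : ParabolicSystem n k)

/-- `U_{ξⁱ}`, taken relative to the closed orthant `ξ ≥ 0`. -/
def dU (i : Fin k) (ξ : Fin k → ℝ) : ℝ :=
  fderivWithin ℝ S.U (Ici 0) ξ (Pi.single i 1)

/-- `U_{ξⁱ ξʲ}`, taken relative to the closed orthant `ξ ≥ 0`. -/
def ddU (i j : Fin k) (ξ : Fin k → ℝ) : ℝ :=
  fderivWithin ℝ (S.dU i) (Ici 0) ξ (Pi.single j 1)

/-- The vector `(u¹, …, uᵏ)` at a point of space-time. -/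
def vec (u : Fin k → SpaceTime n → ℝ) (p : SpaceTime n) : Fin k → ℝ := fun j => u j p

/-- `U` as a function on space-time: `U(u¹(x,t), …, uᵏ(x,t))`. -/
def Uu (u : Fin k → SpaceTime n → ℝ) (p : SpaceTime n) : ℝ := S.U (vec u p)

/-- `A(∇uⁱ, uⁱ, x, t)`, with `G i` in the role of `∇uⁱ`. -/
def Au (u : Fin k → SpaceTime n → ℝ) (G : Fin k → SpaceTime n → Space n) (i : Fin k)
    (p : SpaceTime n) : Space n := S.A (G i p) (u i p) p.2 p.1

/-- `B(uⁱ, x, t)` -/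
def Bu (u : Fin k → SpaceTime n → ℝ) (i : Fin k) (p : SpaceTime n) : Space n :=
  S.B (u i p) p.2 p.1

/-- `∇U = ∑ⱼ U_{uʲ} ∇uʲ` -/
def gradU (u : Fin k → SpaceTime n → ℝ) (G : Fin k → SpaceTime n → Space n)
    (p : SpaceTime n) : Space n := ∑ j, S.dU j (vec u p) • G j p

/-- `∇U_{uⁱ} = ∑ⱼ U_{uⁱ uʲ} ∇uʲ` -/
def gradDU (u : Fin k → SpaceTime n → ℝ) (G : Fin k → SpaceTime n → Space n) (i : Fin k)
    (p : SpaceTime n) : Space n := ∑ j, S.ddU i j (vec u p) • G j p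

/-- Weak (energy) solutions `u` of the system in `Ω × (0, T)`, with `G i` the weak spatial
gradient of the component `u i`. The sign of the `φₜ` term is the one that integration by parts
in `(uⁱ)ₜ = ∇ · F` gives: `∫∫ (F · ∇φ - uⁱ φₜ) = 0`. -/
structure IsWeakSolution (Ω : Set (Space n)) (T : ℝ)
    (u : Fin k → SpaceTime n → ℝ) (G : Fin k → SpaceTime n → Space n) : Prop where
  weakGrad : ∀ i, IsWeakSpaceGrad (Ioo 0 T ×ˢ Ω) (u i) (G i)
  flux_memLp : ∀ i, MemLp (fun p => (S.Uu u p) ^ (S.m - 1) • S.Au u G i p) 2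
    (volume.restrict (Ioo 0 T ×ˢ Ω))
  force_locallyIntegrable : ∀ i, LocallyIntegrableOn (S.Bu u i) (Ioo 0 T ×ˢ Ω) volume
  integral_eq_zero : ∀ i, ∀ φ : SpaceTime n → ℝ, IsTestFunction (Ioo 0 T ×ˢ Ω) φ →
    ∫ p in Ioo 0 T ×ˢ Ω,
      (S.m * (S.Uu u p) ^ (S.m - 1) * inner ℝ (S.Au u G i p) (spaceGrad φ p)
        + inner ℝ (S.Bu u i p) (spaceGrad φ p) - u i p * timeDeriv φ p) = 0

/-- The structure conditions: ranges of the constants, measurability and continuity of `A`, `B`,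
and the conditions on `U`, `A`, `B` (along `u` where they involve the solution). -/
structure StructureConditions
    (u : Fin k → SpaceTime n → ℝ) (G : Fin k → SpaceTime n → Space n) : Prop where
  lam_pos : ∀ i, 0 < S.lam i
  beta_nonneg : ∀ i, 0 ≤ S.beta i
  c_pos : 0 < S.c
  c_le : S.c ≤ 1
  one_le_C₁ : 1 ≤ S.C₁
  one_le_C₂ : 1 ≤ S.C₂
  one_le_C₃ : 1 ≤ S.C₃
  one_le_C₄ : 1 ≤ S.C₄
  measurable_A : ∀ (p : Space n) (z : ℝ), 0 ≤ z →
    AEMeasurable (fun y : SpaceTime n => S.A p z y.2 y.1) (volume.restrict (Ioi 0 ×ˢ univ))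
  continuous_A : ∀ᵐ y : SpaceTime n ∂(volume.restrict (Ioi 0 ×ˢ univ)),
    ContinuousOn (fun w : Space n × ℝ => S.A w.1 w.2 y.2 y.1) {w | 0 ≤ w.2}
  measurable_B : ∀ z : ℝ, 0 ≤ z →
    AEMeasurable (fun y : SpaceTime n => S.B z y.2 y.1) (volume.restrict (Ioi 0 ×ˢ univ))
  continuous_B : ∀ᵐ y : SpaceTime n ∂(volume.restrict (Ioi 0 ×ˢ univ)),
    ContinuousOn (fun z : ℝ => S.B z y.2 y.1) (Ici 0)
  /-- `λᵢ (uⁱ)^βᵢ ≤ U` -/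
  lower_bound : ∀ i, ∀ᵐ y : SpaceTime n ∂(volume.restrict (Ioi 0 ×ˢ univ)),
    S.lam i * (u i y) ^ (S.beta i) ≤ S.Uu u y
  /-- `U^m U_{uⁱ} ∈ L²(0, T; H¹₀(ℝⁿ))` for every `T`. -/
  A1 : ∀ i, ∀ T : ℝ, 0 < T → MemL2H1 T (fun p => (S.Uu u p) ^ S.m * S.dU i (vec u p))
  continuous_U : ContinuousOn S.U (Ici 0)
  /-- Differentiability at the origin is not required, so that `U(ξ) = |ξ|` is covered. -/
  differentiable_U : ∀ ξ : Fin k → ℝ, 0 ≤ ξ → ξ ≠ 0 →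
    DifferentiableWithinAt ℝ S.U (Ici 0) ξ
  A2_zero : S.U 0 = 0
  A2_growth : ∀ ξ : Fin k → ℝ, 0 ≤ ξ → ξ ≠ 0 → ∑ i, |S.dU i ξ * ξ i| ≤ S.C₁ * S.U ξ
  A2_mono : ∀ ξ : Fin k → ℝ, 0 ≤ ξ → ξ ≠ 0 → ∀ i, 0 ≤ S.dU i ξ
  /-- Required at the points where the `∇U_{uⁱ}` make sense. -/
  A3 : ∀ᵐ y : SpaceTime n ∂(volume.restrict (Ioi 0 ×ˢ univ)),
    (∀ i, DifferentiableWithinAt ℝ (S.dU i) (Ici 0) (vec u y)) →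
    0 ≤ ∑ i, inner ℝ ((S.m * (S.Uu u y) ^ (S.m - 1)) • S.Au u G i y + S.Bu u i y)
      (S.gradDU u G i y)
  A4 : ∀ᵐ y : SpaceTime n ∂(volume.restrict (Ioi 0 ×ˢ univ)),
    S.c * ‖S.gradU u G y‖ ^ 2 - S.C₂ * (S.Uu u y) ^ 2
      ≤ inner ℝ (S.gradU u G y) (∑ i, S.dU i (vec u y) • S.Au u G i y)
  A5 : ∀ᵐ y : SpaceTime n ∂(volume.restrict (Ioi 0 ×ˢ univ)), ∀ (p : Space n) (z : ℝ), 0 ≤ z →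
    S.c * ‖p‖ ^ 2 - S.C₂ * z ^ 2 ≤ inner ℝ (S.A p z y.2 y.1) p
  A6 : ∀ᵐ y : SpaceTime n ∂(volume.restrict (Ioi 0 ×ˢ univ)), ∀ (p : Space n) (z : ℝ), 0 ≤ z →
    ‖S.A p z y.2 y.1‖ ≤ S.C₃ * ‖p‖ + S.C₄ * z
  A7 : ∀ᵐ y : SpaceTime n ∂(volume.restrict (Ioi 0 ×ˢ univ)), ∀ z : ℝ, 0 ≤ z →
    ‖S.B z y.2 y.1‖ ≤ S.C₅ * z ^ S.q

/-- `K(t₀) = ess sup of U over ℝⁿ × [t₀, ∞)`, the smallest admissible bound, as an extended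
nonnegative number. -/
def K (u : Fin k → SpaceTime n → ℝ) (t₀ : ℝ) : ℝ≥0∞ :=
  essSup (fun p => ENNReal.ofReal |S.Uu u p|) (volume.restrict (Ici t₀ ×ˢ univ))

end ParabolicSystem

/-- The time slices of `v` are locally integrable, depend continuously on `t > 0` in the sense
of distributions, and tend to the initial datum `v₀` in that sense as `t → 0`. -/
structure HasInitialDatum {n : ℕ} (v : SpaceTime n → ℝ) (v₀ : Space n → ℝ) : Prop where
  initial_locallyIntegrable : LocallyIntegrable v₀ volume
  slice_locallyIntegrable : ∀ t : ℝ, 0 < t → LocallyIntegrable (fun x => v (t, x)) volume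
  slice_continuous : ∀ ψ : Space n → ℝ, ContDiff ℝ ∞ ψ → HasCompactSupport ψ →
    ContinuousOn (fun t : ℝ => ∫ x, v (t, x) * ψ x) (Ioi 0)
  tendsto_initial : ∀ ψ : Space n → ℝ, ContDiff ℝ ∞ ψ → HasCompactSupport ψ →
    Tendsto (fun t : ℝ => ∫ x, v (t, x) * ψ x) (𝓝[>] 0) (𝓝 (∫ x, v₀ x * ψ x))

end

/-! Write `u` for the component `uⁱ` and `w = m U^(m-1)`. Since `B = 0`, `u` solves `uₜ = ∇ · F`
with a flux `F` that is square integrable on slabs and satisfies `F · ∇u ≥ w (c|∇u|² - C u²)` and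
`|F| ≤ C w (|∇u| + u)`. The other components enter only through `w`, of which two facts are used: `w
≤ W(t) = m K(t)^(m-1)`, a function integrable on bounded time intervals, and `w ≥ ν u^σ` with `σ = β
(m-1)`. The reduction is `ParabolicSystem.isFluxSolution` and `ParabolicSystem.isDegenerateFlux`;
everything else concerns a single equation.

Mass. The weight `Z = (1 + |x|²/R²)⁻ⁿ` is integrable and `|∇Z| ≤ (n/R) Z`. Hence `∫ u Z` differs
from its initial value by at most `(n/R) f`, where `f = ∬ |F| Z`, and it is enough to show `f =
O(√R)` and let `R → ∞` (`exists_radius_mul_flux_le`, `mass_eq`).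

Flux. By Young's inequality `|∇u| ≤ u^(a-1)|∇u|² + u^(1-a)`, and for small `a` one has `u^(1-a) ≤ √R
u + R⁻ⁿ`. So `f` is at most a multiple of `∬ w u^(a-1)|∇u|² Z`, plus `O(√R) ∬ W u Z`, plus a
constant because `∫ Z` is of order `Rⁿ`. The middle term is controlled by `∫ u₀ + (n/R) f`; the part
with `f` carries the factor `R^(-1/2)` and is absorbed for large `R`.

Energy. Testing formally with `u^a Z` and using Gronwall's inequality for `∫ u^(1+a) Z` with kernel
`W` bounds `∬ w u^(a-1)|∇u|² Z` uniformly in `R` (`exists_energy_le`). The initial energy is finite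
because `λ u₀^β ≤ U₀` puts `u₀` in `L¹` and `L^(1+σ)`, and `a ≤ σ`. To justify the test, `u^a` is
replaced by a bounded profile `h(u)` whose derivative lives on `1/N ≤ u ≤ 2N`, where `w` is bounded
below and `∇u` is therefore locally square integrable. The missing time derivative is replaced by
backward differences of `u`, continued by `u₀` to negative times, and by the convexity of the
primitive `H` of `h` (`energy_inequality`). The truncation errors vanish as `N → ∞` by dominated
convergence, since `u^a |F| Z` is integrable when `2a ≤ 1`. -/

/-- A sequence of bump functions at the origin with radii tending to zero. -/
theorem exists_contDiffBump_seq {E : Type*} [NormedAddCommGroup E] : ∃ ρ : ℕ → ContDiffBump (0 : E),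
    Tendsto (fun j => (ρ j).rOut) atTop (𝓝 0) ∧
    ∀ j, (ρ j).rOut ≤ 2 * (ρ j).rIn ∧ (ρ j).rOut ≤ 2 := by
  refine ⟨fun j => ⟨1 / ((j : ℝ) + 1), 2 * (1 / ((j : ℝ) + 1)), by positivity, ?_⟩, ?_, ?_⟩
  · have : 0 < 1 / ((j : ℝ) + 1) := by positivity
    linarith
  · have := (tendsto_one_div_add_atTop_nhds_zero_nat (𝕜 := ℝ)).const_mul 2
    simpa using this
  · intro j
    refine ⟨le_rfl, ?_⟩
    have : 1 / ((j : ℝ) + 1) ≤ 1 := by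
      rw [div_le_one (by positivity)]
      have : (0 : ℝ) ≤ j := Nat.cast_nonneg j
      linarith
    show 2 * (1 / ((j : ℝ) + 1)) ≤ 2
    linarith

theorem memLp_translate {E F : Type*} [AddGroup E] [MeasurableSpace E] [MeasurableAdd E]
    {μ : Measure E} [μ.IsAddRightInvariant] [NormedAddCommGroup F] {p : ℝ≥0∞} {f : E → F} (hf : MemLp f p μ) (z : E) :
    MemLp (fun x => f (x - z)) p μ :=
  hf.comp_measurePreserving (measurePreserving_sub_right μ z)

/-! ### Translation and mollification in `Lᵖ`. -/

section Mollification

open scoped Convolution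

variable {E : Type*} [NormedAddCommGroup E] [NormedSpace ℝ E] [FiniteDimensional ℝ E]
  [MeasurableSpace E] [BorelSpace E] {μ : Measure E} [μ.IsAddHaarMeasure]
  {F : Type*} [NormedAddCommGroup F]

/-- Translation is continuous in `Lᵖ`. -/
theorem tendsto_eLpNorm_translate_sub {p : ℝ≥0∞} (hp1 : 1 ≤ p) (hp : p ≠ ⊤) {f : E → F}
    (hf : MemLp f p μ) :
    Tendsto (fun z => eLpNorm (fun x => f (x - z) - f x) p μ) (𝓝 0) (𝓝 0) := by
  have : Fact (1 ≤ p) := ⟨hp1⟩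
  have : Fact (p ≠ ⊤) := ⟨hp⟩
  have hc : Continuous (fun z : E => DomAddAct.mk (-z) +ᵥ hf.toLp f) := by
    have h1 : Continuous (fun z : E => DomAddAct.mk (-z)) :=
      DomAddAct.continuous_mk.comp continuous_neg
    exact h1.vadd continuous_const
  have h0 := (tendsto_iff_edist_tendsto_0.1 (hc.tendsto 0))
  refine h0.congr fun z => ?_
  rw [DomAddAct.mk_vadd_toLp, DomAddAct.mk_vadd_toLp, Lp.edist_toLp_toLp]
  refine eLpNorm_congr_ae (Eventually.of_forall fun x => ?_)
  simp [vadd_eq_add, sub_eq_neg_add]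

variable [NormedSpace ℝ F] [CompleteSpace F]

/-- The mollification error at `x` is the mean of `f (x - z) - f x` under the probability measure
with density `ρ.normed μ`. Comparing the `L¹` and `Lᵖ` norms of that measure and exchanging the
integrals bounds it by an average of translation errors, each at most `ε`. -/
theorem eLpNorm_convolution_sub_le {p : ℝ≥0∞} (hp1 : 1 ≤ p) (hp : p ≠ ⊤) {f : E → F}
    (hf : MemLp f p μ) (ρ : ContDiffBump (0 : E)) {ε : ℝ≥0∞}
    (hε : ∀ z ∈ Metric.ball (0 : E) ρ.rOut, eLpNorm (fun x => f (x - z) - f x) p μ ≤ ε) :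
    eLpNorm (fun x => (ρ.normed μ ⋆[ContinuousLinearMap.lsmul ℝ ℝ, μ] f) x - f x) p μ ≤ ε := by
  have hp0 : p ≠ 0 := (zero_lt_one.trans_le hp1).ne'
  have hpr : 0 < p.toReal := ENNReal.toReal_pos hp0 hp
  set d : E → ℝ≥0∞ := fun z => ENNReal.ofReal (ρ.normed μ z) with hd
  have hdm : Measurable d := (ρ.continuous_normed.measurable).ennreal_ofReal
  set ν : Measure E := μ.withDensity d with hν
  have hνp : IsProbabilityMeasure ν := by
    refine ⟨?_⟩
    rw [hν, withDensity_apply _ MeasurableSet.univ, Measure.restrict_univ,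
      ← ofReal_integral_eq_lintegral_ofReal ρ.integrable_normed
        (Eventually.of_forall fun z => ρ.nonneg_normed z), ρ.integral_normed]
    simp
  have hloc : LocallyIntegrable f μ := hf.locallyIntegrable hp1
  have hfm2 : AEStronglyMeasurable (fun q : E × E => f (q.1 - q.2) - f q.1) (μ.prod μ) := by
    refine AEStronglyMeasurable.sub ?_ ?_
    · exact hf.1.comp_quasiMeasurePreserving (quasiMeasurePreserving_sub_of_right_invariant μ μ)
    · exact hf.1.comp_fst
  have hνac : ν ≪ μ := withDensity_absolutelyContinuous _ _
  have hslice : ∀ x, AEStronglyMeasurable (fun z => f (x - z) - f x) ν := by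
    intro x
    refine AEStronglyMeasurable.sub ?_ aestronglyMeasurable_const
    refine AEStronglyMeasurable.mono_ac hνac ?_
    exact hf.1.comp_quasiMeasurePreserving
      (quasiMeasurePreserving_sub_left_of_right_invariant μ x)
  have hpt : ∀ x, ‖(ρ.normed μ ⋆[ContinuousLinearMap.lsmul ℝ ℝ, μ] f) x - f x‖ₑ ^ p.toReal
      ≤ ∫⁻ z, ‖f (x - z) - f x‖ₑ ^ p.toReal ∂ν := by
    intro x
    have hex : Integrable (fun z => ρ.normed μ z • f (x - z)) μ := by
      have := (ρ.hasCompactSupport_normed (μ := μ)).convolutionExists_left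
        (ContinuousLinearMap.lsmul ℝ ℝ) ρ.continuous_normed hloc x
      simpa [ConvolutionExistsAt] using this
    have h1 : (ρ.normed μ ⋆[ContinuousLinearMap.lsmul ℝ ℝ, μ] f) x - f x
        = ∫ z, ρ.normed μ z • (f (x - z) - f x) ∂μ := by
      have h2 : f x = ∫ z, ρ.normed μ z • f x ∂μ := by
        rw [integral_smul_const, ρ.integral_normed, one_smul]
      conv_lhs => rw [h2]
      simp only [convolution, ContinuousLinearMap.lsmul_apply, smul_sub]
      rw [integral_sub hex (ρ.integrable_normed.smul_const _)]
    have h3 : ‖(ρ.normed μ ⋆[ContinuousLinearMap.lsmul ℝ ℝ, μ] f) x - f x‖ₑ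
        ≤ eLpNorm (fun z => f (x - z) - f x) p ν := by
      refine le_trans ?_ (eLpNorm_le_eLpNorm_of_exponent_le hp1 (hslice x))
      rw [h1, eLpNorm_one_eq_lintegral_enorm]
      refine (enorm_integral_le_lintegral_enorm _).trans (le_of_eq ?_)
      rw [hν, lintegral_withDensity_eq_lintegral_mul_non_measurable _ hdm
        (Eventually.of_forall fun _ => ENNReal.ofReal_lt_top)]
      refine lintegral_congr fun z => ?_
      rw [enorm_smul, Real.enorm_of_nonneg (ρ.nonneg_normed z)]
      rfl
    calc _ ≤ (eLpNorm (fun z => f (x - z) - f x) p ν) ^ p.toReal :=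
          ENNReal.rpow_le_rpow h3 hpr.le
      _ = _ := by
          rw [eLpNorm_eq_lintegral_rpow_enorm_toReal hp0 hp, ← ENNReal.rpow_mul,
            one_div_mul_cancel hpr.ne', ENNReal.rpow_one]
  rw [eLpNorm_eq_lintegral_rpow_enorm_toReal hp0 hp, one_div,
    ENNReal.rpow_inv_le_iff hpr]
  calc _ ≤ ∫⁻ x, ∫⁻ z, ‖f (x - z) - f x‖ₑ ^ p.toReal ∂ν ∂μ := lintegral_mono hpt
    _ = ∫⁻ z, ∫⁻ x, ‖f (x - z) - f x‖ₑ ^ p.toReal ∂μ ∂ν := by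
        refine lintegral_lintegral_swap ?_
        refine AEMeasurable.pow_const ?_ _
        exact (hfm2.mono_ac (Measure.AbsolutelyContinuous.rfl.prod hνac)).enorm
    _ ≤ ∫⁻ _, ε ^ p.toReal ∂ν := by
        refine lintegral_mono_ae ?_
        have hball : ∀ᵐ z ∂ν, z ∈ Metric.ball (0 : E) ρ.rOut := by
          rw [hν, ae_withDensity_iff hdm]
          refine Eventually.of_forall fun z hz => ?_
          rw [← ρ.support_normed_eq (μ := μ)]
          intro h0
          exact hz (by simp [hd, h0])
        filter_upwards [hball] with z hz
        have := hε z hz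
        rw [eLpNorm_eq_lintegral_rpow_enorm_toReal hp0 hp, one_div,
          ENNReal.rpow_inv_le_iff hpr] at this
        exact this
    _ = ε ^ p.toReal := by simp

/-- Mollifications converge in `Lᵖ`. -/
theorem tendsto_eLpNorm_convolution_sub {p : ℝ≥0∞} (hp1 : 1 ≤ p) (hp : p ≠ ⊤) {f : E → F}
    (hf : MemLp f p μ) {ρ : ℕ → ContDiffBump (0 : E)}
    (hρ : Tendsto (fun j => (ρ j).rOut) atTop (𝓝 0)) :
    Tendsto (fun j => eLpNorm
      (fun x => ((ρ j).normed μ ⋆[ContinuousLinearMap.lsmul ℝ ℝ, μ] f) x - f x) p μ)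
      atTop (𝓝 0) := by
  rw [ENNReal.tendsto_nhds_zero]
  intro ε hε
  have h1 := ENNReal.tendsto_nhds_zero.1 (tendsto_eLpNorm_translate_sub hp1 hp hf) ε hε
  obtain ⟨δ, hδ, hδ'⟩ := Metric.eventually_nhds_iff_ball.1 h1
  filter_upwards [hρ.eventually (gt_mem_nhds hδ)] with j hj
  exact eLpNorm_convolution_sub_le hp1 hp hf _ fun z hz =>
    hδ' z (Metric.ball_subset_ball hj.le hz)

end Mollification

/-! ### Calculus of the classical spatial gradient. -/

section SpaceGradient

variable {n : ℕ}

instance volume_spaceTime_isAddHaarMeasure :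
    (volume : Measure (SpaceTime n)).IsAddHaarMeasure := by
  rw [Measure.volume_eq_prod]; infer_instance

/-- The restriction of a linear form on space-time to space, as a vector. -/
noncomputable def gradCLM (n : ℕ) : (SpaceTime n →L[ℝ] ℝ) →L[ℝ] Space n :=
  LinearMap.toContinuousLinearMap
    { toFun := fun l => (InnerProductSpace.toDual ℝ (Space n)).symm
        (l.comp (ContinuousLinearMap.inr ℝ ℝ (Space n)))
      map_add' := fun l l' => by rw [ContinuousLinearMap.add_comp, map_add]
      map_smul' := fun c l => by
        rw [ContinuousLinearMap.smul_comp, map_smulₛₗ]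
        simp }

theorem inner_gradCLM (l : SpaceTime n →L[ℝ] ℝ) (v : Space n) :
    inner ℝ (gradCLM n l) v = l (0, v) := by
  simp [gradCLM]

/-- Exhibits the spatial gradient as a fixed continuous linear image of the full derivative, so that
the rules for `fderiv` transfer to it. -/
theorem spaceGrad_eq_gradCLM {φ : SpaceTime n → ℝ} {p : SpaceTime n}
    (h : DifferentiableAt ℝ φ p) : spaceGrad φ p = gradCLM n (fderiv ℝ φ p) := by
  have h1 : HasFDerivAt (fun y : Space n => φ (p.1, y))
      ((fderiv ℝ φ p).comp (ContinuousLinearMap.inr ℝ ℝ (Space n))) p.2 := by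
    have := h.hasFDerivAt
    exact HasFDerivAt.comp (g := φ) (f := fun y : Space n => ((p.1, y) : SpaceTime n)) p.2 this
      (hasFDerivAt_prodMk_right p.1 p.2)
  rw [spaceGrad, gradient, h1.fderiv]
  rfl

theorem inner_spaceGrad {φ : SpaceTime n → ℝ} {p : SpaceTime n}
    (h : DifferentiableAt ℝ φ p) (v : Space n) :
    inner ℝ (spaceGrad φ p) v = fderiv ℝ φ p (0, v) := by
  rw [spaceGrad_eq_gradCLM h, inner_gradCLM]

theorem timeDeriv_eq_fderiv {φ : SpaceTime n → ℝ} {p : SpaceTime n}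
    (h : DifferentiableAt ℝ φ p) : timeDeriv φ p = fderiv ℝ φ p (1, 0) := by
  have h1 : HasDerivAt (fun s : ℝ => φ (s, p.2)) (fderiv ℝ φ p (1, 0)) p.1 := by
    have h2 : HasDerivAt (fun s : ℝ => ((s, p.2) : SpaceTime n)) (1, 0) p.1 :=
      (hasDerivAt_id p.1).prodMk (hasDerivAt_const p.1 p.2)
    exact HasFDerivAt.comp_hasDerivAt (f := fun s : ℝ => ((s, p.2) : SpaceTime n)) p.1
      h.hasFDerivAt h2
  exact h1.deriv

theorem spaceGrad_mul {φ ψ : SpaceTime n → ℝ} {p : SpaceTime n}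
    (hφ : DifferentiableAt ℝ φ p) (hψ : DifferentiableAt ℝ ψ p) :
    spaceGrad (fun q => φ q * ψ q) p = φ p • spaceGrad ψ p + ψ p • spaceGrad φ p := by
  rw [spaceGrad_eq_gradCLM hφ, spaceGrad_eq_gradCLM hψ, spaceGrad_eq_gradCLM (hφ.fun_mul hψ),
    fderiv_fun_mul hφ hψ]
  simp

theorem continuous_spaceGrad {φ : SpaceTime n → ℝ} (h : ContDiff ℝ 1 φ) :
    Continuous (spaceGrad φ) := by
  have : spaceGrad φ = fun p => gradCLM n (fderiv ℝ φ p) := by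
    ext1 p
    exact spaceGrad_eq_gradCLM (h.differentiable one_ne_zero p)
  rw [this]
  exact (gradCLM n).continuous.comp (h.continuous_fderiv one_ne_zero)

theorem spaceGrad_eq_zero_of_notMem_tsupport {φ : SpaceTime n → ℝ} {p : SpaceTime n}
    (hp : p ∉ tsupport φ) : spaceGrad φ p = 0 := by
  have h : φ =ᶠ[𝓝 p] fun _ => 0 := notMem_tsupport_iff_eventuallyEq.1 hp
  have hd : DifferentiableAt ℝ φ p := (differentiableAt_const (0 : ℝ)).congr_of_eventuallyEq h
  rw [spaceGrad_eq_gradCLM hd, h.fderiv_eq]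
  simp

theorem tsupport_spaceGrad_subset (φ : SpaceTime n → ℝ) :
    tsupport (spaceGrad φ) ⊆ tsupport φ := by
  refine closure_minimal ?_ (isClosed_tsupport φ)
  intro p hp
  by_contra h
  exact hp (spaceGrad_eq_zero_of_notMem_tsupport h)

theorem HasCompactSupport.spaceGrad {φ : SpaceTime n → ℝ} (h : HasCompactSupport φ) :
    HasCompactSupport (spaceGrad φ) :=
  h.mono' ((subset_tsupport _).trans (tsupport_spaceGrad_subset φ))

end SpaceGradient

/-! ### Weak spatial gradients: products, mollification, integration by parts. -/

section WeakGradient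

variable {X V : Type*} [TopologicalSpace X] [T2Space X] [MeasurableSpace X] [OpensMeasurableSpace X]
  {μ : Measure X} [NormedAddCommGroup V] [NormedSpace ℝ V]

theorem integrable_smul_of_tsupport_subset [SecondCountableTopologyEither X ℝ]
    {D : Set X} {φ : X → ℝ} (hφ : Continuous φ)
    (hc : HasCompactSupport φ) (hD : tsupport φ ⊆ D) {f : X → V}
    (hf : LocallyIntegrableOn f D μ) : Integrable (fun p => φ p • f p) μ := by
  have h1 : IntegrableOn f (tsupport φ) μ := hf.integrableOn_compact_subset hD hc
  have h2 : IntegrableOn (fun p => φ p • f p) (tsupport φ) μ :=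
    h1.continuousOn_smul hφ.continuousOn hc
  rw [← integrableOn_iff_integrable_of_support_subset (s := tsupport φ)]
  · exact h2
  · intro p hp
    apply subset_tsupport
    intro h
    exact hp (by simp [h])

theorem integrable_smul_of_tsupport_subset' [SecondCountableTopologyEither X V]
    {D : Set X} {Z : X → V} (hZ : Continuous Z)
    (hc : HasCompactSupport Z) (hD : tsupport Z ⊆ D) {f : X → ℝ}
    (hf : LocallyIntegrableOn f D μ) : Integrable (fun p => f p • Z p) μ := by
  have h1 : IntegrableOn f (tsupport Z) μ := hf.integrableOn_compact_subset hD hc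
  have h2 : IntegrableOn (fun p => f p • Z p) (tsupport Z) μ :=
    h1.smul_continuousOn hZ.continuousOn hc
  rw [← integrableOn_iff_integrable_of_support_subset (s := tsupport Z)]
  · exact h2
  · intro p hp
    apply subset_tsupport
    intro h
    exact hp (by simp [h])

variable {n : ℕ}

theorem IsTestFunction.mul_left {D : Set (SpaceTime n)} {φ χ : SpaceTime n → ℝ}
    (hφ : IsTestFunction D φ) (hχ : ContDiff ℝ ∞ χ) :
    IsTestFunction D (fun p => χ p * φ p) :=
  ⟨hχ.mul hφ.1, hφ.2.1.mul_left, (closure_mono (by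
    intro p hp h
    exact hp (by simp [h]))).trans hφ.2.2⟩

theorem IsTestFunction.mono {D D' : Set (SpaceTime n)} {φ : SpaceTime n → ℝ}
    (hφ : IsTestFunction D φ) (h : D ⊆ D') : IsTestFunction D' φ :=
  ⟨hφ.1, hφ.2.1, hφ.2.2.trans h⟩

theorem IsTestFunction.integrable_smul {D : Set (SpaceTime n)} {φ : SpaceTime n → ℝ}
    (hφ : IsTestFunction D φ) {W : Type*} [NormedAddCommGroup W] [NormedSpace ℝ W]
    {f : SpaceTime n → W} (hf : LocallyIntegrableOn f D volume) :
    Integrable (fun p => φ p • f p) :=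
  integrable_smul_of_tsupport_subset hφ.1.continuous hφ.2.1 hφ.2.2 hf

theorem IsTestFunction.integrable_smul_spaceGrad {D : Set (SpaceTime n)} {φ : SpaceTime n → ℝ}
    (hφ : IsTestFunction D φ) {f : SpaceTime n → ℝ} (hf : LocallyIntegrableOn f D volume) :
    Integrable (fun p => f p • spaceGrad φ p) :=
  integrable_smul_of_tsupport_subset' (continuous_spaceGrad (hφ.1.of_le (by simp)))
    hφ.2.1.spaceGrad ((tsupport_spaceGrad_subset φ).trans hφ.2.2) hf

/-- `P` is the weak spatial gradient of `f` in `D`; integrals over the whole space-time. -/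
def HasWeakSpaceGrad (D : Set (SpaceTime n)) (f : SpaceTime n → ℝ)
    (P : SpaceTime n → Space n) : Prop :=
  ∀ φ, IsTestFunction D φ → ∫ p, f p • spaceGrad φ p = - ∫ p, φ p • P p

/-- Cutting off a weakly differentiable function by a smooth factor. If `χφ` is a test function
in `D` for every test function `φ` in `D'`, the product is weakly differentiable in `D'`. -/
theorem HasWeakSpaceGrad.mul_smooth {D D' : Set (SpaceTime n)} {f : SpaceTime n → ℝ}
    {P : SpaceTime n → Space n} (h : HasWeakSpaceGrad D f P)
    (hf : LocallyIntegrableOn f D) (hP : LocallyIntegrableOn P D)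
    {χ : SpaceTime n → ℝ} (hχ : ContDiff ℝ ∞ χ)
    (hD : ∀ φ, IsTestFunction D' φ → IsTestFunction D (fun p => χ p * φ p))
    (hD' : ∀ φ, IsTestFunction D' φ → Integrable (fun p => (φ p * f p) • spaceGrad χ p)) :
    HasWeakSpaceGrad D' (fun p => χ p * f p) (fun p => χ p • P p + f p • spaceGrad χ p) := by
  intro φ hφ
  have h1 := h _ (hD φ hφ)
  have hg : ∀ p, spaceGrad (fun q => χ q * φ q) p = χ p • spaceGrad φ p + φ p • spaceGrad χ p :=
    fun p => spaceGrad_mul (hχ.differentiable (by simp) p) (hφ.1.differentiable (by simp) p)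
  have i1 : Integrable (fun p => (φ p * f p) • spaceGrad χ p) := hD' φ hφ
  have i0 : Integrable (fun p => f p • spaceGrad (fun q => χ q * φ q) p) :=
    (hD φ hφ).integrable_smul_spaceGrad hf
  -- By the product rule this term is the difference of the other two, which is how its
  -- integrability is obtained.
  have i2 : Integrable (fun p => (χ p * f p) • spaceGrad φ p) := by
    refine (i0.sub i1).congr (Eventually.of_forall fun p => ?_)
    simp only [Pi.sub_apply, hg, smul_add, smul_smul]
    rw [mul_comm (φ p), mul_comm (χ p)]
    abel
  have i3 : Integrable (fun p => (χ p * φ p) • P p) := (hD φ hφ).integrable_smul hP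
  have e1 : ∫ p, f p • spaceGrad (fun q => χ q * φ q) p
      = (∫ p, (χ p * f p) • spaceGrad φ p) + ∫ p, (φ p * f p) • spaceGrad χ p := by
    rw [← integral_add i2 i1]
    refine integral_congr_ae (Eventually.of_forall fun p => ?_)
    simp only [hg, smul_add, smul_smul]
    rw [mul_comm (f p), mul_comm (f p)]
  have e2 : ∫ p, φ p • (χ p • P p + f p • spaceGrad χ p)
      = (∫ p, (χ p * φ p) • P p) + ∫ p, (φ p * f p) • spaceGrad χ p := by
    rw [← integral_add i3 i1]
    refine integral_congr_ae (Eventually.of_forall fun p => ?_)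
    simp only [smul_add, smul_smul]
    rw [mul_comm (φ p) (χ p)]
  rw [e1] at h1
  rw [e2, neg_add, ← h1]
  abel

open scoped Convolution

/-- Mollification commutes with the weak spatial gradient. -/
theorem HasWeakSpaceGrad.spaceGrad_convolution {f : SpaceTime n → ℝ} {P : SpaceTime n → Space n}
    (h : HasWeakSpaceGrad univ f P) (hf : LocallyIntegrable f)
    (ρ : ContDiffBump (0 : SpaceTime n)) (p : SpaceTime n) :
    spaceGrad (ρ.normed volume ⋆[ContinuousLinearMap.lsmul ℝ ℝ, volume] f) p
      = (ρ.normed volume ⋆[ContinuousLinearMap.lsmul ℝ ℝ, volume] P) p := by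
  set r : SpaceTime n → ℝ := ρ.normed volume with hr
  have hrc : HasCompactSupport r := ρ.hasCompactSupport_normed
  have hrs : ContDiff ℝ ∞ r := ρ.contDiff_normed
  have hder := hrc.hasFDerivAt_convolution_left (ContinuousLinearMap.lsmul ℝ ℝ)
    (hrs.of_le (by simp)) hf p
  rw [spaceGrad_eq_gradCLM hder.differentiableAt, hder.fderiv]
  have hr' : Continuous (fun z => fderiv ℝ r z) := hrs.continuous_fderiv (by simp)
  have hInt : Integrable (fun z => (ContinuousLinearMap.precompL (SpaceTime n)
      (ContinuousLinearMap.lsmul ℝ ℝ : ℝ →L[ℝ] ℝ →L[ℝ] ℝ) (fderiv ℝ r z)) (f (p - z))) := by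
    have := (hrc.fderiv (𝕜 := ℝ)).convolutionExists_left
      (ContinuousLinearMap.precompL (SpaceTime n)
        (ContinuousLinearMap.lsmul ℝ ℝ : ℝ →L[ℝ] ℝ →L[ℝ] ℝ)) hr' hf p
    exact this
  rw [convolution_def, ← ContinuousLinearMap.integral_comp_comm _ hInt]
  -- The reflected kernel `z ↦ r (p - z)` is the test function; the sign from the reflection cancels
  -- the sign in the definition of the weak gradient.
  have ht : IsTestFunction univ (fun z : SpaceTime n => r (p - z)) := by
    refine ⟨hrs.comp (contDiff_const.sub contDiff_id), ?_, subset_univ _⟩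
    exact hrc.comp_homeomorph (Homeomorph.subLeft p)
  have h2 := h _ ht
  have hgr : ∀ z, spaceGrad (fun z : SpaceTime n => r (p - z)) z
      = - gradCLM n (fderiv ℝ r (p - z)) := by
    intro z
    have hd : HasFDerivAt (fun z : SpaceTime n => r (p - z)) (-(fderiv ℝ r (p - z))) z := by
      have h3 : HasFDerivAt (fun z : SpaceTime n => p - z)
          (-(ContinuousLinearMap.id ℝ (SpaceTime n))) z := (hasFDerivAt_id z).const_sub p
      have h4 := ((hrs.differentiable (by simp) (p - z)).hasFDerivAt).comp z h3
      rw [ContinuousLinearMap.comp_neg, ContinuousLinearMap.comp_id] at h4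
      exact h4
    rw [spaceGrad_eq_gradCLM hd.differentiableAt, hd.fderiv, map_neg]
  simp only [hgr, smul_neg, integral_neg, neg_inj] at h2
  calc _ = ∫ z, f (p - z) • gradCLM n (fderiv ℝ r z) := by
        refine integral_congr_ae (Eventually.of_forall fun z => ?_)
        have : (ContinuousLinearMap.precompL (SpaceTime n)
          (ContinuousLinearMap.lsmul ℝ ℝ : ℝ →L[ℝ] ℝ →L[ℝ] ℝ) (fderiv ℝ r z)) (f (p - z))
            = f (p - z) • fderiv ℝ r z := by
          ext w <;> simp [ContinuousLinearMap.precompL_apply, mul_comm]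
        simp only [this, map_smul]
    _ = ∫ z, f z • gradCLM n (fderiv ℝ r (p - z)) := by
        rw [← integral_sub_left_eq_self (fun z => f z • gradCLM n (fderiv ℝ r (p - z))) volume p]
        simp
    _ = ∫ z, r (p - z) • P z := h2
    _ = ∫ z, r z • P (p - z) := by
        rw [← integral_sub_left_eq_self (fun z => r z • P (p - z)) volume p]
        simp
    _ = _ := by simp [convolution_def]

/-- Classical integration by parts. -/
theorem hasWeakSpaceGrad_of_contDiff {f : SpaceTime n → ℝ} (hf : ContDiff ℝ 1 f) :
    HasWeakSpaceGrad univ f (spaceGrad f) := by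
  intro φ hφ
  have i1 : Integrable (fun p => f p • spaceGrad φ p) :=
    hφ.integrable_smul_spaceGrad (hf.continuous.locallyIntegrable.locallyIntegrableOn _)
  have i2 : Integrable (fun p => φ p • spaceGrad f p) :=
    hφ.integrable_smul ((continuous_spaceGrad hf).locallyIntegrable.locallyIntegrableOn _)
  have i3 : Integrable (fun p => f p * φ p) := by
    have := hφ.integrable_smul (hf.continuous.locallyIntegrable.locallyIntegrableOn univ)
    simpa [mul_comm] using this
  have df : Differentiable ℝ f := hf.differentiable one_ne_zero
  have dφ : Differentiable ℝ φ := hφ.1.differentiable (by simp)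
  refine ext_inner_left ℝ fun v => ?_
  rw [inner_neg_right, ← integral_inner i1, ← integral_inner i2]
  have e1 : ∀ p, inner ℝ v (f p • spaceGrad φ p) = f p * fderiv ℝ φ p (0, v) := by
    intro p
    rw [inner_smul_right, real_inner_comm, inner_spaceGrad (dφ p)]
  have e2 : ∀ p, inner ℝ v (φ p • spaceGrad f p) = fderiv ℝ f p (0, v) * φ p := by
    intro p
    rw [inner_smul_right, real_inner_comm, inner_spaceGrad (df p), mul_comm]
  simp only [e1, e2]
  refine integral_mul_fderiv_eq_neg_fderiv_mul_of_integrable ?_ ?_ i3 (fun x _ => df x)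
    (fun x _ => dφ x)
  · simpa only [e2] using i2.const_inner (𝕜 := ℝ) v
  · simpa only [e1] using i1.const_inner (𝕜 := ℝ) v

end WeakGradient

/-! ### Chain rule for weak gradients and their vanishing on level sets. -/

section ChainRule

open scoped Convolution

variable {n : ℕ}

theorem abs_sub_le_of_hasDerivAt_bound {η g : ℝ → ℝ} (hη : ∀ z, HasDerivAt η (g z) z) {C : ℝ}
    (hC : ∀ z, |g z| ≤ C) (x y : ℝ) : |η x - η y| ≤ C * |x - y| := by
  have := (convex_univ (𝕜 := ℝ) (E := ℝ)).norm_image_sub_le_of_norm_hasDerivWithin_le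
    (f := η) (f' := g) (C := C) (fun z _ => (hη z).hasDerivWithinAt) (fun z _ => hC z)
    (mem_univ y) (mem_univ x)
  simpa using this

theorem MeasureTheory.LocallyIntegrableOn.bdd_smul_left {X V : Type*} [TopologicalSpace X]
    [MeasurableSpace X] {μ : Measure X} [NormedAddCommGroup V] [NormedSpace ℝ V] {D : Set X}
    {P : X → V} (hP : LocallyIntegrableOn P D μ) {b : X → ℝ} {C : ℝ}
    (hb : AEStronglyMeasurable b (μ.restrict D)) (hC : ∀ p, |b p| ≤ C) :
    LocallyIntegrableOn (fun p => b p • P p) D μ := by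
  intro x hx
  obtain ⟨t, ht, hi⟩ := hP x hx
  refine ⟨t ∩ D, inter_mem ht self_mem_nhdsWithin, ?_⟩
  exact Integrable.bdd_smul (hi.mono_set inter_subset_left) C
    (hb.mono_measure (Measure.restrict_mono inter_subset_right le_rfl))
    (Eventually.of_forall hC)

theorem MeasureTheory.LocallyIntegrableOn.mono_restrict {X V V' : Type*} [TopologicalSpace X]
    [MeasurableSpace X] {μ : Measure X} [NormedAddCommGroup V] [NormedAddCommGroup V'] {D : Set X}
    {f : X → V} (hf : LocallyIntegrableOn f D μ) {f' : X → V'}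
    (hm : AEStronglyMeasurable f' (μ.restrict D)) (hle : ∀ p, ‖f' p‖ ≤ ‖f p‖) :
    LocallyIntegrableOn f' D μ := by
  intro x hx
  obtain ⟨t, ht, hi⟩ := hf x hx
  refine ⟨t ∩ D, inter_mem ht self_mem_nhdsWithin, ?_⟩
  exact Integrable.mono (hi.mono_set inter_subset_left)
    (hm.mono_measure (Measure.restrict_mono inter_subset_right le_rfl))
    (Eventually.of_forall hle)

/-- Passage to the limit in the classical chain rule for mollifications `fj` of `f`. The gradient
term is split into `g (fj) (Pj - P)`, small in `L¹` because `g` is bounded, and `g (fj) P`, which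
converges by dominated convergence because `g` is continuous and `fj → f` almost everywhere. -/
theorem HasWeakSpaceGrad.comp_of_integrable {f : SpaceTime n → ℝ} {P : SpaceTime n → Space n}
    (h : HasWeakSpaceGrad univ f P) (hf : Integrable f) (hP : Integrable P) {η g : ℝ → ℝ}
    (hη : ∀ z, HasDerivAt η (g z) z) (hg : Continuous g) {C : ℝ} (hC : ∀ z, |g z| ≤ C) :
    HasWeakSpaceGrad univ (fun p => η (f p)) (fun p => g (f p) • P p) := by
  intro φ hφ
  have hC0 : 0 ≤ C := (abs_nonneg _).trans (hC 0)
  have hηc : Continuous η := continuous_iff_continuousAt.2 fun z => (hη z).continuousAt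
  obtain ⟨ρ, hρ0, hρ⟩ := exists_contDiffBump_seq (E := SpaceTime n)
  set fj : ℕ → SpaceTime n → ℝ :=
    fun j => (ρ j).normed volume ⋆[ContinuousLinearMap.lsmul ℝ ℝ, volume] f with hfj
  set Pj : ℕ → SpaceTime n → Space n :=
    fun j => (ρ j).normed volume ⋆[ContinuousLinearMap.lsmul ℝ ℝ, volume] P with hPj
  have hfL : Tendsto (fun j => eLpNorm (fun x => fj j x - f x) 1 volume) atTop (𝓝 0) :=
    tendsto_eLpNorm_convolution_sub le_rfl ENNReal.one_ne_top (memLp_one_iff_integrable.2 hf) hρ0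
  have hPL : Tendsto (fun j => eLpNorm (fun x => Pj j x - P x) 1 volume) atTop (𝓝 0) :=
    tendsto_eLpNorm_convolution_sub le_rfl ENNReal.one_ne_top (memLp_one_iff_integrable.2 hP) hρ0
  have hfae : ∀ᵐ x, Tendsto (fun j => fj j x) atTop (𝓝 (f x)) :=
    ContDiffBump.ae_convolution_tendsto_right_of_locallyIntegrable hρ0
      (Eventually.of_forall fun j => (hρ j).1) hf.locallyIntegrable
  have hfs : ∀ j, ContDiff ℝ 1 (fj j) := fun j =>
    (ρ j).hasCompactSupport_normed.contDiff_convolution_left (n := 1) _ (ρ j).contDiff_normed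
      hf.locallyIntegrable
  have hPc : ∀ j, Continuous (Pj j) := fun j =>
    (ρ j).hasCompactSupport_normed.continuous_convolution_left _ (ρ j).continuous_normed
      hP.locallyIntegrable
  have hη1 : ContDiff ℝ 1 η := by
    rw [contDiff_one_iff_deriv]
    refine ⟨fun z => (hη z).differentiableAt, ?_⟩
    have : deriv η = g := funext fun z => (hη z).deriv
    rwa [this]
  have hgrad : ∀ j p, spaceGrad (fun q => η (fj j q)) p = g (fj j p) • Pj j p := by
    intro j p
    have hd : HasFDerivAt (fj j) (fderiv ℝ (fj j) p) p :=
      ((hfs j).differentiable one_ne_zero p).hasFDerivAt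
    have hd2 : HasFDerivAt (fun q => η (fj j q)) (g (fj j p) • fderiv ℝ (fj j) p) p :=
      (hη (fj j p)).comp_hasFDerivAt p hd
    rw [spaceGrad_eq_gradCLM hd2.differentiableAt, hd2.fderiv, map_smul,
      ← spaceGrad_eq_gradCLM hd.differentiableAt, h.spaceGrad_convolution hf.locallyIntegrable]
  have key : ∀ j, ∫ p, η (fj j p) • spaceGrad φ p = - ∫ p, φ p • g (fj j p) • Pj j p := by
    intro j
    have := hasWeakSpaceGrad_of_contDiff (hη1.comp (hfs j)) φ hφ
    simpa [Function.comp_def, hgrad] using this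
  obtain ⟨M, hM⟩ := (continuous_spaceGrad (hφ.1.of_le (by simp))).bounded_above_of_compact_support
    hφ.2.1.spaceGrad
  obtain ⟨M', hM'⟩ := hφ.1.continuous.bounded_above_of_compact_support hφ.2.1
  have hηf : AEStronglyMeasurable (fun p => η (f p)) volume :=
    hηc.comp_aestronglyMeasurable hf.1
  -- the left-hand sides converge
  have lim1 : Tendsto (fun j => ∫ p, η (fj j p) • spaceGrad φ p) atTop
      (𝓝 (∫ p, η (f p) • spaceGrad φ p)) := by
    refine tendsto_integral_of_L1 _ (hηf.smul
      (continuous_spaceGrad (hφ.1.of_le (by simp))).aestronglyMeasurable)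
      (Eventually.of_forall fun j => hφ.integrable_smul_spaceGrad
        ((hηc.comp (hfs j).continuous).locallyIntegrable.locallyIntegrableOn _)) ?_
    have hz : Tendsto (fun j => ENNReal.ofReal (C * M) * eLpNorm (fun x => fj j x - f x) 1 volume)
        atTop (𝓝 0) := by
      simpa using ENNReal.Tendsto.const_mul hfL (Or.inr ENNReal.ofReal_ne_top)
    refine tendsto_of_tendsto_of_tendsto_of_le_of_le tendsto_const_nhds hz (fun _ => zero_le)
      fun j => ?_
    simp only [eLpNorm_one_eq_lintegral_enorm]
    rw [← lintegral_const_mul' _ _ ENNReal.ofReal_ne_top]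
    refine lintegral_mono fun p => ?_
    have e : η (fj j p) • spaceGrad φ p - ((fun p => η (f p)) • spaceGrad φ) p
        = (η (fj j p) - η (f p)) • spaceGrad φ p := (sub_smul _ _ _).symm
    rw [e, enorm_smul, ← ofReal_norm, ← ofReal_norm, ← ofReal_norm,
      ← ENNReal.ofReal_mul (norm_nonneg _), ← ENNReal.ofReal_mul
      (mul_nonneg hC0 ((norm_nonneg _).trans (hM p)))]
    refine ENNReal.ofReal_le_ofReal ?_
    calc _ ≤ (C * |fj j p - f p|) * M := by
          refine mul_le_mul (abs_sub_le_of_hasDerivAt_bound hη hC _ _) (hM p) (norm_nonneg _)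
            (by positivity)
      _ = _ := by rw [Real.norm_eq_abs]; ring
  have iP : Integrable (fun p => φ p • P p) :=
    hφ.integrable_smul (hP.locallyIntegrable.locallyIntegrableOn _)
  have iB : ∀ j, Integrable (fun p => φ p • g (fj j p) • P p) := by
    intro j
    have := iP.bdd_smul C ((hg.comp (hfs j).continuous).aestronglyMeasurable)
      (Eventually.of_forall fun p => hC (fj j p))
    refine this.congr (Eventually.of_forall fun p => ?_)
    exact smul_comm (g (fj j p)) (φ p) (P p)
  have iA : ∀ j, Integrable (fun p => φ p • g (fj j p) • (Pj j p - P p)) := by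
    intro j
    have h1 : Integrable (fun p => φ p • g (fj j p) • Pj j p) := hφ.integrable_smul
      (((hg.comp (hfs j).continuous).smul (hPc j)).locallyIntegrable.locallyIntegrableOn _)
    refine (h1.sub (iB j)).congr (Eventually.of_forall fun p => ?_)
    simp [smul_sub]
  have limA : Tendsto (fun j => ∫ p, φ p • g (fj j p) • (Pj j p - P p)) atTop (𝓝 0) := by
    have := tendsto_integral_of_L1 (μ := (volume : Measure (SpaceTime n)))
      (fun _ => (0 : Space n)) aestronglyMeasurable_const
      (F := fun j p => φ p • g (fj j p) • (Pj j p - P p)) (l := atTop)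
      (Eventually.of_forall iA) ?_
    · simpa using this
    have hz : Tendsto (fun j => ENNReal.ofReal (M' * C) * eLpNorm (fun x => Pj j x - P x) 1 volume)
        atTop (𝓝 0) := by
      simpa using ENNReal.Tendsto.const_mul hPL (Or.inr ENNReal.ofReal_ne_top)
    refine tendsto_of_tendsto_of_tendsto_of_le_of_le tendsto_const_nhds hz (fun _ => zero_le)
      fun j => ?_
    simp only [eLpNorm_one_eq_lintegral_enorm, sub_zero]
    rw [← lintegral_const_mul' _ _ ENNReal.ofReal_ne_top]
    refine lintegral_mono fun p => ?_
    have hM0 : 0 ≤ M' := (norm_nonneg _).trans (hM' p)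
    rw [smul_smul, enorm_smul]
    gcongr
    rw [← ofReal_norm]
    refine ENNReal.ofReal_le_ofReal ?_
    rw [norm_mul]
    exact mul_le_mul (hM' p) (hC _) (norm_nonneg _) hM0
  have limB : Tendsto (fun j => ∫ p, φ p • g (fj j p) • P p) atTop
      (𝓝 (∫ p, φ p • g (f p) • P p)) := by
    refine tendsto_integral_of_dominated_convergence (fun p => C * ‖φ p • P p‖)
      (fun j => (iB j).1) (iP.norm.const_mul C) (fun j => Eventually.of_forall fun p => ?_) ?_
    · rw [smul_comm, norm_smul]
      exact mul_le_mul_of_nonneg_right (hC _) (norm_nonneg _)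
    · filter_upwards [hfae] with p hp
      exact (((hg.tendsto _).comp hp).smul_const _).const_smul _
  have lim2 : Tendsto (fun j => ∫ p, φ p • g (fj j p) • Pj j p) atTop
      (𝓝 (∫ p, φ p • g (f p) • P p)) := by
    have := limA.add limB
    rw [zero_add] at this
    refine this.congr fun j => ?_
    rw [← integral_add (iA j) (iB j)]
    refine integral_congr_ae (Eventually.of_forall fun p => ?_)
    simp [smul_sub]
  refine tendsto_nhds_unique lim1 ?_
  simp only [key]
  exact lim2.neg

theorem exists_smooth_cutoff {D K : Set (SpaceTime n)} (hD : IsOpen D) (hK : IsCompact K)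
    (hKD : K ⊆ D) : ∃ χ : SpaceTime n → ℝ, IsTestFunction D χ ∧ ∀ᶠ x in 𝓝ˢ K, χ x = 1 := by
  obtain ⟨t, ht, hKt, htD⟩ := exists_compact_between hK hD hKD
  obtain ⟨χ, h1, h2, -⟩ := exists_contMDiffMap_one_nhds_of_subset_interior (n := ⊤)
    (modelWithCornersSelf ℝ (SpaceTime n)) hK.isClosed hKt
  have hsub : tsupport (χ : SpaceTime n → ℝ) ⊆ t := by
    refine closure_minimal (fun x hx => ?_) ht.isClosed
    by_contra hxt
    exact hx (h2 x hxt)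
  refine ⟨χ, ⟨χ.contMDiff.contDiff, ?_, hsub.trans htD⟩, h1⟩
  exact ht.of_isClosed_subset (isClosed_tsupport _) hsub

/-- The chain rule for weak spatial gradients. -/
theorem HasWeakSpaceGrad.comp {D : Set (SpaceTime n)} (hD : IsOpen D) {f : SpaceTime n → ℝ}
    {P : SpaceTime n → Space n} (h : HasWeakSpaceGrad D f P) (hf : LocallyIntegrableOn f D)
    (hP : LocallyIntegrableOn P D) {η g : ℝ → ℝ}
    (hη : ∀ z, HasDerivAt η (g z) z) (hg : Continuous g) {C : ℝ} (hC : ∀ z, |g z| ≤ C) :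
    HasWeakSpaceGrad D (fun p => η (f p)) (fun p => g (f p) • P p) := by
  intro φ hφ
  -- A cutoff equal to one near the support of `φ` makes the function and its gradient integrable on
  -- all of space-time and changes neither integral against `φ`.
  obtain ⟨χ, hχ, hχ1⟩ := exists_smooth_cutoff hD hφ.2.1 hφ.2.2
  have hw : HasWeakSpaceGrad univ (fun p => χ p * f p)
      (fun p => χ p • P p + f p • spaceGrad χ p) := by
    refine h.mul_smooth hf hP hχ.1 (fun ψ hψ => ?_) (fun ψ hψ => ?_)
    · have := hχ.mul_left hψ.1
      simpa only [mul_comm] using this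
    · have h1 := hχ.integrable_smul_spaceGrad hf
      obtain ⟨M, hM⟩ := hψ.1.continuous.bounded_above_of_compact_support hψ.2.1
      refine (h1.bdd_smul M hψ.1.continuous.aestronglyMeasurable
        (Eventually.of_forall hM)).congr (Eventually.of_forall fun p => ?_)
      exact smul_smul (ψ p) (f p) (spaceGrad χ p)
  have i1 : Integrable (fun p => χ p * f p) := hχ.integrable_smul hf
  have i2 : Integrable (fun p => χ p • P p + f p • spaceGrad χ p) :=
    (hχ.integrable_smul hP).add (hχ.integrable_smul_spaceGrad hf)
  have key := hw.comp_of_integrable i1 i2 hη hg hC φ (hφ.mono (subset_univ _))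
  have hone : ∀ p ∈ tsupport φ, χ p = 1 ∧ spaceGrad χ p = 0 := by
    intro p hp
    have hp1 : ∀ᶠ x in 𝓝 p, χ x = 1 := (eventually_nhdsSet_iff_forall.1 hχ1) p hp
    refine ⟨hp1.self_of_nhds, ?_⟩
    have he : χ =ᶠ[𝓝 p] fun _ => 1 := hp1
    rw [spaceGrad_eq_gradCLM (hχ.1.differentiable (by simp) p), he.fderiv_eq]
    simp
  have e1 : ∀ p, η (χ p * f p) • spaceGrad φ p = η (f p) • spaceGrad φ p := by
    intro p
    by_cases hp : p ∈ tsupport φ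
    · rw [(hone p hp).1, one_mul]
    · rw [spaceGrad_eq_zero_of_notMem_tsupport hp, smul_zero, smul_zero]
  have e2 : ∀ p, φ p • g (χ p * f p) • (χ p • P p + f p • spaceGrad χ p)
      = φ p • g (f p) • P p := by
    intro p
    by_cases hp : p ∈ tsupport φ
    · rw [(hone p hp).1, (hone p hp).2, one_mul, one_smul, smul_zero, add_zero]
    · rw [image_eq_zero_of_notMem_tsupport hp, zero_smul, zero_smul]
  simpa only [e1, e2] using key

/-- The weak gradient vanishes almost everywhere on a level set. -/
theorem HasWeakSpaceGrad.ae_eq_zero_of_eq_zero {D : Set (SpaceTime n)} (hD : IsOpen D)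
    {f : SpaceTime n → ℝ} {P : SpaceTime n → Space n} (h : HasWeakSpaceGrad D f P)
    (hf : LocallyIntegrableOn f D) (hP : LocallyIntegrableOn P D) :
    ∀ᵐ p, p ∈ D → f p = 0 → P p = 0 := by
  -- The functions `e j` tend to the identity while their derivatives `g j` tend to the indicator of
  -- `z ≠ 0`. In the limit the chain rule says that `P` set to zero where `f = 0` is again a weak
  -- gradient of `f`, so it agrees with `P` almost everywhere.
  set e : ℕ → ℝ → ℝ := fun j z => z - Real.arctan (((j : ℝ) + 1) * z) / ((j : ℝ) + 1) with he
  set g : ℕ → ℝ → ℝ := fun j z => 1 - 1 / (1 + (((j : ℝ) + 1) * z) ^ 2) with hg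
  have hder : ∀ j z, HasDerivAt (e j) (g j z) z := by
    intro j z
    have h1 : HasDerivAt (fun z : ℝ => ((j : ℝ) + 1) * z) ((j : ℝ) + 1) z := by
      simpa using (hasDerivAt_id z).const_mul ((j : ℝ) + 1)
    have h2 := ((h1.arctan).div_const ((j : ℝ) + 1))
    have h3 := (hasDerivAt_id z).sub h2
    have hj : ((j : ℝ) + 1) ≠ 0 := by positivity
    rw [mul_div_cancel_right₀ _ hj] at h3
    exact h3
  have hgc : ∀ j, Continuous (g j) := by
    intro j
    refine continuous_const.sub (continuous_const.div ?_ ?_)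
    · fun_prop
    · intro z
      positivity
  have hgb : ∀ j z, |g j z| ≤ 1 := by
    intro j z
    have h1 : 0 < 1 / (1 + (((j : ℝ) + 1) * z) ^ 2) := by positivity
    have h2 : 1 / (1 + (((j : ℝ) + 1) * z) ^ 2) ≤ 1 := by
      rw [div_le_one (by positivity)]
      nlinarith [sq_nonneg (((j : ℝ) + 1) * z)]
    rw [abs_le]
    constructor <;> simp only [hg] <;> linarith
  have hjinf : Tendsto (fun j : ℕ => (j : ℝ) + 1) atTop atTop :=
    tendsto_natCast_atTop_atTop.atTop_add tendsto_const_nhds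
  have hel : ∀ z, Tendsto (fun j => e j z) atTop (𝓝 z) := by
    intro z
    have : Tendsto (fun j : ℕ => Real.arctan (((j : ℝ) + 1) * z) / ((j : ℝ) + 1)) atTop (𝓝 0) := by
      have h0 : Tendsto (fun j : ℕ => (Real.pi / 2) / ((j : ℝ) + 1)) atTop (𝓝 0) :=
        tendsto_const_nhds.div_atTop hjinf
      refine squeeze_zero_norm (fun j => ?_) h0
      have hj : (0 : ℝ) < (j : ℝ) + 1 := by positivity
      rw [norm_div, Real.norm_eq_abs, Real.norm_eq_abs, abs_of_pos hj]
      gcongr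
      rw [abs_le]
      exact ⟨(Real.neg_pi_div_two_lt_arctan _).le, (Real.arctan_lt_pi_div_two _).le⟩
    simpa using tendsto_const_nhds.sub this
  have heb : ∀ j z, |e j z| ≤ 1 * |z| := by
    intro j z
    have := abs_sub_le_of_hasDerivAt_bound (hder j) (hgb j) z 0
    simpa [he] using this
  have hgl : ∀ z, Tendsto (fun j => g j z) atTop (𝓝 (if z = 0 then 0 else 1)) := by
    intro z
    split_ifs with hz
    · simp [hg, hz]
    · have : Tendsto (fun j : ℕ => 1 / (1 + (((j : ℝ) + 1) * z) ^ 2)) atTop (𝓝 0) := by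
        refine tendsto_const_nhds.div_atTop (tendsto_atTop_add_const_left _ _ ?_)
        have h1 : Tendsto (fun j : ℕ => ((j : ℝ) + 1) ^ 2 * z ^ 2) atTop atTop :=
          ((tendsto_pow_atTop two_ne_zero).comp hjinf).atTop_mul_const (by positivity)
        simpa only [mul_pow] using h1
      simpa only [sub_zero] using this.const_sub 1
  have hQ : LocallyIntegrableOn (fun p => (if f p = 0 then (0 : ℝ) else 1) • P p) D := by
    refine hP.bdd_smul_left (C := 1) ?_ (fun p => ?_)
    · refine (Measurable.ite (measurableSet_singleton 0) measurable_const
        measurable_const).comp_aemeasurable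
        (g := fun z : ℝ => if z = 0 then (0 : ℝ) else 1) ?_ |>.aestronglyMeasurable
      exact hf.aestronglyMeasurable.aemeasurable
    · split_ifs <;> simp
  have hfin : ∀ φ, IsTestFunction D φ →
      ∫ p, φ p • (P p - (if f p = 0 then (0 : ℝ) else 1) • P p) = 0 := by
    intro φ hφ
    have iP := hφ.integrable_smul hP
    have iff := hφ.integrable_smul_spaceGrad hf
    have hfm : AEStronglyMeasurable f (volume.restrict D) := hf.aestronglyMeasurable
    have hgP : ∀ j, LocallyIntegrableOn (fun p => g j (f p) • P p) D := fun j =>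
      hP.bdd_smul_left ((hgc j).comp_aestronglyMeasurable hfm)
        (fun p => hgb j (f p))
    have hef : ∀ j, LocallyIntegrableOn (fun p => e j (f p)) D := by
      intro j
      have hec : Continuous (e j) :=
        continuous_iff_continuousAt.2 fun z => (hder j z).continuousAt
      refine hf.mono_restrict (hec.comp_aestronglyMeasurable hfm) (fun p => ?_)
      simpa using heb j (f p)
    have key := fun j => h.comp hD hf hP (hder j) (hgc j) (hgb j) φ hφ
    have lim1 : Tendsto (fun j => ∫ p, e j (f p) • spaceGrad φ p) atTop
        (𝓝 (∫ p, f p • spaceGrad φ p)) := by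
      refine tendsto_integral_of_dominated_convergence (fun p => ‖f p • spaceGrad φ p‖)
        (fun j => (hφ.integrable_smul_spaceGrad (hef j)).1) iff.norm
        (fun j => Eventually.of_forall fun p => ?_) (Eventually.of_forall fun p => ?_)
      · rw [norm_smul, norm_smul]
        gcongr
        simpa using heb j (f p)
      · exact (hel (f p)).smul_const _
    have lim2 : Tendsto (fun j => ∫ p, φ p • g j (f p) • P p) atTop
        (𝓝 (∫ p, φ p • (if f p = 0 then (0 : ℝ) else 1) • P p)) := by
      refine tendsto_integral_of_dominated_convergence (fun p => ‖φ p • P p‖)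
        (fun j => (hφ.integrable_smul (hgP j)).1) iP.norm
        (fun j => Eventually.of_forall fun p => ?_) (Eventually.of_forall fun p => ?_)
      · rw [smul_comm, norm_smul]
        exact mul_le_of_le_one_left (norm_nonneg _) (hgb j (f p))
      · exact ((hgl (f p)).smul_const _).const_smul _
    have h1 : ∫ p, f p • spaceGrad φ p
        = - ∫ p, φ p • (if f p = 0 then (0 : ℝ) else 1) • P p := by
      refine tendsto_nhds_unique lim1 ?_
      simp only [key]
      exact lim2.neg
    have h2 := h φ hφ
    rw [h1, neg_inj] at h2
    have i2 : Integrable (fun p => φ p • (if f p = 0 then (0 : ℝ) else 1) • P p) :=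
      hφ.integrable_smul (hQ)
    simp only [smul_sub]
    rw [integral_sub iP i2, h2, sub_self]
  have hz := hD.ae_eq_zero_of_integral_contDiff_smul_eq_zero (hP.sub hQ)
    (fun φ h1 h2 h3 => hfin φ ⟨h1, h2, h3⟩)
  filter_upwards [hz] with p hp hpD hp0
  have := hp hpD
  simpa [hp0] using this

end ChainRule

/-! ### The fundamental theorem of calculus for weak derivatives in one variable. -/

section WeakDerivativeInTime

theorem deriv_smoothTransition_eq_zero {x : ℝ} (hx : x ∉ Icc (0 : ℝ) 1) :
    deriv Real.smoothTransition x = 0 := by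
  rw [mem_Icc, not_and_or, not_le, not_le] at hx
  rcases hx with hx | hx
  · have : Real.smoothTransition =ᶠ[𝓝 x] fun _ => 0 := by
      filter_upwards [gt_mem_nhds hx] with y hy
      exact Real.smoothTransition.zero_of_nonpos (le_of_lt hy)
    rw [this.deriv_eq, deriv_const]
  · have : Real.smoothTransition =ᶠ[𝓝 x] fun _ => 1 := by
      filter_upwards [lt_mem_nhds hx] with y hy
      exact Real.smoothTransition.one_of_one_le (le_of_lt hy)
    rw [this.deriv_eq, deriv_const]

theorem continuous_deriv_smoothTransition : Continuous (deriv Real.smoothTransition) :=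
  (Real.smoothTransition.contDiff (n := 1)).continuous_deriv le_rfl

theorem hasCompactSupport_deriv_smoothTransition :
    HasCompactSupport (deriv Real.smoothTransition) :=
  HasCompactSupport.intro isCompact_Icc fun _ hx => deriv_smoothTransition_eq_zero hx

theorem integral_deriv_smoothTransition : ∫ x, deriv Real.smoothTransition x = 1 := by
  have h1 : ∫ x in (0 : ℝ)..1, deriv Real.smoothTransition x = 1 := by
    rw [intervalIntegral.integral_deriv_eq_sub
      (fun x _ => (Real.smoothTransition.contDiff (n := 1)).differentiable one_ne_zero x)
      (continuous_deriv_smoothTransition.intervalIntegrable _ _)]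
    simp
  rw [intervalIntegral.integral_of_le zero_le_one, ← integral_Icc_eq_integral_Ioc] at h1
  rw [← h1]
  refine (setIntegral_eq_integral_of_forall_compl_eq_zero fun x hx => ?_).symm
  exact deriv_smoothTransition_eq_zero hx

/-- Rescaled derivatives of the smooth transition are an approximate identity. -/
theorem tendsto_integral_smoothTransition {f : ℝ → ℝ} (hf : Continuous f) (a : ℝ) :
    Tendsto (fun j : ℕ => ∫ r, f r * (((j : ℝ) + 1) *
      deriv Real.smoothTransition (((j : ℝ) + 1) * (r - a)))) atTop (𝓝 (f a)) := by
  set d := deriv Real.smoothTransition with hd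
  have hdc : Continuous d := continuous_deriv_smoothTransition
  have hdi : Integrable d := hdc.integrable_of_hasCompactSupport
    hasCompactSupport_deriv_smoothTransition
  have e : ∀ j : ℕ, ∫ r, f r * (((j : ℝ) + 1) * d (((j : ℝ) + 1) * (r - a)))
      = ∫ x, f (a + x / ((j : ℝ) + 1)) * d x := by
    intro j
    have hj : (0 : ℝ) < (j : ℝ) + 1 := by positivity
    have h2 := Measure.integral_comp_mul_left (fun x => f (a + x / ((j : ℝ) + 1)) * d x)
      ((j : ℝ) + 1)
    rw [abs_of_pos (inv_pos.2 hj), smul_eq_mul] at h2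
    have h3 : ∫ x, f (a + x / ((j : ℝ) + 1)) * d x
        = ((j : ℝ) + 1) * ∫ x, f (a + (((j : ℝ) + 1) * x) / ((j : ℝ) + 1))
          * d (((j : ℝ) + 1) * x) := by
      rw [h2]; field_simp
    rw [h3, ← integral_const_mul, ← integral_sub_right_eq_self (fun x => ((j : ℝ) + 1) *
      (f (a + (((j : ℝ) + 1) * x) / ((j : ℝ) + 1)) * d (((j : ℝ) + 1) * x))) a]
    refine integral_congr_ae (Eventually.of_forall fun x => ?_)
    simp only
    rw [mul_div_cancel_left₀ _ hj.ne', add_sub_cancel]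
    ring
  simp only [e]
  obtain ⟨M, hM⟩ := isCompact_Icc.exists_bound_of_continuousOn
    (s := Icc a (a + 1)) hf.continuousOn
  have hlim : Tendsto (fun j : ℕ => ∫ x, f (a + x / ((j : ℝ) + 1)) * d x) atTop
      (𝓝 (∫ x, f a * d x)) := by
    refine tendsto_integral_of_dominated_convergence (fun x => M * ‖d x‖) (fun j => ?_)
      (hdi.norm.const_mul M) (fun j => Eventually.of_forall fun x => ?_)
      (Eventually.of_forall fun x => ?_)
    · exact (Continuous.mul (hf.comp (by fun_prop)) hdc).aestronglyMeasurable
    · rw [norm_mul]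
      by_cases hx : x ∈ Icc (0 : ℝ) 1
      · refine mul_le_mul_of_nonneg_right (hM _ ?_) (norm_nonneg _)
        have hj : (1 : ℝ) ≤ (j : ℝ) + 1 := by
          have : (0 : ℝ) ≤ j := Nat.cast_nonneg j
          linarith
        have h1 : 0 ≤ x / ((j : ℝ) + 1) := div_nonneg hx.1 (by linarith)
        have h2 : x / ((j : ℝ) + 1) ≤ 1 := by
          rw [div_le_one (by linarith)]
          linarith [hx.2]
        constructor <;> linarith
      · rw [hd, deriv_smoothTransition_eq_zero hx]
        simp
    · refine Tendsto.mul_const _ ((hf.tendsto a).comp ?_)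
      have : Tendsto (fun j : ℕ => x / ((j : ℝ) + 1)) atTop (𝓝 0) :=
        tendsto_const_nhds.div_atTop
          (tendsto_natCast_atTop_atTop.atTop_add tendsto_const_nhds)
      simpa using this.const_add a
  rwa [integral_const_mul, integral_deriv_smoothTransition, mul_one] at hlim

/-- The hypothesis says `f' = -g` weakly. It is tested with smooth approximations of the indicator
of `(s, t]`, whose derivatives are approximate identities at `s` and at `t`; continuity of `f`
identifies the limits there. -/
theorem sub_eq_neg_integral_of_weak_deriv {f g : ℝ → ℝ} (hf : ContinuousOn f (Ioi 0))
    (hg : ∀ T : ℝ, 0 < T → IntegrableOn g (Ioo 0 T))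
    (hw : ∀ η : ℝ → ℝ, ContDiff ℝ ∞ η → HasCompactSupport η → tsupport η ⊆ Ioi 0 →
      ∫ r, (g r * η r - f r * deriv η r) = 0) {s t : ℝ} (hs : 0 < s) (hst : s < t) :
    f t - f s = - ∫ r in s..t, g r := by
  set θ := Real.smoothTransition with hθ
  have hθs : ContDiff ℝ ∞ θ := Real.smoothTransition.contDiff
  have hθd : ∀ x, HasDerivAt θ (deriv θ x) x := fun x =>
    (hθs.differentiable (by simp) x).hasDerivAt
  set c : ℕ → ℝ := fun j => (j : ℝ) + 1 with hc
  have hc1 : ∀ j, 1 ≤ c j := fun j => by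
    have : (0 : ℝ) ≤ j := Nat.cast_nonneg j
    simp only [hc]; linarith
  have hcinf : Tendsto c atTop atTop := tendsto_natCast_atTop_atTop.atTop_add tendsto_const_nhds
  set η : ℕ → ℝ → ℝ := fun j r => θ (c j * (r - s)) - θ (c j * (r - t)) with hη
  have hηs : ∀ j, ContDiff ℝ ∞ (η j) := fun j =>
    (hθs.comp (contDiff_const.mul (contDiff_id.sub contDiff_const))).sub
      (hθs.comp (contDiff_const.mul (contDiff_id.sub contDiff_const)))
  have hηd : ∀ j r, deriv (η j) r
      = c j * deriv θ (c j * (r - s)) - c j * deriv θ (c j * (r - t)) := by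
    intro j r
    have h1 : ∀ a, HasDerivAt (fun r => θ (c j * (r - a))) (c j * deriv θ (c j * (r - a))) r := by
      intro a
      have h2 : HasDerivAt (fun r => c j * (r - a)) (c j) r := by
        simpa using ((hasDerivAt_id r).sub_const a).const_mul (c j)
      have h3 := (hθd (c j * (r - a))).comp r h2
      rw [mul_comm] at h3
      exact h3
    exact ((h1 s).sub (h1 t)).deriv
  -- As `c j ≥ 1`, both transitions are complete by time `t + 1`; this gives a compact support
  -- common to all `j`.
  have hη0 : ∀ j r, r ∉ Icc s (t + 1) → η j r = 0 := by
    intro j r hr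
    have hcj := hc1 j
    rw [mem_Icc, not_and_or, not_le, not_le] at hr
    rcases hr with hr | hr
    · simp only [hη]
      rw [hθ, Real.smoothTransition.zero_of_nonpos (by nlinarith),
        Real.smoothTransition.zero_of_nonpos (by nlinarith), sub_zero]
    · simp only [hη]
      rw [hθ, Real.smoothTransition.one_of_one_le (by nlinarith),
        Real.smoothTransition.one_of_one_le (by nlinarith), sub_self]
  have hηts : ∀ j, tsupport (η j) ⊆ Icc s (t + 1) := fun j =>
    closure_minimal (fun r hr => by
      by_contra h
      exact hr (hη0 j r h)) isClosed_Icc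
  have hηc : ∀ j, HasCompactSupport (η j) := fun j =>
    HasCompactSupport.intro isCompact_Icc (hη0 j)
  have hηb : ∀ j r, |η j r| ≤ 1 := by
    intro j r
    have h1 := Real.smoothTransition.nonneg (c j * (r - s))
    have h2 := Real.smoothTransition.le_one (c j * (r - s))
    have h3 := Real.smoothTransition.nonneg (c j * (r - t))
    have h4 := Real.smoothTransition.le_one (c j * (r - t))
    rw [abs_le]
    constructor <;> simp only [hη, hθ] <;> linarith
  -- a continuous extension of `f` from `[s, ∞)`
  set F : ℝ → ℝ := fun r => f (max r s) with hF
  have hFc : Continuous F := by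
    refine ContinuousOn.comp_continuous hf (by fun_prop) fun r => ?_
    exact lt_of_lt_of_le hs (le_max_right r s)
  have hfF : ∀ j r, f r * deriv (η j) r = F r * deriv (η j) r := by
    intro j r
    by_cases hr : r ∈ Icc s (t + 1)
    · simp only [hF, max_eq_left hr.1]
    · have : deriv (η j) r = 0 := by
        have h1 : r ∉ tsupport (η j) := fun h => hr (hηts j h)
        have h2 : η j =ᶠ[𝓝 r] fun _ => 0 := notMem_tsupport_iff_eventuallyEq.1 h1
        rw [h2.deriv_eq, deriv_const]
      rw [this, mul_zero, mul_zero]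
  have hgi : IntegrableOn g (Icc s (t + 1)) :=
    (hg (t + 2) (by linarith)).mono_set fun r hr => ⟨by linarith [hr.1], by linarith [hr.2]⟩
  have hgη : ∀ j, Integrable (fun r => g r * η j r) := by
    intro j
    rw [← integrableOn_iff_integrable_of_support_subset (s := Icc s (t + 1))]
    · exact Integrable.mul_bdd (c := 1) hgi
        (hηs j).continuous.aestronglyMeasurable (Eventually.of_forall (hηb j))
    · intro r hr
      by_contra h
      exact hr (by simp [hη0 j r h])
  have hFη : ∀ j, Integrable (fun r => F r * deriv (η j) r) := fun j =>
    (hFc.mul ((hηs j).continuous_deriv (by simp))).integrable_of_hasCompactSupport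
      ((hηc j).deriv.mul_left)
  have key : ∀ j, ∫ r, g r * η j r = ∫ r, F r * deriv (η j) r := by
    intro j
    have := hw (η j) (hηs j) (hηc j) ((hηts j).trans fun r hr => lt_of_lt_of_le hs hr.1)
    simp only [hfF] at this
    rw [integral_sub (hgη j) (hFη j)] at this
    linarith
  have lim1 : Tendsto (fun j => ∫ r, F r * deriv (η j) r) atTop (𝓝 (F s - F t)) := by
    have h := (tendsto_integral_smoothTransition hFc s).sub
      (tendsto_integral_smoothTransition hFc t)
    refine h.congr fun j => ?_
    have hi : ∀ a, Integrable (fun r => F r * (c j * deriv θ (c j * (r - a)))) := by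
      intro a
      have hcj : c j ≠ 0 := (lt_of_lt_of_le one_pos (hc1 j)).ne'
      refine Continuous.integrable_of_hasCompactSupport ?_ ?_
      · exact hFc.mul (continuous_const.mul (continuous_deriv_smoothTransition.comp
          (by fun_prop)))
      · refine HasCompactSupport.mul_left ?_
        refine HasCompactSupport.mul_left (f := fun _ => c j) ?_
        exact hasCompactSupport_deriv_smoothTransition.comp_homeomorph
          ((Homeomorph.subRight a).trans (Homeomorph.mulLeft₀ (c j) hcj))
    rw [← integral_sub (hi s) (hi t)]
    refine integral_congr_ae (Eventually.of_forall fun r => ?_)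
    simp only [hηd]
    ring
  have lim2 : Tendsto (fun j => ∫ r, g r * η j r) atTop (𝓝 (∫ r in s..t, g r)) := by
    have : ∫ r in s..t, g r = ∫ r, (Ioc s t).indicator g r := by
      rw [intervalIntegral.integral_of_le hst.le, integral_indicator measurableSet_Ioc]
    rw [this]
    refine tendsto_integral_of_dominated_convergence
      (fun r => (Icc s (t + 1)).indicator (fun r => ‖g r‖) r) (fun j => (hgη j).1)
      ((integrable_indicator_iff measurableSet_Icc).2 hgi.norm)
      (fun j => Eventually.of_forall fun r => ?_) (Eventually.of_forall fun r => ?_)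
    · by_cases hr : r ∈ Icc s (t + 1)
      · rw [indicator_of_mem hr, norm_mul]
        exact mul_le_of_le_one_right (norm_nonneg _) (hηb j r)
      · rw [indicator_of_notMem hr, hη0 j r hr]; simp
    · have hstep : ∀ a, Tendsto (fun j => θ (c j * (r - a))) atTop
          (𝓝 (if a < r then 1 else 0)) := by
        intro a
        split_ifs with h
        · have h1 : Tendsto (fun j => c j * (r - a)) atTop atTop :=
            hcinf.atTop_mul_const (sub_pos.2 h)
          refine tendsto_const_nhds.congr' ?_
          filter_upwards [h1.eventually_ge_atTop 1] with j hj
          exact (Real.smoothTransition.one_of_one_le hj).symm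
        · refine tendsto_const_nhds.congr fun j => ?_
          refine (Real.smoothTransition.zero_of_nonpos ?_).symm
          exact mul_nonpos_of_nonneg_of_nonpos (by linarith [hc1 j]) (by linarith)
      have h := (((hstep s).sub (hstep t)).const_mul (g r))
      have e : (Ioc s t).indicator g r
          = g r * ((if s < r then 1 else 0) - (if t < r then 1 else 0)) := by
        by_cases h1 : s < r
        · by_cases h2 : t < r
          · rw [indicator_of_notMem (by simp [h2])]; simp [h1, h2]
          · rw [indicator_of_mem (by exact ⟨h1, not_lt.1 h2⟩)]; simp [h1, h2]
        · rw [indicator_of_notMem (by simp [h1])]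
          simp [h1, show ¬ t < r by linarith]
      rw [e]
      exact h
  simp only [key] at lim2
  have := tendsto_nhds_unique lim1 lim2
  simp only [hF, max_self, max_eq_left hst.le] at this
  linarith

end WeakDerivativeInTime

/-! ### Distributional solutions of `uₜ = ∇ · F`: slices and extension to negative times. -/

section FluxSolution

variable {n : ℕ}

theorem continuous_gradient {ψ : Space n → ℝ} (h : ContDiff ℝ 1 ψ) : Continuous (gradient ψ) :=
  (InnerProductSpace.toDual ℝ (Space n)).symm.continuous.comp (h.continuous_fderiv one_ne_zero)

theorem HasCompactSupport.gradient {ψ : Space n → ℝ} (h : HasCompactSupport ψ) :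
    HasCompactSupport (gradient ψ) :=
  (h.fderiv (𝕜 := ℝ)).comp_left (g := (InnerProductSpace.toDual ℝ (Space n)).symm) (map_zero _)

theorem restrict_prod_univ (s : Set ℝ) :
    (volume : Measure (SpaceTime n)).restrict (s ×ˢ univ)
      = (volume.restrict s).prod (volume : Measure (Space n)) := by
  rw [Measure.volume_eq_prod, ← Measure.prod_restrict, Measure.restrict_univ]

theorem MeasureTheory.MemLp.integrable_inner {X V : Type*} [MeasurableSpace X] {μ : Measure X}
    [NormedAddCommGroup V] [InnerProductSpace ℝ V] {f g : X → V} (hf : MemLp f 2 μ)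
    (hg : MemLp g 2 μ) : Integrable (fun x => inner ℝ (f x) (g x)) μ := by
  refine Integrable.mono' (hf.norm.integrable_mul hg.norm) (hf.1.inner hg.1)
    (Eventually.of_forall fun x => ?_)
  exact norm_inner_le_norm _ _

/-- `u` is a nonnegative distributional solution of `uₜ = ∇ · F` with initial datum `u₀` and a
square integrable flux `F`. -/
structure IsFluxSolution (u : SpaceTime n → ℝ) (u₀ : Space n → ℝ)
    (F : SpaceTime n → Space n) : Prop where
  nonneg : ∀ t : ℝ, 0 < t → ∀ x, 0 ≤ u (t, x)
  nonneg_init : ∀ x, 0 ≤ u₀ x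
  locallyIntegrableOn : LocallyIntegrableOn u (Ioi 0 ×ˢ univ)
  memLp_flux : ∀ T : ℝ, 0 < T → MemLp F 2 (volume.restrict (Ioo 0 T ×ˢ univ))
  datum : HasInitialDatum u u₀
  integral_eq_zero : ∀ φ : SpaceTime n → ℝ, IsTestFunction (Ioi 0 ×ˢ univ) φ →
    ∫ p, (inner ℝ (F p) (spaceGrad φ p) - u p * timeDeriv φ p) = 0

namespace IsFluxSolution

variable {u : SpaceTime n → ℝ} {u₀ : Space n → ℝ} {F : SpaceTime n → Space n}

theorem integrableOn_inner_snd (h : IsFluxSolution u u₀ F) {T : ℝ} (hT : 0 < T)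
    {Z : Space n → Space n} (hZ : MemLp Z 2 volume) :
    IntegrableOn (fun p => inner ℝ (F p) (Z p.2)) (Ioo 0 T ×ˢ univ) := by
  refine (h.memLp_flux T hT).integrable_inner ?_
  rw [restrict_prod_univ]
  exact hZ.comp_snd _

theorem integrableOn_integral_inner (h : IsFluxSolution u u₀ F) {T : ℝ} (hT : 0 < T)
    {Z : Space n → Space n} (hZ : MemLp Z 2 volume) :
    IntegrableOn (fun t : ℝ => ∫ x, inner ℝ (F (t, x)) (Z x)) (Ioo 0 T) := by
  have := h.integrableOn_inner_snd hT hZ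
  rw [IntegrableOn, restrict_prod_univ] at this
  exact this.integral_prod_left

theorem memLp_gradient {ψ : Space n → ℝ} (hψ : ContDiff ℝ ∞ ψ) (hc : HasCompactSupport ψ) :
    MemLp (gradient ψ) 2 volume :=
  (continuous_gradient (hψ.of_le (by simp))).memLp_of_hasCompactSupport hc.gradient

theorem isTestFunction_mul {η : ℝ → ℝ} {ψ : Space n → ℝ} (hη : ContDiff ℝ ∞ η)
    (hηc : HasCompactSupport η) (hηs : tsupport η ⊆ Ioi 0) (hψ : ContDiff ℝ ∞ ψ)
    (hψc : HasCompactSupport ψ) :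
    IsTestFunction (Ioi 0 ×ˢ univ) (fun p : SpaceTime n => η p.1 * ψ p.2) := by
  have hsub : tsupport (fun p : SpaceTime n => η p.1 * ψ p.2) ⊆ tsupport η ×ˢ tsupport ψ := by
    refine closure_minimal (fun p hp => ?_) ((isClosed_tsupport η).prod (isClosed_tsupport ψ))
    refine ⟨subset_tsupport _ fun h0 => hp ?_, subset_tsupport _ fun h0 => hp ?_⟩ <;> simp [h0]
  refine ⟨(hη.comp contDiff_fst).mul (hψ.comp contDiff_snd), ?_, ?_⟩
  · exact (hηc.isCompact.prod hψc.isCompact).of_isClosed_subset (isClosed_tsupport _) hsub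
  · exact fun p hp => ⟨hηs (hsub hp).1, mem_univ _⟩

/-- The pairing of a slice with a test function changes by the flux through the test function. -/
theorem slice_sub (h : IsFluxSolution u u₀ F) {ψ : Space n → ℝ} (hψ : ContDiff ℝ ∞ ψ)
    (hψc : HasCompactSupport ψ) {s t : ℝ} (hs : 0 < s) (hst : s < t) :
    (∫ x, u (t, x) * ψ x) - ∫ x, u (s, x) * ψ x
      = - ∫ r in s..t, ∫ x, inner ℝ (F (r, x)) (gradient ψ x) := by
  refine sub_eq_neg_integral_of_weak_deriv (h.datum.slice_continuous ψ hψ hψc)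
    (fun T hT => h.integrableOn_integral_inner hT (memLp_gradient hψ hψc)) ?_ hs hst
  intro η hη hηc hηs
  -- Test functions `η(t) ψ(x)` turn the equation, by Fubini, into a weak ordinary differential
  -- equation for the pairing of the slices with `ψ`.
  have hφ := isTestFunction_mul hη hηc hηs hψ hψc
  set φ : SpaceTime n → ℝ := fun p => η p.1 * ψ p.2 with hφd
  have hw := h.integral_eq_zero φ hφ
  have e1 : ∀ p : SpaceTime n, spaceGrad φ p = η p.1 • gradient ψ p.2 := by
    intro p
    have hd : DifferentiableAt ℝ ψ p.2 := hψ.differentiable (by simp) p.2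
    simp only [spaceGrad, hφd]
    simp only [gradient]
    rw [fderiv_const_mul hd, map_smulₛₗ]
    simp
  have e2 : ∀ p : SpaceTime n, timeDeriv φ p = deriv η p.1 * ψ p.2 := by
    intro p
    simp only [timeDeriv, hφd]
    exact deriv_mul_const (hη.differentiable (by simp) p.1) _
  simp only [e1, e2] at hw
  obtain ⟨T, hT⟩ : ∃ T : ℝ, 0 < T ∧ tsupport η ⊆ Ioo 0 T := by
    obtain ⟨T, hT⟩ := hηc.isCompact.bddAbove
    refine ⟨max T 0 + 1, by positivity, fun r hr => ⟨hηs hr, ?_⟩⟩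
    have := hT hr
    linarith [le_max_left T 0]
  have hηz : ∀ r, r ∉ Ioo 0 T → η r = 0 := fun r hr =>
    image_eq_zero_of_notMem_tsupport fun h' => hr (hT.2 h')
  obtain ⟨M, hM⟩ := hη.continuous.bounded_above_of_compact_support hηc
  have i1 : Integrable (fun p : SpaceTime n => inner ℝ (F p) (η p.1 • gradient ψ p.2)) := by
    rw [← integrableOn_iff_integrable_of_support_subset (s := Ioo 0 T ×ˢ univ)]
    · have h1 := h.integrableOn_inner_snd hT.1 (memLp_gradient hψ hψc)
      have h2 := Integrable.bdd_smul h1 (φ := fun p : SpaceTime n => η p.1) M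
        (hη.continuous.comp continuous_fst).aestronglyMeasurable
        (Eventually.of_forall fun p => hM p.1)
      refine h2.congr (Eventually.of_forall fun p => ?_)
      simp [inner_smul_right]
    · intro p hp
      by_contra h'
      refine hp ?_
      have : p.1 ∉ Ioo 0 T := fun h'' => h' ⟨h'', mem_univ _⟩
      simp [hηz _ this]
  have i2 : Integrable (fun p : SpaceTime n => u p * (deriv η p.1 * ψ p.2)) := by
    have hφ' := isTestFunction_mul (n := n) (hη.iterate_deriv 1) hηc.deriv
      ((tsupport_deriv_subset).trans hηs) hψ hψc
    have := hφ'.integrable_smul h.locallyIntegrableOn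
    refine this.congr (Eventually.of_forall fun p => ?_)
    simp [mul_comm]
  rw [Measure.volume_eq_prod, integral_prod _ (by
    rw [← Measure.volume_eq_prod]; exact i1.sub i2)] at hw
  rw [← hw]
  have i1' := i1; have i2' := i2
  rw [Measure.volume_eq_prod] at i1' i2'
  refine integral_congr_ae ?_
  filter_upwards [i1'.prod_right_ae, i2'.prod_right_ae] with r h1 h2
  rw [integral_sub h1 h2]
  congr 1
  · rw [mul_comm, ← integral_const_mul]
    refine integral_congr_ae (Eventually.of_forall fun x => ?_)
    simp [inner_smul_right]
  · rw [← integral_mul_const]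
    refine integral_congr_ae (Eventually.of_forall fun x => ?_)
    simp only
    ring

/-- The identity between times `s` and `t` as `s → 0`: the pairing with `ψ` converges by the initial
condition, the flux integral because the flux pairing is integrable up to time zero. -/
theorem slice_eq (h : IsFluxSolution u u₀ F) {ψ : Space n → ℝ} (hψ : ContDiff ℝ ∞ ψ)
    (hψc : HasCompactSupport ψ) {t : ℝ} (ht : 0 < t) :
    ∫ x, u (t, x) * ψ x
      = (∫ x, u₀ x * ψ x) - ∫ r in (0 : ℝ)..t, ∫ x, inner ℝ (F (r, x)) (gradient ψ x) := by
  set g : ℝ → ℝ := fun r => ∫ x, inner ℝ (F (r, x)) (gradient ψ x) with hg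
  have hgi : IntegrableOn g (Ioo 0 (t + 1)) :=
    h.integrableOn_integral_inner (by linarith) (memLp_gradient hψ hψc)
  have hgint : IntervalIntegrable g volume 0 t := by
    rw [intervalIntegrable_iff_integrableOn_Ioc_of_le ht.le]
    exact hgi.mono_set fun r hr => ⟨hr.1, by linarith [hr.2]⟩
  have lim1 := h.datum.tendsto_initial ψ hψ hψc
  have lim2 : Tendsto (fun s => ∫ r in s..t, g r) (𝓝[>] 0) (𝓝 (∫ r in (0 : ℝ)..t, g r)) := by
    have hc : ContinuousOn (fun s => ∫ r in s..t, g r) (uIcc 0 t) :=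
      intervalIntegral.continuousOn_primitive_interval_left (by
        rw [uIcc_of_le ht.le, integrableOn_Icc_iff_integrableOn_Ioc]
        exact (intervalIntegrable_iff_integrableOn_Ioc_of_le ht.le).1 hgint)
    have h1 := (hc 0 left_mem_uIcc).tendsto
    refine h1.mono_left ?_
    rw [uIcc_of_le ht.le, ← nhdsWithin_Ioc_eq_nhdsGT ht]
    exact nhdsWithin_mono _ Ioc_subset_Icc_self
  have lim3 : Tendsto (fun s => (∫ x, u (s, x) * ψ x) - ∫ r in s..t, g r) (𝓝[>] 0)
      (𝓝 ((∫ x, u₀ x * ψ x) - ∫ r in (0 : ℝ)..t, g r)) := lim1.sub lim2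
  refine tendsto_nhds_unique (tendsto_const_nhds.congr' ?_) lim3
  filter_upwards [Ioo_mem_nhdsGT ht] with s hs
  have := h.slice_sub hψ hψc hs.1 hs.2
  linarith

theorem slice_integrable (h : IsFluxSolution u u₀ F) {ψ : Space n → ℝ} (hψ : Continuous ψ)
    (hψc : HasCompactSupport ψ) {t : ℝ} (ht : 0 < t) : Integrable (fun x => u (t, x) * ψ x) := by
  have := (h.datum.slice_locallyIntegrable t ht).integrable_smul_left_of_hasCompactSupport hψ hψc
  refine this.congr (Eventually.of_forall fun x => ?_)
  simp [mul_comm]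

/-- Integrability down to `t = 0`, which local integrability on `t > 0` does not provide. By
nonnegativity the `L¹` norm of a slice against `ψ` is its pairing with `ψ`, and `slice_eq` bounds
that by the initial pairing plus the total flux. -/
theorem integrableOn_mul_snd (h : IsFluxSolution u u₀ F) {ψ : Space n → ℝ} (hψ : ContDiff ℝ ∞ ψ)
    (hψc : HasCompactSupport ψ) (hψ0 : ∀ x, 0 ≤ ψ x) {T : ℝ} (hT : 0 < T) :
    IntegrableOn (fun p => u p * ψ p.2) (Ioo 0 T ×ˢ univ) := by
  have hum : AEStronglyMeasurable u (volume.restrict (Ioo 0 T ×ˢ univ)) :=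
    h.locallyIntegrableOn.aestronglyMeasurable.mono_measure
      (Measure.restrict_mono (prod_mono Ioo_subset_Ioi_self subset_rfl) le_rfl)
  have hm : AEStronglyMeasurable (fun p => u p * ψ p.2) (volume.restrict (Ioo 0 T ×ˢ univ)) :=
    hum.mul (hψ.continuous.comp continuous_snd).aestronglyMeasurable
  set g : ℝ → ℝ := fun r => ∫ x, inner ℝ (F (r, x)) (gradient ψ x) with hg
  have hgi : IntegrableOn g (Ioo 0 T) :=
    h.integrableOn_integral_inner hT (memLp_gradient hψ hψc)
  rw [IntegrableOn, restrict_prod_univ] at *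
  rw [integrable_prod_iff hm]
  refine ⟨?_, ?_⟩
  · filter_upwards [ae_restrict_mem measurableSet_Ioo] with t ht
    exact h.slice_integrable hψ.continuous hψc ht.1
  · have hcont : ContinuousOn (fun t : ℝ => ∫ x, u (t, x) * ψ x) (Ioo 0 T) :=
      (h.datum.slice_continuous ψ hψ hψc).mono Ioo_subset_Ioi_self
    have hi : IntegrableOn (fun t : ℝ => ∫ x, u (t, x) * ψ x) (Ioo 0 T) := by
      refine IntegrableOn.of_bound (by simp) (hcont.aestronglyMeasurable measurableSet_Ioo)
        (|∫ x, u₀ x * ψ x| + ∫ r in Ioo 0 T, |g r|) ?_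
      filter_upwards [ae_restrict_mem measurableSet_Ioo] with t ht
      rw [h.slice_eq hψ hψc ht.1, Real.norm_eq_abs]
      refine (abs_sub _ _).trans (add_le_add le_rfl ?_)
      rw [intervalIntegral.integral_of_le ht.1.le]
      refine (abs_integral_le_integral_abs).trans ?_
      refine setIntegral_mono_set hgi.abs (Eventually.of_forall fun _ => abs_nonneg _) ?_
      exact (show Ioc 0 t ⊆ Ioo 0 T from fun r hr => ⟨hr.1, lt_of_le_of_lt hr.2 ht.2⟩).eventuallyLE
    refine Integrable.congr hi ?_
    filter_upwards [ae_restrict_mem measurableSet_Ioo] with t ht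
    refine integral_congr_ae (Eventually.of_forall fun x => ?_)
    simp only [Real.norm_eq_abs]
    rw [abs_of_nonneg (mul_nonneg (h.nonneg t ht.1 x) (hψ0 x))]

end IsFluxSolution

/-- The extension of `u` to negative times by its initial datum. -/
noncomputable def extendPast (u₀ : Space n → ℝ) (u : SpaceTime n → ℝ) (p : SpaceTime n) : ℝ :=
  if p.1 ≤ 0 then u₀ p.2 else u p

namespace IsFluxSolution

variable {u : SpaceTime n → ℝ} {u₀ : Space n → ℝ} {F : SpaceTime n → Space n}

theorem extendPast_slice_locallyIntegrable (h : IsFluxSolution u u₀ F) (t : ℝ) :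
    LocallyIntegrable (fun x => extendPast u₀ u (t, x)) volume := by
  by_cases ht : t ≤ 0
  · simpa [extendPast, ht] using h.datum.initial_locallyIntegrable
  · simpa [extendPast, ht] using h.datum.slice_locallyIntegrable t (not_le.1 ht)

theorem locallyIntegrable_extendPast (h : IsFluxSolution u u₀ F) :
    LocallyIntegrable (extendPast u₀ u) volume := by
  rw [locallyIntegrable_iff]
  intro K hK
  obtain ⟨T, hT0, hT⟩ : ∃ T : ℝ, 0 < T ∧ K ⊆ Ioo (-T) T ×ˢ Metric.closedBall (0 : Space n) T := by
    obtain ⟨T, hT⟩ := hK.isBounded.subset_closedBall (0 : SpaceTime n)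
    refine ⟨max T 0 + 1, by positivity, fun p hp => ?_⟩
    have h1 := hT hp
    rw [mem_closedBall_zero_iff, Prod.norm_def, max_le_iff] at h1
    have h2 := le_max_left T 0
    refine ⟨abs_lt.1 (lt_of_le_of_lt h1.1 (by linarith)), ?_⟩
    rw [mem_closedBall_zero_iff]
    linarith [h1.2]
  refine IntegrableOn.mono_set ?_ hT
  have hsub : Ioo (-T) T ×ˢ Metric.closedBall (0 : Space n) T
      ⊆ (Ioc (-T) 0 ×ˢ Metric.closedBall (0 : Space n) T)
        ∪ (Ioo 0 T ×ˢ Metric.closedBall (0 : Space n) T) := by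
    rintro ⟨s, x⟩ ⟨hs, hx⟩
    rcases le_or_gt s 0 with h0 | h0
    · exact Or.inl ⟨⟨hs.1, h0⟩, hx⟩
    · exact Or.inr ⟨⟨h0, hs.2⟩, hx⟩
  refine IntegrableOn.mono_set (IntegrableOn.union ?_ ?_) hsub
  · have h1 : IntegrableOn u₀ (Metric.closedBall (0 : Space n) T) :=
      h.datum.initial_locallyIntegrable.integrableOn_isCompact (isCompact_closedBall _ _)
    have h2 : IntegrableOn (fun p : SpaceTime n => u₀ p.2)
        (Ioc (-T) 0 ×ˢ Metric.closedBall (0 : Space n) T) := by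
      rw [IntegrableOn, Measure.volume_eq_prod, ← Measure.prod_restrict]
      exact Integrable.comp_snd h1 _
    refine h2.congr_fun ?_ (measurableSet_Ioc.prod measurableSet_closedBall)
    intro p hp
    simp [extendPast, hp.1.2]
  -- For positive times the solution is dominated on the ball by its product with a bump that equals
  -- one there.
  · let b : ContDiffBump (0 : Space n) := ⟨T, T + 1, hT0, by linarith⟩
    have h1 := h.integrableOn_mul_snd (b.contDiff (n := ⊤)) b.hasCompactSupport
      (fun x => b.nonneg) hT0
    refine (h1.mono_set (prod_mono subset_rfl (subset_univ _))).congr_fun ?_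
      (measurableSet_Ioo.prod measurableSet_closedBall)
    intro p hp
    have h2 : b p.2 = 1 := b.one_of_mem_closedBall hp.2
    simp [extendPast, not_le.2 hp.1.1, h2]

end IsFluxSolution

end FluxSolution

/-! ### Time differences of the solution against test functions. -/

section Pairing

theorem abs_integral_inner_le {X V : Type*} [MeasurableSpace X] {μ : Measure X}
    [NormedAddCommGroup V] [InnerProductSpace ℝ V] {f g : X → V} (hf : MemLp f 2 μ)
    (hg : MemLp g 2 μ) :
    |∫ x, inner ℝ (f x) (g x) ∂μ| ≤ (eLpNorm f 2 μ).toReal * (eLpNorm g 2 μ).toReal := by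
  have h1 : ∫ x, inner ℝ (f x) (g x) ∂μ = inner ℝ (hf.toLp f) (hg.toLp g) := by
    rw [L2.inner_def]
    refine integral_congr_ae ?_
    filter_upwards [hf.coeFn_toLp, hg.coeFn_toLp] with x h1 h2
    rw [h1, h2]
  rw [h1]
  refine (abs_real_inner_le_norm _ _).trans ?_
  rw [Lp.norm_toLp, Lp.norm_toLp]

variable {n : ℕ}

/-- The time shift `(r, 0)`. -/
abbrev timeShift (n : ℕ) (r : ℝ) : SpaceTime n := (r, 0)

/-- Gives joint measurability of a shifted field in the shift and the point, which Fubini needs. -/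
theorem quasiMeasurePreserving_sub_timeShift (μ : Measure ℝ) [SFinite μ] :
    Measure.QuasiMeasurePreserving (fun q : ℝ × SpaceTime n => q.2 - timeShift n q.1)
      (μ.prod volume) volume := by
  refine QuasiMeasurePreserving.prod_of_right ?_ (Eventually.of_forall fun r => ?_)
  · exact (by fun_prop : Continuous fun q : ℝ × SpaceTime n => q.2 - timeShift n q.1).measurable
  · exact (measurePreserving_sub_right volume (timeShift n r)).quasiMeasurePreserving

theorem eLpNorm_translate {E V : Type*} [AddGroup E] [MeasurableSpace E] [MeasurableAdd E]
    {μ : Measure E} [μ.IsAddRightInvariant] [NormedAddCommGroup V] {p : ℝ≥0∞} {f : E → V}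
    (hf : AEStronglyMeasurable f μ) (z : E) :
    eLpNorm (fun x => f (x - z)) p μ = eLpNorm f p μ :=
  eLpNorm_comp_measurePreserving hf (measurePreserving_sub_right μ z)

theorem MeasureTheory.LocallyIntegrable.translate {E V : Type*} [NormedAddCommGroup E]
    [MeasurableSpace E] [BorelSpace E] [LocallyCompactSpace E] {μ : Measure E}
    [μ.IsAddRightInvariant] [NormedAddCommGroup V] {f : E → V} (hf : LocallyIntegrable f μ)
    (z : E) : LocallyIntegrable (fun x => f (x - z)) μ := by
  rw [locallyIntegrable_iff] at *
  intro K hK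
  have h1 := hf ((Homeomorph.subRight z) '' K) (hK.image (Homeomorph.subRight z).continuous)
  have h2 := ((measurePreserving_sub_right μ z).integrableOn_comp_preimage
    (Homeomorph.subRight z).measurableEmbedding).2 h1
  refine h2.mono_set fun x hx => ⟨x, hx, rfl⟩

theorem integrable_inner_timeShift {f g : SpaceTime n → Space n} (hf : MemLp f 2 volume)
    (hg : MemLp g 2 volume) (η : ℝ) :
    Integrable (fun q : ℝ × SpaceTime n => inner ℝ (f (q.2 - timeShift n q.1)) (g q.2))
      ((volume.restrict (Ioc 0 η)).prod volume) := by
  have hm : AEStronglyMeasurable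
      (fun q : ℝ × SpaceTime n => inner ℝ (f (q.2 - timeShift n q.1)) (g q.2))
      ((volume.restrict (Ioc 0 η)).prod volume) :=
    (hf.1.comp_quasiMeasurePreserving (quasiMeasurePreserving_sub_timeShift _)).inner hg.1.comp_snd
  rw [integrable_prod_iff hm]
  refine ⟨Eventually.of_forall fun r => (memLp_translate hf (timeShift n r)).integrable_inner hg,
    ?_⟩
  refine Integrable.of_bound hm.norm.integral_prod_right'
    ((eLpNorm f 2 volume).toReal * (eLpNorm g 2 volume).toReal)
    (Eventually.of_forall fun r => ?_)
  have hf' := memLp_translate hf (timeShift n r)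
  rw [Real.norm_of_nonneg (integral_nonneg fun _ => norm_nonneg _),
    ← eLpNorm_translate hf.1 (timeShift n r)]
  calc _ ≤ ∫ p, inner ℝ ‖f (p - timeShift n r)‖ ‖g p‖ := by
        refine integral_mono (hf'.integrable_inner hg).norm
          (hf'.norm.integrable_inner hg.norm) fun p => ?_
        refine (norm_inner_le_norm _ _).trans (le_of_eq ?_)
        simp [mul_comm]
    _ ≤ _ := by
        refine (le_abs_self _).trans ((abs_integral_inner_le hf'.norm hg.norm).trans ?_)
        rw [eLpNorm_norm, eLpNorm_norm]

/-- The time correlation of two square integrable fields is continuous at the origin. -/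
theorem correlation_average {f g : SpaceTime n → Space n} (hf : MemLp f 2 volume)
    (hg : MemLp g 2 volume) {ε : ℝ} (hε : 0 < ε) : ∃ δ > 0, ∀ η, 0 < η → η < δ →
    |(∫ r in (0 : ℝ)..η, ∫ p, inner ℝ (f (p - timeShift n r)) (g p))
      - η * ∫ p, inner ℝ (f p) (g p)| ≤ ε * η := by
  set B := (eLpNorm g 2 volume).toReal with hB
  have hB0 : 0 ≤ B := ENNReal.toReal_nonneg
  have h1 := tendsto_eLpNorm_translate_sub (by norm_num : (1 : ℝ≥0∞) ≤ 2) ENNReal.ofNat_ne_top hf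
  have h2 : Tendsto (fun r : ℝ => timeShift n r) (𝓝 0) (𝓝 0) := by
    have : Continuous (fun r : ℝ => timeShift n r) := by fun_prop
    exact this.tendsto 0
  have h3 := (ENNReal.tendsto_toReal ENNReal.zero_ne_top).comp (h1.comp h2)
  simp only [ENNReal.toReal_zero] at h3
  have h4 : ∀ᶠ r : ℝ in 𝓝 0, (eLpNorm (fun x => f (x - timeShift n r) - f x) 2 volume).toReal
      < ε / (B + 1) := h3.eventually (gt_mem_nhds (by positivity))
  obtain ⟨δ, hδ, hball⟩ := Metric.eventually_nhds_iff.1 h4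
  refine ⟨δ, hδ, fun η hη0 hηδ => ?_⟩
  have hi : IntervalIntegrable (fun r => ∫ p, inner ℝ (f (p - timeShift n r)) (g p)) volume 0 η := by
    rw [intervalIntegrable_iff_integrableOn_Ioc_of_le hη0.le]
    exact (integrable_inner_timeShift hf hg η).integral_prod_left
  have e : (∫ r in (0 : ℝ)..η, ∫ p, inner ℝ (f (p - timeShift n r)) (g p))
      - η * ∫ p, inner ℝ (f p) (g p)
      = ∫ r in (0 : ℝ)..η, ((∫ p, inner ℝ (f (p - timeShift n r)) (g p))
        - ∫ p, inner ℝ (f p) (g p)) := by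
    rw [intervalIntegral.integral_sub hi (by simp)]
    simp
  rw [e]
  have := intervalIntegral.norm_integral_le_of_norm_le_const (a := (0 : ℝ)) (b := η) (C := ε)
    (f := fun r => (∫ p, inner ℝ (f (p - timeShift n r)) (g p)) - ∫ p, inner ℝ (f p) (g p)) ?_
  · simpa [abs_of_pos hη0] using this
  intro r hr
  rw [uIoc_of_le hη0.le] at hr
  have hf' := memLp_translate hf (timeShift n r)
  rw [← integral_sub (hf'.integrable_inner hg) (hf.integrable_inner hg)]
  simp only [← inner_sub_left]
  refine (abs_integral_inner_le (hf'.sub hf) hg).trans ?_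
  have h5 := hball (y := r) (by rw [Real.dist_eq, sub_zero, abs_of_pos hr.1]; linarith [hr.2])
  calc _ ≤ ε / (B + 1) * B := mul_le_mul_of_nonneg_right h5.le hB0
    _ ≤ ε / (B + 1) * (B + 1) := by gcongr; linarith
    _ = ε := by field_simp

/-- The flux cut off to the time interval `(0, T)`. -/
noncomputable def cutFlux (T : ℝ) (F : SpaceTime n → Space n) : SpaceTime n → Space n :=
  (Ioo 0 T ×ˢ univ).indicator F

namespace IsFluxSolution

variable {u : SpaceTime n → ℝ} {u₀ : Space n → ℝ} {F : SpaceTime n → Space n}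

theorem memLp_cutFlux (h : IsFluxSolution u u₀ F) {T : ℝ} (hT : 0 < T) :
    MemLp (cutFlux T F) 2 volume :=
  (memLp_indicator_iff_restrict (measurableSet_Ioo.prod MeasurableSet.univ)).2 (h.memLp_flux T hT)

/-- The cut-off flux vanishes at times `t ≤ 0`, where the extended solution is constant. One formula
thus covers all times below `T`, and differences over `(s - η, s)` need no distinction by the sign
of `s - η`. -/
theorem extendPast_slice_eq (h : IsFluxSolution u u₀ F) {T : ℝ} {ψ : Space n → ℝ}
    (hψ : ContDiff ℝ ∞ ψ) (hψc : HasCompactSupport ψ) {t : ℝ} (htT : t < T) :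
    ∫ x, extendPast u₀ u (t, x) * ψ x = (∫ x, u₀ x * ψ x)
      - ∫ r in Iic t, ∫ x, inner ℝ (cutFlux T F (r, x)) (gradient ψ x) := by
  have hz : ∀ r, r ≤ 0 → ∫ x, inner ℝ (cutFlux T F (r, x)) (gradient ψ x) = 0 := by
    intro r hr
    have : ∀ x, cutFlux T F (r, x) = 0 := fun x => indicator_of_notMem (by simp [hr]) _
    simp [this]
  by_cases ht : t ≤ 0
  · rw [setIntegral_eq_zero_of_forall_eq_zero (t := Iic t) fun r hr => hz r (le_trans hr ht),
      sub_zero]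
    simp [extendPast, ht]
  · rw [not_le] at ht
    have e : ∫ x, extendPast u₀ u (t, x) * ψ x = ∫ x, u (t, x) * ψ x := by
      simp [extendPast, not_le.2 ht]
    rw [e, h.slice_eq hψ hψc ht, intervalIntegral.integral_of_le ht.le]
    congr 1
    have h1 : ∫ r in Iic t, ∫ x, inner ℝ (cutFlux T F (r, x)) (gradient ψ x)
        = ∫ r in Ioc 0 t, ∫ x, inner ℝ (cutFlux T F (r, x)) (gradient ψ x) := by
      refine (setIntegral_eq_of_subset_of_forall_sdiff_eq_zero measurableSet_Iic
        (fun r hr => hr.2) fun r hr => hz r ?_)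
      by_contra hr'
      exact hr.2 ⟨not_le.1 hr', hr.1⟩
    rw [h1]
    refine setIntegral_congr_fun measurableSet_Ioc fun r hr => ?_
    have h2 : ∀ x, cutFlux T F (r, x) = F (r, x) := fun x =>
      indicator_of_mem (show (r, x) ∈ Ioo 0 T ×ˢ univ from
        ⟨⟨hr.1, lt_of_le_of_lt hr.2 htT⟩, mem_univ _⟩) _
    simp [h2]

theorem integrable_integral_cutFlux (h : IsFluxSolution u u₀ F) {T : ℝ} (hT : 0 < T)
    {Z : Space n → Space n} (hZ : MemLp Z 2 volume) :
    Integrable (fun r : ℝ => ∫ x, inner ℝ (cutFlux T F (r, x)) (Z x)) := by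
  have h1 := h.integrableOn_integral_inner hT hZ
  rw [← integrable_indicator_iff measurableSet_Ioo] at h1
  refine h1.congr (Eventually.of_forall fun r => ?_)
  by_cases hr : r ∈ Ioo 0 T
  · have h2 : ∀ x, cutFlux T F (r, x) = F (r, x) := fun x =>
      indicator_of_mem (show (r, x) ∈ Ioo 0 T ×ˢ univ from ⟨hr, mem_univ _⟩) _
    simp only [indicator_of_mem hr, h2]
  · have h2 : ∀ x, cutFlux T F (r, x) = 0 := fun x =>
      indicator_of_notMem (fun h' => hr h'.1) _
    simp only [indicator_of_notMem hr, h2, inner_zero_left, integral_zero]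

theorem extendPast_slice_integrable (h : IsFluxSolution u u₀ F) {ψ : Space n → ℝ}
    (hψ : Continuous ψ) (hψc : HasCompactSupport ψ) (t : ℝ) :
    Integrable (fun x => extendPast u₀ u (t, x) * ψ x) := by
  have := (h.extendPast_slice_locallyIntegrable t).integrable_smul_left_of_hasCompactSupport hψ hψc
  refine this.congr (Eventually.of_forall fun x => ?_)
  simp [mul_comm]

theorem extendPast_slice_diff (h : IsFluxSolution u u₀ F) {T : ℝ} (hT : 0 < T) {ψ : Space n → ℝ}
    (hψ : ContDiff ℝ ∞ ψ) (hψc : HasCompactSupport ψ) {s η : ℝ} (hs : s < T) (hη : 0 < η) :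
    ∫ x, (extendPast u₀ u (s, x) - extendPast u₀ u (s - η, x)) * ψ x
      = - ∫ r in (0 : ℝ)..η, ∫ x, inner ℝ (cutFlux T F (s - r, x)) (gradient ψ x) := by
  have hgi := h.integrable_integral_cutFlux hT (memLp_gradient hψ hψc)
  simp only [sub_mul]
  rw [integral_sub (h.extendPast_slice_integrable hψ.continuous hψc s)
    (h.extendPast_slice_integrable hψ.continuous hψc (s - η)),
    h.extendPast_slice_eq hψ hψc hs, h.extendPast_slice_eq hψ hψc (by linarith : s - η < T),
    intervalIntegral.integral_comp_sub_left
      (fun r => ∫ x, inner ℝ (cutFlux T F (r, x)) (gradient ψ x)), sub_zero,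
    ← intervalIntegral.integral_Iic_sub_Iic hgi.integrableOn hgi.integrableOn]
  ring

/-- Every slice `φ (s, ·)` is a spatial test function, so the slice identity can be integrated over
`s` and the integrals exchanged. No time derivative of `φ` appears; this is what later admits test
functions without regularity in time. -/
theorem pairing_smooth (h : IsFluxSolution u u₀ F) {T : ℝ} (hT : 0 < T) {φ : SpaceTime n → ℝ}
    (hφ : IsTestFunction (Iio T ×ˢ univ) φ) {η : ℝ} (hη : 0 < η) :
    ∫ p, (extendPast u₀ u p - extendPast u₀ u (p - timeShift n η)) * φ p
      = - ∫ r in (0 : ℝ)..η, ∫ p, inner ℝ (cutFlux T F (p - timeShift n r)) (spaceGrad φ p) := by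
  have hFc := h.memLp_cutFlux hT
  have hgφ : MemLp (spaceGrad φ) 2 volume :=
    (continuous_spaceGrad (hφ.1.of_le (by simp))).memLp_of_hasCompactSupport hφ.2.1.spaceGrad
  have hsc : ∀ s : ℝ, ContDiff ℝ ∞ (fun x : Space n => φ (s, x)) := fun s =>
    hφ.1.comp (contDiff_const.prodMk contDiff_id)
  have hcc : ∀ s : ℝ, HasCompactSupport (fun x : Space n => φ (s, x)) := by
    intro s
    refine HasCompactSupport.intro (hφ.2.1.isCompact.image continuous_snd) fun x hx => ?_
    by_contra h'
    exact hx ⟨(s, x), subset_tsupport _ h', rfl⟩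
  have hslice : ∀ s : ℝ,
      ∫ x, (extendPast u₀ u (s, x) - extendPast u₀ u (s - η, x)) * φ (s, x)
        = - ∫ r in Ioc 0 η, ∫ x, inner ℝ (cutFlux T F (s - r, x)) (spaceGrad φ (s, x)) := by
    intro s
    by_cases hs : s < T
    · rw [← intervalIntegral.integral_of_le hη.le]
      exact h.extendPast_slice_diff hT (hsc s) (hcc s) hs hη
    · have h0 : ∀ x, (s, x) ∉ tsupport φ := fun x hx => hs (hφ.2.2 hx).1
      simp [fun x => image_eq_zero_of_notMem_tsupport (h0 x),
        fun x => spaceGrad_eq_zero_of_notMem_tsupport (h0 x)]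
  have i0 : LocallyIntegrable (fun p => extendPast u₀ u p - extendPast u₀ u (p - timeShift n η)) :=
    h.locallyIntegrable_extendPast.sub
      (h.locallyIntegrable_extendPast.translate (timeShift n η))
  have iL : Integrable
      (fun p => (extendPast u₀ u p - extendPast u₀ u (p - timeShift n η)) * φ p) := by
    have := i0.integrable_smul_left_of_hasCompactSupport hφ.1.continuous hφ.2.1
    refine this.congr (Eventually.of_forall fun x => ?_)
    simp [mul_comm]
  have iR := integrable_inner_timeShift hFc hgφ η
  set Ψ : ℝ × SpaceTime n → ℝ :=
    fun q => inner ℝ (cutFlux T F (q.2 - timeShift n q.1)) (spaceGrad φ q.2) with hΨ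
  have iR' : Integrable (fun q : (ℝ × ℝ) × Space n => Ψ (q.1.1, (q.1.2, q.2)))
      (((volume.restrict (Ioc 0 η)).prod volume).prod volume) := by
    have hmp := measurePreserving_prodAssoc (volume.restrict (Ioc 0 η)) (volume : Measure ℝ)
      (volume : Measure (Space n))
    exact hmp.integrable_comp_of_integrable (g := Ψ) iR
  have iJ := iR'.integral_prod_left
  rw [Measure.volume_eq_prod, integral_prod _ (by
    rw [← Measure.volume_eq_prod]; exact iL)]
  have e1 : ∀ s : ℝ, ∫ x, (extendPast u₀ u (s, x)
      - extendPast u₀ u ((s, x) - timeShift n η)) * φ (s, x)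
        = - ∫ r in Ioc 0 η, ∫ x, Ψ (r, (s, x)) := by
    intro s
    have := hslice s
    simpa [hΨ, timeShift] using this
  simp only [e1]
  rw [integral_neg, intervalIntegral.integral_of_le hη.le,
    ← integral_integral_swap (f := fun r s => ∫ x, Ψ (r, (s, x))) iJ]
  congr 1
  refine integral_congr_ae ?_
  filter_upwards [iR.prod_right_ae] with r hr
  exact (integral_prod (fun p => Ψ (r, p)) (by rw [← Measure.volume_eq_prod]; exact hr)).symm

end IsFluxSolution

end Pairing

/-! ### Extension of the pairing to weakly differentiable test functions; time cutoffs. -/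

section Energy

open scoped Convolution

variable {n : ℕ}

namespace IsFluxSolution

variable {u : SpaceTime n → ℝ} {u₀ : Space n → ℝ} {F : SpaceTime n → Space n}

/-- Time differences of the solution may be paired with bounded, compactly supported, weakly
differentiable functions. -/
theorem pairing (h : IsFluxSolution u u₀ F) {T t R M : ℝ} (hT : 0 < T) (htT : t < T)
    {Φ : SpaceTime n → ℝ} {P : SpaceTime n → Space n} (hΦ : Integrable Φ)
    (hΦb : ∀ p, |Φ p| ≤ M)
    (hsupp : ∀ p, p ∉ Icc 0 t ×ˢ Metric.closedBall (0 : Space n) R → Φ p = 0)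
    (hw : HasWeakSpaceGrad univ Φ P) (hP : MemLp P 2 volume) {η : ℝ} (hη : 0 < η) :
    ∫ p, (extendPast u₀ u p - extendPast u₀ u (p - timeShift n η)) * Φ p
      = - ∫ r in (0 : ℝ)..η, ∫ p, inner ℝ (cutFlux T F (p - timeShift n r)) (P p) := by
  have hFc := h.memLp_cutFlux hT
  obtain ⟨ρ, hρ0, hρ⟩ := exists_contDiffBump_seq (E := SpaceTime n)
  set φ : ℕ → SpaceTime n → ℝ :=
    fun j => (ρ j).normed volume ⋆[ContinuousLinearMap.lsmul ℝ ℝ, volume] Φ with hφ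
  set Pj : ℕ → SpaceTime n → Space n :=
    fun j => (ρ j).normed volume ⋆[ContinuousLinearMap.lsmul ℝ ℝ, volume] P with hPj
  have hgrad : ∀ j, spaceGrad (φ j) = Pj j := fun j =>
    funext fun p => hw.spaceGrad_convolution hΦ.locallyIntegrable (ρ j) p
  have hae : ∀ᵐ x, Tendsto (fun j => φ j x) atTop (𝓝 (Φ x)) :=
    ContDiffBump.ae_convolution_tendsto_right_of_locallyIntegrable hρ0
      (Eventually.of_forall fun j => (hρ j).1) hΦ.locallyIntegrable
  have hPL : Tendsto (fun j => eLpNorm (fun x => Pj j x - P x) 2 volume) atTop (𝓝 0) :=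
    tendsto_eLpNorm_convolution_sub (by norm_num) ENNReal.ofNat_ne_top hP hρ0
  have hsm : ∀ j, ContDiff ℝ ∞ (φ j) := fun j =>
    (ρ j).hasCompactSupport_normed.contDiff_convolution_left (n := ⊤) _ (ρ j).contDiff_normed
      hΦ.locallyIntegrable
  have hzero : ∀ j p, φ j p ≠ 0 → p ∈ Icc (-(ρ j).rOut) (t + (ρ j).rOut) ×ˢ
      Metric.closedBall (0 : Space n) (R + (ρ j).rOut) := by
    intro j p hp
    by_contra hcon
    refine hp ?_
    simp only [hφ, convolution_def, ContinuousLinearMap.lsmul_apply]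
    refine integral_eq_zero_of_ae (Eventually.of_forall fun z => ?_)
    by_cases hz : z ∈ Metric.ball (0 : SpaceTime n) (ρ j).rOut
    · have hΦ0 : Φ (p - z) = 0 := by
        refine hsupp _ fun hmem => hcon ?_
        rw [mem_ball_zero_iff, Prod.norm_def, max_lt_iff] at hz
        have h1 := abs_lt.1 hz.1
        obtain ⟨⟨a1, a2⟩, a3⟩ := hmem
        rw [mem_closedBall_zero_iff] at a3
        simp only [Prod.fst_sub, Prod.snd_sub] at a1 a2 a3
        refine ⟨⟨by linarith [h1.1], by linarith [h1.2]⟩, ?_⟩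
        rw [mem_closedBall_zero_iff]
        calc ‖p.2‖ = ‖(p.2 - z.2) + z.2‖ := by rw [sub_add_cancel]
          _ ≤ ‖p.2 - z.2‖ + ‖z.2‖ := norm_add_le _ _
          _ ≤ R + (ρ j).rOut := by linarith [hz.2]
      simp [hΦ0]
    · have : (ρ j).normed volume z = 0 := by
        rw [← Function.notMem_support, (ρ j).support_normed_eq]
        exact hz
      simp [this]
  have htsupp : ∀ j, tsupport (φ j) ⊆ Icc (-(ρ j).rOut) (t + (ρ j).rOut) ×ˢ
      Metric.closedBall (0 : Space n) (R + (ρ j).rOut) := fun j =>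
    closure_minimal (fun p hp => hzero j p hp)
      (isClosed_Icc.prod Metric.isClosed_closedBall)
  have hcs : ∀ j, HasCompactSupport (φ j) := fun j =>
    (isCompact_Icc.prod (isCompact_closedBall _ _)).of_isClosed_subset (isClosed_tsupport _)
      (htsupp j)
  have hbd : ∀ j p, |φ j p| ≤ M := by
    intro j p
    simp only [hφ, convolution_def, ContinuousLinearMap.lsmul_apply]
    refine (norm_integral_le_integral_norm (fun z => (ρ j).normed volume z • Φ (p - z))).trans ?_
    calc _ ≤ ∫ z, (ρ j).normed volume z * M := by
          refine integral_mono_of_nonneg (Eventually.of_forall fun _ => norm_nonneg _)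
            ((ρ j).integrable_normed.mul_const M) (Eventually.of_forall fun z => ?_)
          simp only [norm_smul]
          rw [Real.norm_of_nonneg ((ρ j).nonneg_normed z)]
          exact mul_le_mul_of_nonneg_left (hΦb _) ((ρ j).nonneg_normed z)
      _ = M := by rw [integral_mul_const, (ρ j).integral_normed, one_mul]
  -- A compact set containing the supports of all mollifications, since every `rOut` is at most `2`.
  set K : Set (SpaceTime n) := Icc (-2) (t + 2) ×ˢ Metric.closedBall (0 : Space n) (R + 2) with hK
  have hKc : IsCompact K := isCompact_Icc.prod (isCompact_closedBall _ _)
  have hφK : ∀ j p, p ∉ K → φ j p = 0 := by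
    intro j p hp
    by_contra h0
    obtain ⟨⟨a1, a2⟩, a3⟩ := hzero j p h0
    have := (hρ j).2
    rw [mem_closedBall_zero_iff] at a3
    refine hp ⟨⟨by linarith, by linarith⟩, ?_⟩
    rw [mem_closedBall_zero_iff]
    linarith
  set D : SpaceTime n → ℝ := fun p => extendPast u₀ u p - extendPast u₀ u (p - timeShift n η)
    with hD
  have iD : LocallyIntegrable D :=
    h.locallyIntegrable_extendPast.sub
      (h.locallyIntegrable_extendPast.translate (timeShift n η))
  have iDK : IntegrableOn D K := iD.integrableOn_isCompact hKc
  -- The difference `D` is merely locally integrable, so the limit rests on the uniform bound `M`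
  -- for the mollifications and their almost everywhere convergence.
  have lim1 : Tendsto (fun j => ∫ p, D p * φ j p) atTop (𝓝 (∫ p, D p * Φ p)) := by
    refine tendsto_integral_of_dominated_convergence (K.indicator fun p => ‖D p‖ * M)
      (fun j => iD.aestronglyMeasurable.mul (hsm j).continuous.aestronglyMeasurable)
      ((integrable_indicator_iff hKc.measurableSet).2 (iDK.norm.mul_const M))
      (fun j => Eventually.of_forall fun p => ?_) ?_
    · by_cases hp : p ∈ K
      · rw [indicator_of_mem hp, norm_mul]
        exact mul_le_mul_of_nonneg_left (hbd j p) (norm_nonneg _)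
      · rw [indicator_of_notMem hp, hφK j p hp]; simp
    · filter_upwards [hae] with p hp
      exact hp.const_mul _
  have iC : ∀ Q : SpaceTime n → Space n, MemLp Q 2 volume → IntervalIntegrable
      (fun r => ∫ p, inner ℝ (cutFlux T F (p - timeShift n r)) (Q p)) volume 0 η := by
    intro Q hQ
    rw [intervalIntegrable_iff_integrableOn_Ioc_of_le hη.le]
    exact (integrable_inner_timeShift hFc hQ η).integral_prod_left
  have hPjL : ∀ j, MemLp (Pj j) 2 volume := fun j => by
    rw [← hgrad j]
    exact (continuous_spaceGrad ((hsm j).of_le (by simp))).memLp_of_hasCompactSupport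
      (hcs j).spaceGrad
  set B := (eLpNorm (cutFlux T F) 2 volume).toReal with hB
  have lim2 : Tendsto (fun j => ∫ r in (0 : ℝ)..η, ∫ p,
      inner ℝ (cutFlux T F (p - timeShift n r)) (Pj j p)) atTop
      (𝓝 (∫ r in (0 : ℝ)..η, ∫ p, inner ℝ (cutFlux T F (p - timeShift n r)) (P p))) := by
    rw [tendsto_iff_norm_sub_tendsto_zero]
    have hz : Tendsto (fun j => B * (eLpNorm (fun x => Pj j x - P x) 2 volume).toReal * |η - 0|)
        atTop (𝓝 0) := by
      have := (ENNReal.tendsto_toReal ENNReal.zero_ne_top).comp hPL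
      have h2 := (this.const_mul B).mul_const |η - 0|
      simpa using h2
    refine squeeze_zero (fun _ => norm_nonneg _) (fun j => ?_) hz
    rw [← intervalIntegral.integral_sub (iC _ (hPjL j)) (iC _ hP)]
    refine intervalIntegral.norm_integral_le_of_norm_le_const fun r _ => ?_
    have hf' := memLp_translate hFc (timeShift n r)
    rw [← integral_sub (hf'.integrable_inner (hPjL j)) (hf'.integrable_inner hP)]
    simp only [← inner_sub_right]
    refine (abs_integral_inner_le hf' ((hPjL j).sub hP)).trans (le_of_eq ?_)
    rw [eLpNorm_translate hFc.1]
    rfl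
  refine tendsto_nhds_unique lim1 (lim2.neg.congr' ?_)
  -- Mollification enlarges the support by `rOut`; the strict inequality `t < T` keeps it below time
  -- `T` for large `j`.
  filter_upwards [hρ0.eventually (gt_mem_nhds (sub_pos.2 htT))] with j hj
  have htest : IsTestFunction (Iio T ×ˢ univ) (φ j) := by
    refine ⟨hsm j, hcs j, fun p hp => ⟨?_, mem_univ _⟩⟩
    have := (htsupp j hp).1.2
    show p.1 < T
    linarith
  have := h.pairing_smooth hT htest hη
  rw [hgrad j] at this
  exact this.symm

end IsFluxSolution

/-- Smooth substitutes for the indicator of `(0, t)`. Pointwise convergence is enough and no bound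
on derivatives is asked for, because only spatial gradients will be taken. -/
theorem exists_time_cutoff {t : ℝ} : ∃ χ : ℕ → ℝ → ℝ,
    (∀ j, ContDiff ℝ ∞ (χ j)) ∧ (∀ j, HasCompactSupport (χ j)) ∧
    (∀ j, tsupport (χ j) ⊆ Ioo 0 t) ∧ (∀ j s, 0 ≤ χ j s ∧ χ j s ≤ 1) ∧
    ∀ s ∈ Ioo 0 t, Tendsto (fun j => χ j s) atTop (𝓝 1) := by
  set θ := Real.smoothTransition with hθ
  have hθs : ContDiff ℝ ∞ θ := Real.smoothTransition.contDiff
  set χ : ℕ → ℝ → ℝ := fun j s => θ (((j : ℝ) + 1) * s - 1) * θ (((j : ℝ) + 1) * (t - s) - 1)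
    with hχ
  have hts : ∀ j, tsupport (χ j) ⊆ Icc (1 / ((j : ℝ) + 1)) (t - 1 / ((j : ℝ) + 1)) := by
    intro j
    have hj : (0 : ℝ) < (j : ℝ) + 1 := by positivity
    refine closure_minimal (fun s hs => ?_) isClosed_Icc
    by_contra hcon
    rw [mem_Icc, not_and_or, not_le, not_le] at hcon
    refine hs ?_
    rcases hcon with hc | hc
    · have : θ (((j : ℝ) + 1) * s - 1) = 0 := by
        refine Real.smoothTransition.zero_of_nonpos ?_
        rw [lt_div_iff₀ hj] at hc
        linarith
      simp only [hχ, this, zero_mul]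
    · have : θ (((j : ℝ) + 1) * (t - s) - 1) = 0 := by
        refine Real.smoothTransition.zero_of_nonpos ?_
        have : t - s < 1 / ((j : ℝ) + 1) := by linarith
        rw [lt_div_iff₀ hj] at this
        linarith
      simp only [hχ, this, mul_zero]
  refine ⟨χ, fun j => ?_, fun j => ?_, fun j => ?_, fun j s => ⟨?_, ?_⟩, fun s hs => ?_⟩
  · exact (hθs.comp ((contDiff_const.mul contDiff_id).sub contDiff_const)).mul
      (hθs.comp ((contDiff_const.mul (contDiff_const.sub contDiff_id)).sub contDiff_const))
  · exact isCompact_Icc.of_isClosed_subset (isClosed_tsupport _) (hts j)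
  · refine (hts j).trans fun s hs => ?_
    have hj : (0 : ℝ) < 1 / ((j : ℝ) + 1) := by positivity
    exact ⟨by linarith [hs.1], by linarith [hs.2]⟩
  · exact mul_nonneg (Real.smoothTransition.nonneg _) (Real.smoothTransition.nonneg _)
  · exact mul_le_one₀ (Real.smoothTransition.le_one _) (Real.smoothTransition.nonneg _)
      (Real.smoothTransition.le_one _)
  · have hlim : ∀ y : ℝ, 0 < y → Tendsto (fun j : ℕ => θ (((j : ℝ) + 1) * y - 1)) atTop (𝓝 1) := by
      intro y hy
      have h1 : Tendsto (fun j : ℕ => ((j : ℝ) + 1) * y) atTop atTop :=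
        (tendsto_natCast_atTop_atTop.atTop_add tendsto_const_nhds).atTop_mul_const hy
      refine tendsto_const_nhds.congr' ?_
      filter_upwards [h1.eventually_ge_atTop 2] with j hj
      exact (Real.smoothTransition.one_of_one_le (by linarith)).symm
    simpa using (hlim s hs.1).mul (hlim (t - s) (sub_pos.2 hs.2))

end Energy

/-! ### The energy inequality for a truncated convex function of the solution. -/

section EnergyInequality

variable {n : ℕ}

theorem isOpen_positiveTimes : IsOpen (Ioi (0 : ℝ) ×ˢ (univ : Set (Space n))) :=
  isOpen_Ioi.prod isOpen_univ

/-- Cutting off by a spatial test function and a time interval. -/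
theorem HasWeakSpaceGrad.indicator_mul {f : SpaceTime n → ℝ} {P : SpaceTime n → Space n}
    (hw : HasWeakSpaceGrad (Ioi 0 ×ˢ univ) f P) (hf : LocallyIntegrableOn f (Ioi 0 ×ˢ univ))
    (hP : LocallyIntegrableOn P (Ioi 0 ×ˢ univ)) {ζ : Space n → ℝ} (hζ : ContDiff ℝ ∞ ζ)
    (hζc : HasCompactSupport ζ) {t : ℝ}
    (hΦ : LocallyIntegrable ((Ioo 0 t ×ˢ univ).indicator fun p : SpaceTime n => ζ p.2 * f p))
    (hQ : LocallyIntegrable ((Ioo 0 t ×ˢ univ).indicator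
      fun p : SpaceTime n => ζ p.2 • P p + f p • gradient ζ p.2)) :
    HasWeakSpaceGrad univ ((Ioo 0 t ×ˢ univ).indicator fun p => ζ p.2 * f p)
      ((Ioo 0 t ×ˢ univ).indicator fun p => ζ p.2 • P p + f p • gradient ζ p.2) := by
  intro φ hφ
  set Φ := (Ioo 0 t ×ˢ univ).indicator fun p : SpaceTime n => ζ p.2 * f p with hΦd
  set Q := (Ioo 0 t ×ˢ univ).indicator
      fun p : SpaceTime n => ζ p.2 • P p + f p • gradient ζ p.2 with hQd
  -- A factor depending on time alone passes through the spatial gradient. The sharp indicator is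
  -- therefore reached as a limit of smooth factors supported in `(0, t)`.
  obtain ⟨χ, hχs, hχc, hχt, hχb, hχl⟩ := exists_time_cutoff (t := t)
  have hone : ∀ j, IsTestFunction (Ioi 0 ×ˢ univ) (fun p : SpaceTime n => χ j p.1 * ζ p.2) :=
    fun j => IsFluxSolution.isTestFunction_mul (hχs j) (hχc j)
      ((hχt j).trans Ioo_subset_Ioi_self) hζ hζc
  have hgr : ∀ j (p : SpaceTime n), spaceGrad (fun p : SpaceTime n => χ j p.1 * ζ p.2) p
      = χ j p.1 • gradient ζ p.2 := by
    intro j p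
    have hd : DifferentiableAt ℝ ζ p.2 := hζ.differentiable (by simp) p.2
    simp only [spaceGrad, gradient]
    rw [fderiv_const_mul hd, map_smulₛₗ]
    simp
  have key : ∀ j, ∫ p, (χ j p.1 * Φ p) • spaceGrad φ p = - ∫ p, φ p • χ j p.1 • Q p := by
    intro j
    have hj : HasWeakSpaceGrad univ (fun p => (χ j p.1 * ζ p.2) * f p)
        (fun p => (χ j p.1 * ζ p.2) • P p
          + f p • spaceGrad (fun p : SpaceTime n => χ j p.1 * ζ p.2) p) := by
      refine hw.mul_smooth hf hP (hone j).1 (fun ψ hψ => ?_) (fun ψ hψ => ?_)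
      · have := (hone j).mul_left hψ.1
        simpa only [mul_comm] using this
      · have h1 := (hone j).integrable_smul_spaceGrad hf
        obtain ⟨M, hM⟩ := hψ.1.continuous.bounded_above_of_compact_support hψ.2.1
        refine (h1.bdd_smul M hψ.1.continuous.aestronglyMeasurable
          (Eventually.of_forall hM)).congr (Eventually.of_forall fun p => ?_)
        exact smul_smul (ψ p) (f p) _
    have hz : ∀ s, s ∉ Ioo 0 t → χ j s = 0 := fun s hs =>
      image_eq_zero_of_notMem_tsupport fun h' => hs (hχt j h')
    have e := hj φ hφ
    have e1 : ∀ p : SpaceTime n, (χ j p.1 * ζ p.2) * f p = χ j p.1 * Φ p := by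
      intro p
      by_cases hp : p ∈ Ioo 0 t ×ˢ (univ : Set (Space n))
      · rw [hΦd, indicator_of_mem hp]; ring
      · rw [hz p.1 fun h' => hp ⟨h', mem_univ _⟩]; ring
    have e2 : ∀ p : SpaceTime n, (χ j p.1 * ζ p.2) • P p
        + f p • spaceGrad (fun p : SpaceTime n => χ j p.1 * ζ p.2) p = χ j p.1 • Q p := by
      intro p
      rw [hgr]
      by_cases hp : p ∈ Ioo 0 t ×ˢ (univ : Set (Space n))
      · rw [hQd, indicator_of_mem hp, smul_add, mul_smul, smul_comm (f p)]
      · rw [hz p.1 fun h' => hp ⟨h', mem_univ _⟩]; simp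
    simpa only [e1, e2] using e
  have iΦ := hφ.integrable_smul_spaceGrad (hΦ.locallyIntegrableOn univ)
  have iQ := hφ.integrable_smul (hQ.locallyIntegrableOn univ)
  have hχm : ∀ j, AEStronglyMeasurable (fun p : SpaceTime n => χ j p.1) volume := fun j =>
    ((hχs j).continuous.comp continuous_fst).aestronglyMeasurable
  have lim1 : Tendsto (fun j => ∫ p, (χ j p.1 * Φ p) • spaceGrad φ p) atTop
      (𝓝 (∫ p, Φ p • spaceGrad φ p)) := by
    refine tendsto_integral_of_dominated_convergence (fun p => ‖Φ p • spaceGrad φ p‖)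
      (fun j => ?_) iΦ.norm (fun j => Eventually.of_forall fun p => ?_)
      (Eventually.of_forall fun p => ?_)
    · simp only [mul_smul]
      exact (hχm j).smul iΦ.1
    · rw [mul_smul, norm_smul, Real.norm_of_nonneg (hχb j p.1).1]
      exact mul_le_of_le_one_left (norm_nonneg _) (hχb j p.1).2
    · by_cases hp : p ∈ Ioo 0 t ×ˢ (univ : Set (Space n))
      · simpa using ((hχl p.1 hp.1).mul_const (Φ p)).smul_const (spaceGrad φ p)
      · have : Φ p = 0 := indicator_of_notMem hp _
        simp [this]
  have lim2 : Tendsto (fun j => ∫ p, φ p • χ j p.1 • Q p) atTop (𝓝 (∫ p, φ p • Q p)) := by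
    refine tendsto_integral_of_dominated_convergence (fun p => ‖φ p • Q p‖)
      (fun j => ?_) iQ.norm (fun j => Eventually.of_forall fun p => ?_)
      (Eventually.of_forall fun p => ?_)
    · refine ((hχm j).smul iQ.1).congr (Eventually.of_forall fun p => ?_)
      exact smul_comm (χ j p.1) (φ p) (Q p)
    · rw [smul_comm, norm_smul, Real.norm_of_nonneg (hχb j p.1).1]
      exact mul_le_of_le_one_left (norm_nonneg _) (hχb j p.1).2
    · by_cases hp : p ∈ Ioo 0 t ×ˢ (univ : Set (Space n))
      · simpa using ((hχl p.1 hp.1).smul_const (Q p)).const_smul (φ p)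
      · have : Q p = 0 := indicator_of_notMem hp _
        simp [this]
  refine tendsto_nhds_unique lim1 ?_
  simp only [key]
  exact lim2.neg

/-- A convex function `H` with `H 0 = 0`, with bounded derivative `h` and bounded continuous
second derivative `g`. -/
structure IsEnergyProfile (g h H : ℝ → ℝ) (C M : ℝ) : Prop where
  hasDerivAt_h : ∀ z, HasDerivAt h (g z) z
  hasDerivAt_H : ∀ z, HasDerivAt H (h z) z
  continuous_g : Continuous g
  g_nonneg : ∀ z, 0 ≤ g z
  g_le : ∀ z, g z ≤ C
  abs_h_le : ∀ z, |h z| ≤ M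
  H_zero : H 0 = 0

namespace IsEnergyProfile

variable {g h H : ℝ → ℝ} {C M : ℝ}

theorem continuous_h (hp : IsEnergyProfile g h H C M) : Continuous h :=
  continuous_iff_continuousAt.2 fun z => (hp.hasDerivAt_h z).continuousAt

theorem continuous_H (hp : IsEnergyProfile g h H C M) : Continuous H :=
  continuous_iff_continuousAt.2 fun z => (hp.hasDerivAt_H z).continuousAt

theorem monotone_h (hp : IsEnergyProfile g h H C M) : Monotone h :=
  monotone_of_hasDerivAt_nonneg hp.hasDerivAt_h hp.g_nonneg

theorem abs_H_le (hp : IsEnergyProfile g h H C M) (z : ℝ) : |H z| ≤ M * |z| := by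
  simpa [hp.H_zero] using abs_sub_le_of_hasDerivAt_bound hp.hasDerivAt_H hp.abs_h_le z 0

/-- Convexity of `H`, through the mean value theorem. It is the discrete replacement of `∂ₜ H(u) =
h(u) uₜ`, so that `u` is never differentiated in time. -/
theorem H_sub_le (hp : IsEnergyProfile g h H C M) (x y : ℝ) :
    H x - H y ≤ (x - y) * h x := by
  rcases lt_trichotomy x y with hxy | hxy | hxy
  · obtain ⟨c, hc, he⟩ := exists_hasDerivAt_eq_slope H h hxy hp.continuous_H.continuousOn
      fun z _ => hp.hasDerivAt_H z
    rw [eq_div_iff (by linarith)] at he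
    have := hp.monotone_h hc.1.le
    nlinarith
  · simp [hxy]
  · obtain ⟨c, hc, he⟩ := exists_hasDerivAt_eq_slope H h hxy hp.continuous_H.continuousOn
      fun z _ => hp.hasDerivAt_H z
    rw [eq_div_iff (by linarith)] at he
    have := hp.monotone_h hc.2.le
    nlinarith

end IsEnergyProfile

namespace IsFluxSolution

variable {u : SpaceTime n → ℝ} {u₀ : Space n → ℝ} {F : SpaceTime n → Space n}
  {G : SpaceTime n → Space n} {g h H : ℝ → ℝ} {C M : ℝ}

/-- The energy inequality. -/
theorem energy_inequality (hs : IsFluxSolution u u₀ F)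
    (hG : HasWeakSpaceGrad (Ioi 0 ×ˢ univ) u G) (hGl : LocallyIntegrableOn G (Ioi 0 ×ˢ univ))
    (hp : IsEnergyProfile g h H C M) {T : ℝ} (hT : 0 < T)
    (hgG : ∀ R : ℝ, MemLp (fun p => g (u p) • G p) 2
      (volume.restrict (Ioo 0 T ×ˢ Metric.closedBall 0 R)))
    {ζ : Space n → ℝ} (hζ : ContDiff ℝ ∞ ζ) (hζc : HasCompactSupport ζ) (hζ0 : ∀ x, 0 ≤ ζ x) :
    ∀ᵐ t : ℝ, t ∈ Ioo 0 T →
      IntegrableOn (fun p => inner ℝ (F p) (ζ p.2 • g (u p) • G p + h (u p) • gradient ζ p.2))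
        (Ioo 0 t ×ˢ univ) ∧
      (∫ x, H (u (t, x)) * ζ x) + ∫ p in Ioo 0 t ×ˢ univ,
        inner ℝ (F p) (ζ p.2 • g (u p) • G p + h (u p) • gradient ζ p.2)
      ≤ ∫ x, H (u₀ x) * ζ x := by
  have hM0 : 0 ≤ M := (abs_nonneg _).trans (hp.abs_h_le 0)
  obtain ⟨R, hR⟩ := hζc.isCompact.isBounded.subset_closedBall (0 : Space n)
  have hζz : ∀ x, x ∉ Metric.closedBall (0 : Space n) R → ζ x = 0 := fun x hx =>
    image_eq_zero_of_notMem_tsupport fun h' => hx (hR h')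
  have hgz : ∀ x, x ∉ Metric.closedBall (0 : Space n) R → gradient ζ x = 0 := by
    intro x hx
    have h1 : x ∉ tsupport ζ := fun h' => hx (hR h')
    have h2 : ζ =ᶠ[𝓝 x] fun _ => 0 := notMem_tsupport_iff_eventuallyEq.1 h1
    rw [gradient, h2.fderiv_eq]
    simp
  obtain ⟨Z, hZ⟩ := hζ.continuous.bounded_above_of_compact_support hζc
  obtain ⟨Z', hZ'⟩ := (continuous_gradient (hζ.of_le (by simp))).bounded_above_of_compact_support
    hζc.gradient
  have hum := hs.locallyIntegrableOn.aestronglyMeasurable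
  have hhum : AEStronglyMeasurable (fun p => h (u p)) (volume.restrict (Ioi 0 ×ˢ univ)) :=
    hp.continuous_h.comp_aestronglyMeasurable hum
  have hhl : LocallyIntegrableOn (fun p => h (u p)) (Ioi 0 ×ˢ univ) := by
    refine LocallyIntegrableOn.mono_restrict (f := fun _ => M)
      ((locallyIntegrable_const M).locallyIntegrableOn _) hhum fun p => ?_
    rw [Real.norm_of_nonneg hM0]
    exact hp.abs_h_le _
  have hggl : LocallyIntegrableOn (fun p => g (u p) • G p) (Ioi 0 ×ˢ univ) :=
    hGl.bdd_smul_left (hp.continuous_g.comp_aestronglyMeasurable hum) (C := C) fun p => by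
      rw [abs_of_nonneg (hp.g_nonneg _)]; exact hp.g_le _
  have hwh : HasWeakSpaceGrad (Ioi 0 ×ˢ univ) (fun p => h (u p)) (fun p => g (u p) • G p) :=
    hG.comp isOpen_positiveTimes hs.locallyIntegrableOn hGl hp.hasDerivAt_h hp.continuous_g
      (C := C) fun z => by rw [abs_of_nonneg (hp.g_nonneg _)]; exact hp.g_le _
  -- the energy of the slices
  set q : SpaceTime n → ℝ := fun p => H (extendPast u₀ u p) * ζ p.2 with hq
  set Y : ℝ → ℝ := fun s => ∫ x, q (s, x) with hY
  have hqm : AEStronglyMeasurable q volume :=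
    (hp.continuous_H.comp_aestronglyMeasurable
      hs.locallyIntegrable_extendPast.aestronglyMeasurable).mul
      (hζ.continuous.comp continuous_snd).aestronglyMeasurable
  have hqi : ∀ a b : ℝ, IntegrableOn q (Icc a b ×ˢ univ) := by
    intro a b
    have h1 : IntegrableOn (extendPast u₀ u) (Icc a b ×ˢ Metric.closedBall (0 : Space n) R) :=
      hs.locallyIntegrable_extendPast.integrableOn_isCompact
        (isCompact_Icc.prod (isCompact_closedBall _ _))
    have h2 : IntegrableOn q (Icc a b ×ˢ Metric.closedBall (0 : Space n) R) := by
      refine Integrable.mono' (h1.norm.const_mul (M * Z)) hqm.restrict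
        (Eventually.of_forall fun p => ?_)
      rw [hq, norm_mul]
      calc _ ≤ (M * ‖extendPast u₀ u p‖) * Z :=
            mul_le_mul (hp.abs_H_le _) (hZ _) (norm_nonneg _) (by positivity)
        _ = _ := by ring
    refine h2.of_forall_sdiff_eq_zero (measurableSet_Icc.prod MeasurableSet.univ) fun p hp' => ?_
    have : p.2 ∉ Metric.closedBall (0 : Space n) R := fun h' => hp'.2 ⟨hp'.1.1, h'⟩
    simp [hq, hζz _ this]
  have hqi' : ∀ a b : ℝ, Integrable q ((volume.restrict (Icc a b)).prod volume) := by
    intro a b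
    rw [← restrict_prod_univ]
    exact hqi a b
  have hYi : ∀ a b : ℝ, IntegrableOn Y (Icc a b) := fun a b => (hqi' a b).integral_prod_left
  have hYl : LocallyIntegrable Y := by
    intro s
    exact ⟨Icc (s - 1) (s + 1), Icc_mem_nhds (by linarith) (by linarith), hYi _ _⟩
  have hYint : ∀ a b : ℝ, IntervalIntegrable Y volume a b := fun a b =>
    intervalIntegrable_iff.2 ((hYi (min a b) (max a b)).mono_set Ioc_subset_Icc_self)
  have hYneg : ∀ s, s ≤ 0 → Y s = ∫ x, H (u₀ x) * ζ x := by
    intro s hs0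
    simp [hY, hq, extendPast, hs0]
  have hYpos : ∀ s, 0 < s → Y s = ∫ x, H (u (s, x)) * ζ x := by
    intro s hs0
    simp [hY, hq, extendPast, not_le.2 hs0]
  -- The slice energy `Y` is only locally integrable in time; the inequality is obtained at the
  -- times where its primitive has derivative `Y t`.
  filter_upwards [LocallyIntegrable.ae_hasDerivAt_integral hYl] with t hder ht
  -- the test function and its gradient
  set Φ := (Ioo 0 t ×ˢ univ).indicator fun p : SpaceTime n => ζ p.2 * h (u p) with hΦd
  set Q := (Ioo 0 t ×ˢ univ).indicator
      fun p : SpaceTime n => ζ p.2 • g (u p) • G p + h (u p) • gradient ζ p.2 with hQd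
  have hmeas : MeasurableSet (Ioo 0 t ×ˢ (univ : Set (Space n))) :=
    measurableSet_Ioo.prod MeasurableSet.univ
  have hmeasB : MeasurableSet (Ioo 0 t ×ˢ Metric.closedBall (0 : Space n) R) :=
    measurableSet_Ioo.prod measurableSet_closedBall
  have hfin : volume (Ioo 0 t ×ˢ Metric.closedBall (0 : Space n) R) ≠ ⊤ :=
    (measure_mono (prod_mono Ioo_subset_Icc_self subset_rfl)).trans_lt
      ((isCompact_Icc.prod (isCompact_closedBall _ _)).measure_lt_top) |>.ne
  have hsubD : Ioo 0 t ×ˢ Metric.closedBall (0 : Space n) R ⊆ Ioi 0 ×ˢ univ :=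
    prod_mono Ioo_subset_Ioi_self (subset_univ _)
  have hhB : AEStronglyMeasurable (fun p => h (u p))
      (volume.restrict (Ioo 0 t ×ˢ Metric.closedBall (0 : Space n) R)) :=
    hhum.mono_measure (Measure.restrict_mono hsubD le_rfl)
  have : IsFiniteMeasure (volume.restrict (Ioo 0 t ×ˢ Metric.closedBall (0 : Space n) R)) :=
    ⟨by rw [Measure.restrict_apply_univ]; exact hfin.lt_top⟩
  have hΦB : Φ = (Ioo 0 t ×ˢ Metric.closedBall (0 : Space n) R).indicator
      fun p : SpaceTime n => ζ p.2 * h (u p) := by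
    funext p
    by_cases h1 : p.1 ∈ Ioo 0 t
    · have hm : p ∈ Ioo 0 t ×ˢ (univ : Set (Space n)) := ⟨h1, mem_univ _⟩
      by_cases h2 : p.2 ∈ Metric.closedBall (0 : Space n) R
      · have hm' : p ∈ Ioo 0 t ×ˢ Metric.closedBall (0 : Space n) R := ⟨h1, h2⟩
        rw [hΦd, indicator_of_mem hm, indicator_of_mem hm']
      · rw [hΦd, indicator_of_mem hm, indicator_of_notMem fun h' => h2 h'.2,
          hζz _ h2, zero_mul]
    · rw [hΦd, indicator_of_notMem fun h' => h1 h'.1, indicator_of_notMem fun h' => h1 h'.1]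
  have hQB : Q = (Ioo 0 t ×ˢ Metric.closedBall (0 : Space n) R).indicator
      fun p : SpaceTime n => ζ p.2 • g (u p) • G p + h (u p) • gradient ζ p.2 := by
    funext p
    by_cases h1 : p.1 ∈ Ioo 0 t
    · have hm : p ∈ Ioo 0 t ×ˢ (univ : Set (Space n)) := ⟨h1, mem_univ _⟩
      by_cases h2 : p.2 ∈ Metric.closedBall (0 : Space n) R
      · have hm' : p ∈ Ioo 0 t ×ˢ Metric.closedBall (0 : Space n) R := ⟨h1, h2⟩
        rw [hQd, indicator_of_mem hm, indicator_of_mem hm']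
      · rw [hQd, indicator_of_mem hm, indicator_of_notMem fun h' => h2 h'.2,
          hζz _ h2, hgz _ h2, zero_smul, smul_zero, zero_add]
    · rw [hQd, indicator_of_notMem fun h' => h1 h'.1, indicator_of_notMem fun h' => h1 h'.1]
  have hΦi : Integrable Φ := by
    rw [hΦB, integrable_indicator_iff hmeasB]
    refine Integrable.of_bound ((hζ.continuous.comp continuous_snd).aestronglyMeasurable.mul hhB)
      (Z * M) (Eventually.of_forall fun p => ?_)
    rw [norm_mul]
    exact mul_le_mul (hZ _) (hp.abs_h_le _) (norm_nonneg _) ((norm_nonneg _).trans (hZ 0))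
  have hQL : MemLp Q 2 volume := by
    rw [hQB, memLp_indicator_iff_restrict hmeasB]
    refine MemLp.add ?_ ?_
    · have h1 : MemLp (fun p => g (u p) • G p) 2
          (volume.restrict (Ioo 0 t ×ˢ Metric.closedBall (0 : Space n) R)) :=
        (hgG R).mono_measure (Measure.restrict_mono
          (prod_mono (Ioo_subset_Ioo_right ht.2.le) subset_rfl) le_rfl)
      exact MemLp.of_le_mul (c := Z) h1
        ((hζ.continuous.comp continuous_snd).aestronglyMeasurable.smul h1.1)
        (Eventually.of_forall fun p => by
          rw [norm_smul]; exact mul_le_mul_of_nonneg_right (hZ _) (norm_nonneg _))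
    · refine MemLp.of_bound (hhB.smul ((continuous_gradient (hζ.of_le (by simp))).comp
        continuous_snd).aestronglyMeasurable) (M * Z') (Eventually.of_forall fun p => ?_)
      rw [norm_smul]
      exact mul_le_mul (hp.abs_h_le _) (hZ' _) (norm_nonneg _) hM0
  have hw : HasWeakSpaceGrad univ Φ Q :=
    hwh.indicator_mul hhl hggl hζ hζc hΦi.locallyIntegrable (hQL.locallyIntegrable (by norm_num))
  have hFc := hs.memLp_cutFlux hT
  have hsetint : ∀ p, (inner ℝ (cutFlux T F p) (Q p) : ℝ) = (Ioo 0 t ×ˢ univ).indicator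
      (fun p => inner ℝ (F p) (ζ p.2 • g (u p) • G p + h (u p) • gradient ζ p.2)) p := by
    intro p
    by_cases h1 : p ∈ Ioo 0 t ×ˢ (univ : Set (Space n))
    · have h2 : cutFlux T F p = F p :=
        indicator_of_mem (show p ∈ Ioo 0 T ×ˢ univ from
          ⟨⟨h1.1.1, h1.1.2.trans ht.2⟩, mem_univ _⟩) _
      rw [hQd, indicator_of_mem h1, indicator_of_mem h1, h2]
    · rw [hQd, indicator_of_notMem h1, indicator_of_notMem h1, inner_zero_right]
  have hii := hFc.integrable_inner hQL
  have hC0 : ∫ p, inner ℝ (cutFlux T F p) (Q p) = ∫ p in Ioo 0 t ×ˢ univ,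
      inner ℝ (F p) (ζ p.2 • g (u p) • G p + h (u p) • gradient ζ p.2) := by
    simp only [hsetint]
    exact integral_indicator hmeas
  refine ⟨?_, ?_⟩
  · simp only [hsetint] at hii
    exact (integrable_indicator_iff hmeas).1 hii
  rw [← hC0, ← hYpos t ht.1]
  -- the discrete inequality
  have hstep : ∀ η : ℝ, 0 < η → (∫ s in (t - η)..t, Y s) - η * ∫ x, H (u₀ x) * ζ x
      ≤ - ∫ r in (0 : ℝ)..η, ∫ p, inner ℝ (cutFlux T F (p - timeShift n r)) (Q p) := by
    intro η hη
    have hpair := hs.pairing (R := R) (M := Z * M) hT ht.2 hΦi (fun p => ?_) (fun p hp' => ?_)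
      hw hQL hη
    rotate_left
    · rw [hΦd]
      by_cases h1 : p ∈ Ioo 0 t ×ˢ (univ : Set (Space n))
      · rw [indicator_of_mem h1, abs_mul]
        exact mul_le_mul (hZ _) (hp.abs_h_le _) (abs_nonneg _) ((norm_nonneg _).trans (hZ 0))
      · rw [indicator_of_notMem h1, abs_zero]
        exact mul_nonneg ((norm_nonneg _).trans (hZ 0)) hM0
    · rw [hΦB, indicator_of_notMem]
      exact fun h' => hp' ⟨Ioo_subset_Icc_self h'.1, h'.2⟩
    rw [← hpair]
    have iq1 : IntegrableOn q (Ioo 0 t ×ˢ univ) :=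
      (hqi 0 t).mono_set (prod_mono Ioo_subset_Icc_self subset_rfl)
    have iq2 : IntegrableOn (fun p => q (p - timeShift n η)) (Ioo 0 t ×ˢ univ) := by
      have h2 := ((measurePreserving_sub_right volume (timeShift n η)).integrableOn_comp_preimage
        (Homeomorph.subRight (timeShift n η)).measurableEmbedding).2 (hqi (0 - η) (t - η))
      refine h2.mono_set fun p hp' => ⟨⟨?_, ?_⟩, mem_univ _⟩
      · simpa using hp'.1.1.le
      · simpa using hp'.1.2.le
    have eY1 : ∫ p in Ioo 0 t ×ˢ univ, q p = ∫ s in (0 : ℝ)..t, Y s := by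
      rw [intervalIntegral.integral_of_le ht.1.le, integral_Ioc_eq_integral_Ioo,
        restrict_prod_univ, integral_prod]
      rw [← restrict_prod_univ]
      exact iq1
    have eY2 : ∫ p in Ioo 0 t ×ˢ univ, q (p - timeShift n η) = ∫ s in (0 : ℝ)..t, Y (s - η) := by
      rw [intervalIntegral.integral_of_le ht.1.le, integral_Ioc_eq_integral_Ioo,
        restrict_prod_univ, integral_prod]
      · simp [hY, timeShift]
      · rw [← restrict_prod_univ]
        exact iq2
    -- Backward differences telescope: only the last interval of length `η` and the interval `(-η,
    -- 0)` remain, and on the latter `Y` is the initial energy.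
    have eY3 : (∫ s in (t - η)..t, Y s) - η * ∫ x, H (u₀ x) * ζ x
        = (∫ p in Ioo 0 t ×ˢ univ, q p) - ∫ p in Ioo 0 t ×ˢ univ, q (p - timeShift n η) := by
      rw [eY1, eY2, intervalIntegral.integral_comp_sub_right (fun s => Y s)]
      have e1 : ∫ s in (0 - η)..0, Y s = η * ∫ x, H (u₀ x) * ζ x := by
        rw [intervalIntegral.integral_congr (g := fun _ => ∫ x, H (u₀ x) * ζ x)]
        · rw [intervalIntegral.integral_const]; simp
        · intro s hs'
          rw [uIcc_of_le (by linarith)] at hs'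
          exact hYneg s hs'.2
      rw [← e1]
      have a1 := intervalIntegral.integral_add_adjacent_intervals (hYint (0 - η) 0) (hYint 0 t)
      have a2 := intervalIntegral.integral_add_adjacent_intervals (hYint (0 - η) (t - η))
        (hYint (t - η) t)
      linarith
    rw [eY3, ← integral_sub iq1 iq2, ← integral_indicator hmeas]
    have hΦbd : ∀ p, ‖Φ p‖ ≤ Z * M := by
      intro p
      rw [hΦd]
      by_cases h1 : p ∈ Ioo 0 t ×ˢ (univ : Set (Space n))
      · rw [indicator_of_mem h1, norm_mul]
        exact mul_le_mul (hZ _) (hp.abs_h_le _) (abs_nonneg _) ((norm_nonneg _).trans (hZ 0))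
      · rw [indicator_of_notMem h1, norm_zero]
        exact mul_nonneg ((norm_nonneg _).trans (hZ 0)) hM0
    have iD : IntegrableOn
        (fun p => extendPast u₀ u p - extendPast u₀ u (p - timeShift n η))
        (Icc 0 t ×ˢ Metric.closedBall (0 : Space n) R) :=
      (hs.locallyIntegrable_extendPast.sub
        (hs.locallyIntegrable_extendPast.translate (timeShift n η))).integrableOn_isCompact
        (isCompact_Icc.prod (isCompact_closedBall _ _))
    have iDΦ : Integrable
        (fun p => (extendPast u₀ u p - extendPast u₀ u (p - timeShift n η)) * Φ p) := by
      rw [← integrableOn_iff_integrable_of_support_subset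
        (s := Icc 0 t ×ˢ Metric.closedBall (0 : Space n) R)]
      · exact Integrable.mul_bdd (c := Z * M) iD hΦi.1.restrict (Eventually.of_forall hΦbd)
      · intro p hp'
        by_contra h'
        refine hp' ?_
        have : Φ p = 0 := by
          rw [hΦB, indicator_of_notMem]
          exact fun h'' => h' ⟨Ioo_subset_Icc_self h''.1, h''.2⟩
        simp [this]
    -- Inside the slab this is `H_sub_le` at the values now and at time `η` earlier, multiplied by
    -- `ζ ≥ 0`; outside both sides vanish.
    refine integral_mono ((integrable_indicator_iff hmeas).2 (iq1.sub iq2)) iDΦ fun p => ?_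
    by_cases h1 : p ∈ Ioo 0 t ×ˢ (univ : Set (Space n))
    · have h2 : extendPast u₀ u p = u p := by simp [extendPast, not_le.2 h1.1.1]
      have h3 := mul_le_mul_of_nonneg_right
        (hp.H_sub_le (extendPast u₀ u p) (extendPast u₀ u (p - timeShift n η))) (hζ0 p.2)
      rw [indicator_of_mem h1]
      simp only [hΦd]
      rw [indicator_of_mem h1]
      simp only [hq]
      rw [← h2]
      calc _ = (H (extendPast u₀ u p) - H (extendPast u₀ u (p - timeShift n η))) * ζ p.2 := by
            simp [timeShift]; ring
        _ ≤ _ := h3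
        _ = _ := by ring
    · rw [indicator_of_notMem h1]
      have : Φ p = 0 := indicator_of_notMem h1 _
      simp [this]
  -- passage to the limit
  have hη0 : ∀ j : ℕ, 0 < 1 / ((j : ℝ) + 1) := fun j => by positivity
  have hηl : Tendsto (fun j : ℕ => 1 / ((j : ℝ) + 1)) atTop (𝓝 0) :=
    tendsto_one_div_add_atTop_nhds_zero_nat
  have lim1 : Tendsto (fun j : ℕ => ((j : ℝ) + 1) * ∫ s in (t - 1 / ((j : ℝ) + 1))..t, Y s) atTop
      (𝓝 (Y t)) := by
    have h1 := (hasDerivAt_iff_tendsto_slope.1 (hder 0))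
    have h2 : Tendsto (fun j : ℕ => t - 1 / ((j : ℝ) + 1)) atTop (𝓝[≠] t) := by
      refine tendsto_nhdsWithin_iff.2 ⟨by simpa using tendsto_const_nhds.sub hηl, ?_⟩
      refine Eventually.of_forall fun j => ?_
      have := hη0 j
      simp only [mem_compl_iff, mem_singleton_iff]
      intro h'
      linarith
    refine (h1.comp h2).congr fun j => ?_
    have a1 := intervalIntegral.integral_add_adjacent_intervals
      (hYint 0 (t - 1 / ((j : ℝ) + 1))) (hYint (t - 1 / ((j : ℝ) + 1)) t)
    simp only [Function.comp_apply, slope_def_field]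
    rw [← a1]
    have hj : ((j : ℝ) + 1) ≠ 0 := by positivity
    field_simp
    ring
  -- Averaging over short time shifts recovers the unshifted flux pairing, by continuity of
  -- translations in `L²`.
  have lim2 : Tendsto (fun j : ℕ => ((j : ℝ) + 1) * ∫ r in (0 : ℝ)..(1 / ((j : ℝ) + 1)),
      ∫ p, inner ℝ (cutFlux T F (p - timeShift n r)) (Q p)) atTop
      (𝓝 (∫ p, inner ℝ (cutFlux T F p) (Q p))) := by
    rw [Metric.tendsto_nhds]
    intro ε hε
    obtain ⟨δ, hδ, hδ'⟩ := correlation_average hFc hQL (half_pos hε)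
    filter_upwards [hηl.eventually (gt_mem_nhds hδ)] with j hj
    have h1 := hδ' _ (hη0 j) hj
    have hj0 : (0 : ℝ) < (j : ℝ) + 1 := by positivity
    rw [Real.dist_eq]
    set A := ∫ r in (0 : ℝ)..(1 / ((j : ℝ) + 1)),
      ∫ p, inner ℝ (cutFlux T F (p - timeShift n r)) (Q p)
    set A0 := ∫ p, inner ℝ (cutFlux T F p) (Q p)
    have e : ((j : ℝ) + 1) * A - A0 = ((j : ℝ) + 1) * (A - 1 / ((j : ℝ) + 1) * A0) := by
      field_simp
    rw [e, abs_mul, abs_of_pos hj0]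
    calc _ ≤ ((j : ℝ) + 1) * (ε / 2 * (1 / ((j : ℝ) + 1))) :=
          mul_le_mul_of_nonneg_left h1 hj0.le
      _ = ε / 2 := by field_simp
      _ < ε := by linarith
  have hfinal := le_of_tendsto_of_tendsto' (lim1.sub tendsto_const_nhds) lim2.neg
    (a₁ := Y t - ∫ x, H (u₀ x) * ζ x) fun j => ?_
  · linarith
  have h1 := mul_le_mul_of_nonneg_left (hstep _ (hη0 j)) (by positivity : 0 ≤ (j : ℝ) + 1)
  have e : ((j : ℝ) + 1) * (1 / ((j : ℝ) + 1) * ∫ x, H (u₀ x) * ζ x) = ∫ x, H (u₀ x) * ζ x := by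
    field_simp
  rw [mul_sub, e] at h1
  linarith

end IsFluxSolution

end EnergyInequality

/-! ### Truncated power functions used as energy profiles. -/

section PowerProfile

/-- A truncation at level `N` of the energy profile with `h z = z ^ a`. -/
structure IsPowerProfile (a K N : ℝ) (g h H : ℝ → ℝ) : Prop where
  exists_bounds : ∃ C M, IsEnergyProfile g h H C M
  g_eq_zero_of_le : ∀ z, z ≤ 1 / N → g z = 0
  g_eq_zero_of_ge : ∀ z, 2 * N ≤ z → g z = 0
  g_le_rpow : ∀ z, 0 < z → g z ≤ a * z ^ (a - 1)
  g_eq_rpow : ∀ z, 2 / N ≤ z → z ≤ N → g z = a * z ^ (a - 1)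
  h_nonneg : ∀ z, 0 ≤ z → 0 ≤ h z
  h_le_rpow : ∀ z, 0 ≤ z → h z ≤ z ^ a
  h_sq_le : ∀ z, 0 ≤ z → z ≤ N → a * h z ^ 2 ≤ g z * z ^ (1 + a)
  H_nonneg : ∀ z, 0 ≤ z → 0 ≤ H z
  H_le_rpow : ∀ z, 0 ≤ z → H z ≤ z ^ (1 + a)
  rpow_le : ∀ z, 0 ≤ z → z ≤ 2 * N → z ^ (1 + a) ≤ K * H z + K * N ^ (-a) * z

theorem hasDerivAt_integral_of_continuous {f : ℝ → ℝ} (hf : Continuous f) (z : ℝ) :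
    HasDerivAt (fun z => ∫ s in (0 : ℝ)..z, f s) (f z) z :=
  intervalIntegral.integral_hasDerivAt_right (hf.intervalIntegrable _ _)
    (hf.stronglyMeasurableAtFilter _ _) hf.continuousAt

theorem integral_mul_rpow_sub_one {a : ℝ} (ha : 0 < a) {x y : ℝ} :
    ∫ s in x..y, a * s ^ (a - 1) = y ^ a - x ^ a := by
  rw [intervalIntegral.integral_const_mul, integral_rpow (Or.inl (by linarith))]
  simp only [sub_add_cancel]
  field_simp

theorem intervalIntegrable_mul_rpow_sub_one {a : ℝ} (ha : 0 < a) (x y : ℝ) :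
    IntervalIntegrable (fun s => a * s ^ (a - 1)) volume x y :=
  (intervalIntegral.intervalIntegrable_rpow' (by linarith)).const_mul a

/-- The derivative of `h` is `a z^(a-1) θ(z)`, where `θ` rises linearly on `[1/N, 2/N]` and falls
linearly on `[N, 2N]`. Up to `N` the factor `θ` is nondecreasing, so `h z ≤ θ(z) z^a`, and since `θ
≤ 1` this makes `h²` comparable with `g z^(1+a)`. For the lower bound on `H` with `z ≥ 8/N`, the
interval `[z/4, z/2]` already contributes a fixed fraction of `z^a` to `h`; for smaller `z`, `z^a`
is at most `8^a N^(-a)`, which leaves the linear error. -/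
theorem exists_isPowerProfile {a : ℝ} (ha : 0 < a) (ha1 : a < 1) :
    ∃ K > 0, ∀ N : ℝ, 1 ≤ N → ∃ g h H, IsPowerProfile a K N g h H := by
  -- `K₁ z^a` is the increment of `s^a` from `z/4` to `z/2`.
  set K₁ : ℝ := (1 / 2 : ℝ) ^ a - (1 / 4 : ℝ) ^ a with hK₁
  have hK₁0 : 0 < K₁ := sub_pos.2 (Real.rpow_lt_rpow (by norm_num) (by norm_num) ha)
  refine ⟨2 / K₁ + 8 ^ a, by positivity, fun N hN => ?_⟩
  have hN0 : 0 < N := by linarith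
  set θ : ℝ → ℝ := fun z => max 0 (min 1 (N * z - 1)) * max 0 (min 1 (2 - z / N)) with hθ
  -- The base is frozen at `1/N` to keep the negative power continuous; `θ` vanishes below that
  -- level.
  set g : ℝ → ℝ := fun z => a * max z (1 / N) ^ (a - 1) * θ z with hg
  set h : ℝ → ℝ := fun z => ∫ s in (0 : ℝ)..z, g s with hh
  set H : ℝ → ℝ := fun z => ∫ s in (0 : ℝ)..z, h s with hH
  have hθc : Continuous θ := by
    simp only [hθ]; fun_prop
  have hgc : Continuous g := by
    refine (continuous_const.mul (Continuous.rpow_const (by fun_prop) fun z => Or.inl ?_)).mul hθc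
    exact (lt_of_lt_of_le (by positivity) (le_max_right z (1 / N))).ne'
  have hθ0 : ∀ z, 0 ≤ θ z := fun z => mul_nonneg (le_max_left _ _) (le_max_left _ _)
  have hθ1 : ∀ z, θ z ≤ 1 := fun z =>
    mul_le_one₀ (max_le zero_le_one (min_le_left _ _)) (le_max_left _ _)
      (max_le zero_le_one (min_le_left _ _))
  have hθlow : ∀ z, z ≤ 1 / N → θ z = 0 := by
    intro z hz
    rw [le_div_iff₀ hN0] at hz
    have : max 0 (min 1 (N * z - 1)) = 0 :=
      max_eq_left ((min_le_right _ _).trans (by linarith))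
    simp only [hθ, this, zero_mul]
  have hθhigh : ∀ z, 2 * N ≤ z → θ z = 0 := by
    intro z hz
    rw [← le_div_iff₀ hN0] at hz
    have : max 0 (min 1 (2 - z / N)) = 0 :=
      max_eq_left ((min_le_right _ _).trans (by linarith))
    simp only [hθ, this, mul_zero]
  have hθmid : ∀ z, z ≤ N → θ z = max 0 (min 1 (N * z - 1)) := by
    intro z hz
    have hz' : z / N ≤ 1 := (div_le_one hN0).2 hz
    have : max 0 (min 1 (2 - z / N)) = 1 := by
      rw [min_eq_left (by linarith), max_eq_right zero_le_one]
    simp only [hθ, this, mul_one]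
  have hθmono : ∀ s z, s ≤ z → z ≤ N → θ s ≤ θ z := by
    intro s z hsz hz
    rw [hθmid s (hsz.trans hz), hθmid z hz]
    gcongr
  have hgeq : ∀ z, 0 < z → g z = a * z ^ (a - 1) * θ z := by
    intro z hz
    rcases le_total z (1 / N) with h1 | h1
    · simp only [hg, hθlow z h1, mul_zero]
    · simp only [hg, max_eq_left h1]
  have hg0 : ∀ z, 0 ≤ g z := fun z => by
    refine mul_nonneg (mul_nonneg ha.le (Real.rpow_nonneg ?_ _)) (hθ0 z)
    exact (by positivity : (0 : ℝ) ≤ 1 / N).trans (le_max_right _ _)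
  have hglow : ∀ z, z ≤ 1 / N → g z = 0 := fun z hz => by simp only [hg, hθlow z hz, mul_zero]
  have hghigh : ∀ z, 2 * N ≤ z → g z = 0 := fun z hz => by simp only [hg, hθhigh z hz, mul_zero]
  have hgle : ∀ z, 0 < z → g z ≤ a * z ^ (a - 1) := by
    intro z hz
    rw [hgeq z hz]
    exact mul_le_of_le_one_right (by positivity) (hθ1 z)
  have hgle0 : ∀ z, 0 ≤ z → g z ≤ a * z ^ (a - 1) := by
    intro z hz
    rcases hz.eq_or_lt with rfl | hz
    · rw [hglow 0 (by positivity)]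
      positivity
    · exact hgle z hz
  have hgmid : ∀ z, 2 / N ≤ z → z ≤ N → g z = a * z ^ (a - 1) := by
    intro z hz1 hz2
    have hz0 : 0 < z := lt_of_lt_of_le (by positivity) hz1
    rw [div_le_iff₀ hN0] at hz1
    rw [hgeq z hz0, hθmid z hz2, min_eq_left (by linarith), max_eq_right zero_le_one, mul_one]
  have hhd : ∀ z, HasDerivAt h (g z) z := hasDerivAt_integral_of_continuous hgc
  have hhc : Continuous h := continuous_iff_continuousAt.2 fun z => (hhd z).continuousAt
  have hHd : ∀ z, HasDerivAt H (h z) z := hasDerivAt_integral_of_continuous hhc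
  have hhmono : Monotone h := monotone_of_hasDerivAt_nonneg hhd hg0
  have hh0 : h 0 = 0 := by simp [hh]
  have hhnn : ∀ z, 0 ≤ z → 0 ≤ h z := fun z hz => hh0 ▸ hhmono hz
  have hhle : ∀ z, 0 ≤ z → h z ≤ z ^ a := by
    intro z hz
    calc h z ≤ ∫ s in (0 : ℝ)..z, a * s ^ (a - 1) := by
          refine intervalIntegral.integral_mono_on hz (hgc.intervalIntegrable _ _)
            (intervalIntegrable_mul_rpow_sub_one ha _ _) fun s hs => hgle0 s hs.1
      _ = z ^ a := by
          rw [integral_mul_rpow_sub_one ha, Real.zero_rpow ha.ne', sub_zero]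
  have hhθ : ∀ z, 0 ≤ z → z ≤ N → h z ≤ θ z * z ^ a := by
    intro z hz hzN
    calc h z ≤ ∫ s in (0 : ℝ)..z, θ z * (a * s ^ (a - 1)) := by
          refine intervalIntegral.integral_mono_on hz (hgc.intervalIntegrable _ _)
            ((intervalIntegrable_mul_rpow_sub_one ha _ _).const_mul _) fun s hs => ?_
          rcases hs.1.eq_or_lt with h0 | h0
          · rw [← h0, hglow 0 (by positivity)]
            have := hθ0 z
            positivity
          · rw [hgeq s h0, mul_comm]
            exact mul_le_mul_of_nonneg_right (hθmono s z hs.2 hzN) (by positivity)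
      _ = θ z * z ^ a := by
          rw [intervalIntegral.integral_const_mul, integral_mul_rpow_sub_one ha,
            Real.zero_rpow ha.ne', sub_zero]
  have hHnn : ∀ z, 0 ≤ z → 0 ≤ H z := fun z hz =>
    intervalIntegral.integral_nonneg hz fun s hs => hhnn s hs.1
  have hHle : ∀ z, 0 ≤ z → H z ≤ z ^ (1 + a) := by
    intro z hz
    calc H z ≤ ∫ _ in (0 : ℝ)..z, z ^ a := by
          refine intervalIntegral.integral_mono_on hz (hhc.intervalIntegrable _ _)
            (by simp) fun s hs => ?_
          exact (hhle s hs.1).trans (Real.rpow_le_rpow hs.1 hs.2 ha.le)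
      _ = z ^ (1 + a) := by
          rw [intervalIntegral.integral_const, sub_zero, smul_eq_mul,
            Real.rpow_add_of_nonneg hz zero_le_one ha.le, Real.rpow_one]
  have hhneg : ∀ z, z ≤ 0 → h z = 0 := by
    intro z hz
    have : ∫ s in (0 : ℝ)..z, g s = ∫ _ in (0 : ℝ)..z, (0 : ℝ) := by
      refine intervalIntegral.integral_congr fun s hs => ?_
      rw [uIcc_of_ge hz] at hs
      exact hglow s (hs.2.trans (by positivity))
    simp [hh, this]
  have hhbd : ∀ z, |h z| ≤ (2 * N) ^ a := by
    intro z
    rcases le_total z 0 with hz | hz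
    · rw [hhneg z hz, abs_zero]; positivity
    rw [abs_of_nonneg (hhnn z hz)]
    rcases le_total z (2 * N) with h2 | h2
    · exact (hhle z hz).trans (Real.rpow_le_rpow hz h2 ha.le)
    · have e : h z = h (2 * N) := by
        have a1 := intervalIntegral.integral_add_adjacent_intervals
          (hgc.intervalIntegrable (μ := volume) 0 (2 * N)) (hgc.intervalIntegrable (2 * N) z)
        have a2 : ∫ s in (2 * N)..z, g s = ∫ _ in (2 * N)..z, (0 : ℝ) := by
          refine intervalIntegral.integral_congr fun s hs => ?_
          rw [uIcc_of_le h2] at hs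
          exact hghigh s hs.1
        simp only [hh]
        rw [← a1, a2]
        simp
      rw [e]
      exact hhle _ (by positivity)
  have hgbd : ∀ z, g z ≤ a * (1 / N) ^ (a - 1) := by
    intro z
    rcases le_total z (1 / N) with h1 | h1
    · rw [hglow z h1]; positivity
    · refine (hgle z (lt_of_lt_of_le (by positivity) h1)).trans ?_
      refine mul_le_mul_of_nonneg_left ?_ ha.le
      exact Real.rpow_le_rpow_of_nonpos (by positivity) h1 (by linarith)
  refine ⟨g, h, H, ⟨⟨a * (1 / N) ^ (a - 1), (2 * N) ^ a, ⟨hhd, hHd, hgc, hg0, hgbd, hhbd,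
    by simp [hH]⟩⟩, hglow, hghigh, hgle, hgmid, hhnn, hhle, ?_, hHnn, hHle, ?_⟩⟩
  · intro z hz hzN
    rcases hz.eq_or_lt with h0 | h0
    · rw [← h0, hh0]
      have := hg0 0
      simp only [ne_eq, OfNat.ofNat_ne_zero, not_false_eq_true, zero_pow, mul_zero]
      positivity
    · have h1 := hhθ z hz hzN
      have e : g z * z ^ (1 + a) = a * (θ z * (z ^ a) ^ 2) := by
        rw [hgeq z h0]
        have : z ^ (a - 1) * z ^ (1 + a) = (z ^ a) ^ 2 := by
          rw [← Real.rpow_add h0, ← Real.rpow_natCast, ← Real.rpow_mul hz]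
          congr 1
          push_cast
          ring
        rw [← this]; ring
      rw [e]
      refine mul_le_mul_of_nonneg_left ?_ ha.le
      calc h z ^ 2 ≤ (θ z * z ^ a) ^ 2 := pow_le_pow_left₀ (hhnn z hz) h1 2
        _ = θ z * (θ z * (z ^ a) ^ 2) := by ring
        _ ≤ 1 * (θ z * (z ^ a) ^ 2) :=
            mul_le_mul_of_nonneg_right (hθ1 z) (mul_nonneg (hθ0 z) (by positivity))
        _ = _ := one_mul _
  · intro z hz hz2
    have hHz := hHnn z hz
    have e1 : z ^ (1 + a) = z * z ^ a := by
      rw [Real.rpow_add_of_nonneg hz zero_le_one ha.le, Real.rpow_one]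
    have hNa : 0 ≤ N ^ (-a) := by positivity
    rcases le_total z (8 / N) with h8 | h8
    · have h1 : z ^ a ≤ 8 ^ a * N ^ (-a) := by
        calc z ^ a ≤ (8 / N) ^ a := Real.rpow_le_rpow hz h8 ha.le
          _ = 8 ^ a * N ^ (-a) := by
              rw [Real.div_rpow (by norm_num) hN0.le, Real.rpow_neg hN0.le, div_eq_mul_inv]
      have h2 : 0 ≤ 2 / K₁ := by positivity
      have h3 : (0 : ℝ) ≤ 8 ^ a := by positivity
      calc z ^ (1 + a) = z * z ^ a := e1
        _ ≤ z * (8 ^ a * N ^ (-a)) := mul_le_mul_of_nonneg_left h1 hz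
        _ ≤ _ := by
            have : 0 ≤ (2 / K₁ + 8 ^ a) * H z := by positivity
            have : 0 ≤ 2 / K₁ * N ^ (-a) * z := by positivity
            nlinarith
    · have hz0 : 0 < z := lt_of_lt_of_le (by positivity) h8
      -- The range `8/N ≤ z ≤ 2N` places `[z/4, z/2]` inside `[2/N, N]`, where `g` is the
      -- untruncated power.
      have hq : 2 / N ≤ z / 4 := by
        have : (8 : ℝ) / N = 4 * (2 / N) := by ring
        linarith
      have h1 : K₁ * z ^ a ≤ h (z / 2) := by
        have a1 := intervalIntegral.integral_add_adjacent_intervals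
          (hgc.intervalIntegrable (μ := volume) 0 (z / 4)) (hgc.intervalIntegrable (z / 4) (z / 2))
        have a2 : ∫ s in (z / 4)..(z / 2), g s = ∫ s in (z / 4)..(z / 2), a * s ^ (a - 1) := by
          refine intervalIntegral.integral_congr fun s hs => ?_
          rw [uIcc_of_le (by linarith)] at hs
          exact hgmid s (hq.trans hs.1) (by linarith [hs.2])
        rw [a2, integral_mul_rpow_sub_one ha] at a1
        have a3 := hhnn (z / 4) (by positivity)
        have e2 : (z / 2) ^ a - (z / 4) ^ a = K₁ * z ^ a := by
          rw [hK₁, div_eq_mul_one_div z 2, div_eq_mul_one_div z 4,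
            Real.mul_rpow hz (by norm_num), Real.mul_rpow hz (by norm_num)]
          ring
        rw [e2] at a1
        simp only [hh] at a3 ⊢
        linarith
      have h2 : z / 2 * h (z / 2) ≤ H z := by
        have a1 := intervalIntegral.integral_add_adjacent_intervals
          (hhc.intervalIntegrable (μ := volume) 0 (z / 2)) (hhc.intervalIntegrable (z / 2) z)
        have a3 := hHnn (z / 2) (by positivity)
        have a4 : ∫ _ in (z / 2)..z, h (z / 2) ≤ ∫ s in (z / 2)..z, h s := by
          refine intervalIntegral.integral_mono_on (by linarith) (by simp)
            (hhc.intervalIntegrable _ _) fun s hs => hhmono hs.1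
        rw [intervalIntegral.integral_const, smul_eq_mul] at a4
        have : z - z / 2 = z / 2 := by ring
        rw [this] at a4
        simp only [hH] at a3 ⊢
        linarith
      have h3 : z ^ (1 + a) ≤ 2 / K₁ * H z := by
        rw [div_mul_eq_mul_div, le_div_iff₀ hK₁0, e1]
        have : z / 2 * (K₁ * z ^ a) ≤ z / 2 * h (z / 2) :=
          mul_le_mul_of_nonneg_left h1 (by positivity)
        nlinarith
      have h4 : (0 : ℝ) ≤ 8 ^ a * H z := by positivity
      have h5 : 0 ≤ (2 / K₁ + 8 ^ a) * N ^ (-a) * z := by positivity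
      linarith

end PowerProfile

/-! ### Gronwall's inequality with an integrable kernel. -/

section Gronwall

theorem integral_exp_mul_le {lam t : ℝ} (hl : 0 < lam) (ht : 0 < t) :
    ∫ s in Ioo 0 t, Real.exp (lam * s) ≤ Real.exp (lam * t) / lam := by
  rw [← integral_Ioc_eq_integral_Ioo, ← intervalIntegral.integral_of_le ht.le,
    intervalIntegral.integral_comp_mul_left (fun s => Real.exp s) hl.ne', integral_exp]
  simp only [mul_zero, Real.exp_zero, smul_eq_mul]
  rw [inv_mul_eq_div]
  gcongr
  linarith

/-- Gronwall's inequality with an integrable kernel; the constant depends on the kernel only. -/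
theorem exists_gronwall_const {W : ℝ → ℝ} {T : ℝ} (hW : IntegrableOn W (Ioo 0 T))
    (hW0 : ∀ t, 0 ≤ W t) : ∃ C, 0 ≤ C ∧ ∀ (Y : ℝ → ℝ) (A B : ℝ), 0 ≤ A →
      AEStronglyMeasurable Y (volume.restrict (Ioo 0 T)) →
      (∀ᵐ t : ℝ, t ∈ Ioo 0 T → 0 ≤ Y t ∧ Y t ≤ B) →
      (∀ᵐ t : ℝ, t ∈ Ioo 0 T → Y t ≤ A + ∫ s in Ioo 0 t, W s * Y s) →
      ∀ᵐ t : ℝ, t ∈ Ioo 0 T → Y t ≤ C * A := by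
  -- the part of the kernel above a high level has small integral
  obtain ⟨L, hL0, hL⟩ : ∃ L : ℝ, 0 < L ∧ ∫ s in Ioo 0 T, (W s - min (W s) L) ≤ 1 / 4 := by
    have hlim : Tendsto (fun j : ℕ => ∫ s in Ioo 0 T, (W s - min (W s) (j : ℝ))) atTop
        (𝓝 (∫ s in Ioo 0 T, (0 : ℝ))) := by
      refine tendsto_integral_of_dominated_convergence W (fun j => ?_) hW
        (fun j => Eventually.of_forall fun s => ?_) (Eventually.of_forall fun s => ?_)
      · exact hW.1.sub (hW.1.inf aestronglyMeasurable_const)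
      · have h1 : 0 ≤ min (W s) (j : ℝ) := le_min (hW0 s) (Nat.cast_nonneg j)
        rw [Real.norm_of_nonneg (by linarith [min_le_left (W s) (j : ℝ)])]
        linarith
      · refine tendsto_const_nhds.congr' ?_
        filter_upwards [eventually_ge_atTop ⌈W s⌉₊] with j hj
        have : W s ≤ j := (Nat.le_ceil _).trans (by exact_mod_cast hj)
        rw [min_eq_left this, sub_self]
    rw [integral_zero] at hlim
    have h1 := (hlim.eventually (ge_mem_nhds (by norm_num : (0 : ℝ) < 1 / 4))).and
      (eventually_ge_atTop 1)
    obtain ⟨j, hj, hj1⟩ := h1.exists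
    exact ⟨j, by exact_mod_cast hj1, hj⟩
  -- If `Y ≤ D exp(lam t)`, the part of the kernel below `L` contributes at most `D exp(lam t) / 4`
  -- because `lam = 4 L`, and the part above `L` at most the same because its integral is at most
  -- `1/4`. So `D` improves to `A + D/2`, a map with fixed point `2 A`.
  set lam : ℝ := 4 * L with hlam
  have hlam0 : 0 < lam := by positivity
  refine ⟨2 * Real.exp (lam * T), by positivity, fun Y A B hA hYm hYB hY => ?_⟩
  have step : ∀ D : ℝ, 0 ≤ D →
      (∀ᵐ t : ℝ, t ∈ Ioo 0 T → Y t ≤ D * Real.exp (lam * t)) →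
      ∀ᵐ t : ℝ, t ∈ Ioo 0 T → Y t ≤ (A + D / 2) * Real.exp (lam * t) := by
    intro D hD hYD
    filter_upwards [hY] with t ht htT
    have hsub : Ioo 0 t ⊆ Ioo 0 T := Ioo_subset_Ioo_right htT.2.le
    have hWt : IntegrableOn W (Ioo 0 t) := hW.mono_set hsub
    have hmi : IntegrableOn (fun s => W s - min (W s) L) (Ioo 0 T) := by
      refine Integrable.mono' hW (hW.1.sub (hW.1.inf aestronglyMeasurable_const))
        (Eventually.of_forall fun s => ?_)
      have h1 : 0 ≤ min (W s) L := le_min (hW0 s) hL0.le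
      rw [Real.norm_of_nonneg (by linarith [min_le_left (W s) L])]
      linarith
    have hei : IntegrableOn (fun s => Real.exp (lam * s)) (Ioo 0 t) :=
      ((by fun_prop : Continuous fun s => Real.exp (lam * s)).integrableOn_Icc).mono_set
        Ioo_subset_Icc_self
    have h1 : ∫ s in Ioo 0 t, W s * Y s ≤ ∫ s in Ioo 0 t,
        ((D * L) * Real.exp (lam * s) + (D * Real.exp (lam * t)) * (W s - min (W s) L)) := by
      refine integral_mono_of_nonneg ?_ ((hei.const_mul _).add
        ((hmi.mono_set hsub).const_mul _)) ?_
      · filter_upwards [ae_restrict_mem measurableSet_Ioo, ae_restrict_of_ae hYB] with s hs h2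
        exact mul_nonneg (hW0 s) (h2 (hsub hs)).1
      · filter_upwards [ae_restrict_mem measurableSet_Ioo, ae_restrict_of_ae hYD,
          ae_restrict_of_ae hYB] with s hs h2 h3
        have h4 := h2 (hsub hs)
        have h6 : Real.exp (lam * s) ≤ Real.exp (lam * t) :=
          Real.exp_le_exp.2 (mul_le_mul_of_nonneg_left hs.2.le hlam0.le)
        have h7 : 0 ≤ W s - min (W s) L := sub_nonneg.2 (min_le_left _ _)
        have h8 : min (W s) L ≤ L := min_le_right _ _
        have h9 := Real.exp_pos (lam * s)
        calc W s * Y s ≤ W s * (D * Real.exp (lam * s)) :=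
              mul_le_mul_of_nonneg_left h4 (hW0 s)
          _ = min (W s) L * (D * Real.exp (lam * s))
              + (D * Real.exp (lam * s)) * (W s - min (W s) L) := by ring
          _ ≤ L * (D * Real.exp (lam * s))
              + (D * Real.exp (lam * t)) * (W s - min (W s) L) := by gcongr
          _ = _ := by ring
    rw [integral_add (hei.const_mul _) ((hmi.mono_set hsub).const_mul _), integral_const_mul,
      integral_const_mul] at h1
    have h2 := integral_exp_mul_le hlam0 htT.1
    have h3 : ∫ s in Ioo 0 t, (W s - min (W s) L) ≤ 1 / 4 := by
      refine le_trans (setIntegral_mono_set hmi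
        (Eventually.of_forall fun s => sub_nonneg.2 (min_le_left _ _)) hsub.eventuallyLE) hL
    have h4 : D * L * ∫ s in Ioo 0 t, Real.exp (lam * s) ≤ D * Real.exp (lam * t) / 4 := by
      calc _ ≤ D * L * (Real.exp (lam * t) / lam) :=
            mul_le_mul_of_nonneg_left h2 (by positivity)
        _ = _ := by rw [hlam]; field_simp
    have h5 : D * Real.exp (lam * t) * ∫ s in Ioo 0 t, (W s - min (W s) L)
        ≤ D * Real.exp (lam * t) * (1 / 4) := mul_le_mul_of_nonneg_left h3 (by positivity)
    have h6 : A ≤ A * Real.exp (lam * t) :=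
      le_mul_of_one_le_right hA (Real.one_le_exp (mul_nonneg hlam0.le htT.1.le))
    have := ht htT
    nlinarith
  -- The a priori bound only starts the iteration; its contribution is halved each time, so the
  -- final constant does not depend on it.
  set B' := max B 0 with hB'
  have iter : ∀ j : ℕ, ∀ᵐ t : ℝ, t ∈ Ioo 0 T →
      Y t ≤ (2 * A + B' / 2 ^ j) * Real.exp (lam * t) := by
    intro j
    induction j with
    | zero =>
      filter_upwards [hYB] with t ht htT
      have h1 := (ht htT).2
      have h2 : B ≤ B' := le_max_left _ _
      have h3 : 0 ≤ B' := le_max_right _ _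
      have h4 : 1 ≤ Real.exp (lam * t) := Real.one_le_exp (mul_nonneg hlam0.le htT.1.le)
      have h5 : 0 ≤ 2 * A + B' := by linarith
      rw [pow_zero, div_one]
      calc Y t ≤ 2 * A + B' := by linarith
        _ ≤ _ := le_mul_of_one_le_right h5 h4
    | succ j ih =>
      have h3 : 0 ≤ B' := le_max_right _ _
      have := step _ (by positivity) ih
      filter_upwards [this] with t ht htT
      refine (ht htT).trans (le_of_eq ?_)
      rw [pow_succ]
      field_simp
      ring
  filter_upwards [ae_all_iff.2 iter] with t ht htT
  have hlim : Tendsto (fun j : ℕ => (2 * A + B' / 2 ^ j) * Real.exp (lam * t)) atTop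
      (𝓝 ((2 * A + 0) * Real.exp (lam * t))) := by
    refine Tendsto.mul_const _ (Tendsto.const_add _ ?_)
    exact tendsto_const_nhds.div_atTop (tendsto_pow_atTop_atTop_of_one_lt (by norm_num))
  have h1 := ge_of_tendsto' hlim fun j => ht j htT
  have h2 : Real.exp (lam * t) ≤ Real.exp (lam * T) :=
    Real.exp_le_exp.2 (mul_le_mul_of_nonneg_left htT.2.le hlam0.le)
  rw [add_zero] at h1
  calc Y t ≤ 2 * A * Real.exp (lam * t) := h1
    _ ≤ 2 * A * Real.exp (lam * T) := mul_le_mul_of_nonneg_left h2 (by positivity)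
    _ = _ := by ring

end Gronwall

/-! ### The decaying weight, its scaling and its cutoffs. -/

section Weight

variable {n : ℕ}

/-- The weight `(1 + |x|² / R²)⁻ⁿ`. -/
noncomputable def decayWeight (n : ℕ) (R : ℝ) (x : Space n) : ℝ := ((1 + ‖x‖ ^ 2 / R ^ 2) ^ n)⁻¹

theorem one_le_decayWeight_base (R : ℝ) (x : Space n) : 1 ≤ 1 + ‖x‖ ^ 2 / R ^ 2 := by
  have : 0 ≤ ‖x‖ ^ 2 / R ^ 2 := by positivity
  linarith

theorem decayWeight_pos (R : ℝ) (x : Space n) : 0 < decayWeight n R x :=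
  inv_pos.2 (pow_pos (lt_of_lt_of_le one_pos (one_le_decayWeight_base R x)) n)

theorem decayWeight_le_one (R : ℝ) (x : Space n) : decayWeight n R x ≤ 1 :=
  inv_le_one_of_one_le₀ (one_le_pow₀ (one_le_decayWeight_base R x))

theorem contDiff_decayWeight (R : ℝ) : ContDiff ℝ ∞ (decayWeight n R) := by
  refine ContDiff.inv ?_ fun x => ?_
  · exact (contDiff_const.add ((contDiff_norm_sq ℝ).div_const _)).pow n
  · exact (pow_pos (lt_of_lt_of_le one_pos (one_le_decayWeight_base R x)) n).ne'

/-- The logarithmic gradient of the weight has length `2n|x| / (R² + |x|²)`, which is at most `n/R`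
by `2R|x| ≤ R² + |x|²`. A derivative thus reproduces the weight and gains a factor `1/R`. -/
theorem norm_gradient_decayWeight_le {R : ℝ} (hR : 0 < R) (x : Space n) :
    ‖gradient (decayWeight n R) x‖ ≤ n / R * decayWeight n R x := by
  set b := 1 + ‖x‖ ^ 2 / R ^ 2 with hb
  have hb1 : 1 ≤ b := one_le_decayWeight_base R x
  have hb0 : 0 < b := by linarith
  have h1 : HasFDerivAt (fun y : Space n => 1 + ‖y‖ ^ 2 / R ^ 2)
      ((R ^ 2)⁻¹ • (2 : ℝ) • innerSL ℝ x) x := by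
    have h2 : HasFDerivAt (fun y : Space n => ‖y‖ ^ 2) ((2 : ℝ) • innerSL ℝ x) x := by
      have h := (hasStrictFDerivAt_norm_sq x).hasFDerivAt
      have e : (2 : ℝ) • innerSL ℝ x = (2 : ℕ) • innerSL ℝ x := by
        rw [two_smul, two_nsmul]
      rw [e]
      exact h
    have h3 := (h2.const_mul (R ^ 2)⁻¹).const_add 1
    refine h3.congr_of_eventuallyEq (Eventually.of_forall fun y => ?_)
    simp only
    rw [div_eq_inv_mul]
  have hphi : HasDerivAt (fun z : ℝ => (z ^ n)⁻¹) (-(n * b ^ (n - 1)) / (b ^ n) ^ 2) b :=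
    (hasDerivAt_pow n b).fun_inv (pow_pos hb0 n).ne'
  have h4 : HasFDerivAt (decayWeight n R)
      ((-(n * b ^ (n - 1)) / (b ^ n) ^ 2) • ((R ^ 2)⁻¹ • (2 : ℝ) • innerSL ℝ x)) x :=
    HasDerivAt.comp_hasFDerivAt (h₂ := fun z : ℝ => (z ^ n)⁻¹)
      (f := fun y : Space n => 1 + ‖y‖ ^ 2 / R ^ 2) x hphi h1
  have hw : decayWeight n R x = (b ^ n)⁻¹ := rfl
  rw [gradient, LinearIsometryEquiv.norm_map, h4.fderiv, norm_smul, norm_smul, norm_smul,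
    innerSL_apply_norm, hw]
  have hbn : 0 < b ^ n := pow_pos hb0 n
  rcases Nat.eq_zero_or_pos n with h0 | h0
  · subst h0; simp
  have e1 : ‖-(n * b ^ (n - 1)) / (b ^ n) ^ 2‖ = n * (b ^ n)⁻¹ * b⁻¹ := by
    rw [norm_div, norm_neg, Real.norm_of_nonneg (by positivity), Real.norm_of_nonneg (by positivity)]
    have : b ^ n = b ^ (n - 1) * b := by
      rw [← pow_succ, Nat.sub_add_cancel h0]
    rw [this]
    field_simp
  rw [e1, Real.norm_of_nonneg (by positivity), Real.norm_of_nonneg (by norm_num)]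
  have key : b⁻¹ * ((R ^ 2)⁻¹ * (2 * ‖x‖)) ≤ 1 / R := by
    rw [inv_mul_le_iff₀ hb0, inv_mul_le_iff₀ (by positivity)]
    have : R ^ 2 * (b * (1 / R)) = (R ^ 2 + ‖x‖ ^ 2) / R := by
      rw [hb]; field_simp
    rw [this, le_div_iff₀ hR]
    nlinarith [sq_nonneg (R - ‖x‖)]
  calc _ = n * (b ^ n)⁻¹ * (b⁻¹ * ((R ^ 2)⁻¹ * (2 * ‖x‖))) := by ring
    _ ≤ n * (b ^ n)⁻¹ * (1 / R) := mul_le_mul_of_nonneg_left key (by positivity)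
    _ = _ := by ring

theorem decayWeight_eq_comp_smul (R : ℝ) (x : Space n) :
    decayWeight n R x = decayWeight n 1 (R⁻¹ • x) := by
  simp only [decayWeight, norm_smul, mul_pow, norm_inv, inv_pow, one_pow, div_one]
  rw [Real.norm_eq_abs, sq_abs, div_eq_inv_mul]

theorem integrable_decayWeight_one (hn : 0 < n) : Integrable (decayWeight n 1) := by
  have h := integrable_rpow_neg_one_add_norm_sq (E := Space n) (μ := volume) (r := 2 * (n : ℝ)) (by
    rw [finrank_euclideanSpace_fin]
    have : (0 : ℝ) < n := by exact_mod_cast hn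
    linarith)
  refine h.congr (Eventually.of_forall fun x => ?_)
  simp only [decayWeight, one_pow, div_one]
  rw [show -(2 * (n : ℝ)) / 2 = -(n : ℝ) by ring, Real.rpow_neg (by positivity),
    Real.rpow_natCast]

theorem integrable_decayWeight (hn : 0 < n) {R : ℝ} (hR : 0 < R) :
    Integrable (decayWeight n R) := by
  have := (integrable_decayWeight_one hn).comp_smul (inv_ne_zero hR.ne')
  exact this.congr (Eventually.of_forall fun x => (decayWeight_eq_comp_smul R x).symm)

theorem integral_decayWeight {R : ℝ} (hR : 0 < R) :
    ∫ x, decayWeight n R x = R ^ n * ∫ x, decayWeight n 1 x := by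
  simp only [decayWeight_eq_comp_smul (n := n) R]
  rw [Measure.integral_comp_inv_smul volume, finrank_euclideanSpace_fin, abs_of_pos (by positivity),
    smul_eq_mul]

theorem memLp_decayWeight (hn : 0 < n) {R : ℝ} (hR : 0 < R) : MemLp (decayWeight n R) 2 volume := by
  have hc := (contDiff_decayWeight (n := n) R).continuous.aestronglyMeasurable (μ := volume)
  rw [memLp_two_iff_integrable_sq hc]
  refine Integrable.mono' (integrable_decayWeight hn hR) (hc.pow 2) (Eventually.of_forall fun x => ?_)
  have h1 := (decayWeight_pos R x).le
  rw [Real.norm_of_nonneg (by positivity), sq]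
  exact mul_le_of_le_one_left h1 (decayWeight_le_one R x)

theorem tendsto_decayWeight (x : Space n) {R : ℕ → ℝ} (hR : Tendsto R atTop atTop) :
    Tendsto (fun j => decayWeight n (R j) x) atTop (𝓝 1) := by
  have h1 : Tendsto (fun j => ‖x‖ ^ 2 / R j ^ 2) atTop (𝓝 0) :=
    tendsto_const_nhds.div_atTop ((tendsto_pow_atTop two_ne_zero).comp hR)
  have h2 := ((h1.const_add 1).pow n).inv₀ (by simp)
  simpa [decayWeight] using h2

theorem gradient_mul {f g : Space n → ℝ} {x : Space n} (hf : DifferentiableAt ℝ f x)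
    (hg : DifferentiableAt ℝ g x) :
    gradient (fun y => f y * g y) x = f x • gradient g x + g x • gradient f x := by
  simp only [gradient]
  rw [fderiv_fun_mul hf hg, map_add, map_smulₛₗ, map_smulₛₗ]
  simp

/-- Compactly supported approximations of the weight. -/
theorem exists_cutoff_decayWeight (n : ℕ) {R : ℝ} (hR : 0 < R) :
    ∃ C, 0 ≤ C ∧ ∃ ζ : ℕ → Space n → ℝ, (∀ N, ContDiff ℝ ∞ (ζ N)) ∧
      (∀ N, HasCompactSupport (ζ N)) ∧ (∀ N x, 0 ≤ ζ N x) ∧ (∀ N x, ζ N x ≤ decayWeight n R x) ∧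
      (∀ N x, ‖gradient (ζ N) x‖
        ≤ n / R * ζ N x + C / ((N : ℝ) + 1) * decayWeight n R x) ∧
      ∀ x, ∀ᶠ N in atTop, ζ N x = decayWeight n R x
        ∧ gradient (ζ N) x = gradient (decayWeight n R) x := by
  let b : ContDiffBump (0 : Space n) := ⟨1, 2, one_pos, one_lt_two⟩
  have hbs : ContDiff ℝ ∞ b := b.contDiff
  obtain ⟨C, hC⟩ := (hbs.continuous_fderiv (by simp)).bounded_above_of_compact_support
    (b.hasCompactSupport.fderiv (𝕜 := ℝ))
  have hC0 : 0 ≤ C := (norm_nonneg _).trans (hC 0)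
  set c : ℕ → ℝ := fun N => ((N : ℝ) + 1)⁻¹ with hc
  have hc0 : ∀ N, 0 < c N := fun N => by simp only [hc]; positivity
  set χ : ℕ → Space n → ℝ := fun N x => b (c N • x) with hχ
  have hχs : ∀ N, ContDiff ℝ ∞ (χ N) := fun N => hbs.comp (contDiff_const_smul (c N))
  have hχg : ∀ N x, ‖gradient (χ N) x‖ ≤ C * c N := by
    intro N x
    have h1 : HasFDerivAt (fun y : Space n => c N • y) (c N • ContinuousLinearMap.id ℝ (Space n)) x :=
      (hasFDerivAt_id x).const_smul (c N)
    have h2 : HasFDerivAt (χ N) ((fderiv ℝ b (c N • x)).comp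
        (c N • ContinuousLinearMap.id ℝ (Space n))) x :=
      (hbs.differentiable (by simp) (c N • x)).hasFDerivAt.comp x h1
    rw [gradient, LinearIsometryEquiv.norm_map, h2.fderiv, ContinuousLinearMap.comp_smul,
      ContinuousLinearMap.comp_id, norm_smul, Real.norm_of_nonneg (hc0 N).le, mul_comm]
    exact mul_le_mul_of_nonneg_right (hC _) (hc0 N).le
  have hχc : ∀ N, HasCompactSupport (χ N) := fun N =>
    b.hasCompactSupport.comp_homeomorph (Homeomorph.smulOfNeZero (c N) (hc0 N).ne')
  have hws := contDiff_decayWeight (n := n) R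
  refine ⟨C, hC0, fun N x => decayWeight n R x * χ N x, fun N => hws.mul (hχs N),
    fun N => (hχc N).mul_left, fun N x => mul_nonneg (decayWeight_pos R x).le b.nonneg,
    fun N x => mul_le_of_le_one_right (decayWeight_pos R x).le b.le_one, fun N x => ?_,
    fun x => ?_⟩
  · rw [gradient_mul (hws.differentiable (by simp) x) ((hχs N).differentiable (by simp) x)]
    refine (norm_add_le _ _).trans ?_
    rw [norm_smul, norm_smul, Real.norm_of_nonneg (decayWeight_pos R x).le,
      Real.norm_of_nonneg (b.nonneg : 0 ≤ χ N x)]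
    have h1 := mul_le_mul_of_nonneg_left (hχg N x) (decayWeight_pos R x).le
    have h2 := mul_le_mul_of_nonneg_left (norm_gradient_decayWeight_le hR x)
      (b.nonneg : 0 ≤ χ N x)
    rw [div_eq_mul_inv C]
    calc _ ≤ decayWeight n R x * (C * c N) + χ N x * (n / R * decayWeight n R x) := add_le_add h1 h2
      _ = _ := by simp only [hc]; ring
  · have hlim : Tendsto (fun N : ℕ => (N : ℝ) + 1) atTop atTop :=
      tendsto_natCast_atTop_atTop.atTop_add tendsto_const_nhds
    filter_upwards [hlim.eventually_gt_atTop ‖x‖] with N hN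
    have hmem : c N • x ∈ Metric.ball (0 : Space n) 1 := by
      rw [mem_ball_zero_iff, norm_smul, Real.norm_of_nonneg (hc0 N).le]
      simp only [hc]
      rw [inv_mul_lt_iff₀ (by positivity), mul_one]
      exact hN
    have hev : χ N =ᶠ[𝓝 x] fun _ => 1 := by
      have h1 : ∀ᶠ y in 𝓝 x, c N • y ∈ Metric.ball (0 : Space n) 1 :=
        (continuous_const_smul (c N)).continuousAt.eventually_mem
          (Metric.isOpen_ball.mem_nhds hmem)
      filter_upwards [h1] with y hy
      exact b.one_of_mem_closedBall (Metric.ball_subset_closedBall hy)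
    refine ⟨by simp only [hev.self_of_nhds, mul_one], ?_⟩
    have hev2 : (fun y => decayWeight n R y * χ N y) =ᶠ[𝓝 x] decayWeight n R := by
      filter_upwards [hev] with y hy
      rw [hy, mul_one]
    rw [gradient, gradient, hev2.fderiv_eq]

end Weight

/-! ### Evolution of the weighted mass. -/

section WeightedMass

/-- Fatou's lemma, in a form that also yields integrability of the limit. -/
theorem integrable_of_tendsto_of_integral_le {α : Type*} [MeasurableSpace α] {μ : Measure α}
    {f : ℕ → α → ℝ} {g : α → ℝ} {b : ℕ → ℝ} {B : ℝ} (hf : ∀ N, Integrable (f N) μ)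
    (h0 : ∀ N, 0 ≤ᵐ[μ] f N)
    (hlim : ∀ᵐ x ∂μ, Tendsto (fun N => f N x) atTop (𝓝 (g x)))
    (hb : ∀ N, ∫ x, f N x ∂μ ≤ b N) (hB : Tendsto b atTop (𝓝 B)) :
    Integrable g μ ∧ ∫ x, g x ∂μ ≤ B := by
  have hg0 : 0 ≤ᵐ[μ] g := by
    filter_upwards [hlim, ae_all_iff.2 h0] with x hx hx0
    exact ge_of_tendsto' hx hx0
  have hgm : AEStronglyMeasurable g μ :=
    aestronglyMeasurable_of_tendsto_ae atTop (fun N => (hf N).aestronglyMeasurable) hlim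
  have hle : ∫⁻ x, ENNReal.ofReal (g x) ∂μ ≤ ENNReal.ofReal B := by
    calc ∫⁻ x, ENNReal.ofReal (g x) ∂μ
        = ∫⁻ x, liminf (fun N => ENNReal.ofReal (f N x)) atTop ∂μ := by
          refine lintegral_congr_ae ?_
          filter_upwards [hlim] with x hx
          exact ((ENNReal.continuous_ofReal.tendsto _).comp hx).liminf_eq.symm
      _ ≤ liminf (fun N => ∫⁻ x, ENNReal.ofReal (f N x) ∂μ) atTop :=
          lintegral_liminf_le' fun N => (hf N).aestronglyMeasurable.aemeasurable.ennreal_ofReal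
      _ ≤ liminf (fun N => ENNReal.ofReal (b N)) atTop := by
          refine liminf_le_liminf (Eventually.of_forall fun N => ?_)
          rw [← ofReal_integral_eq_lintegral_ofReal (hf N) (h0 N)]
          exact ENNReal.ofReal_le_ofReal (hb N)
      _ = ENNReal.ofReal B := ((ENNReal.continuous_ofReal.tendsto _).comp hB).liminf_eq
  have hB0 : 0 ≤ B := ge_of_tendsto' hB fun N =>
    (integral_nonneg_of_ae (h0 N)).trans (hb N)
  refine ⟨⟨hgm, ?_⟩, ?_⟩
  · rw [hasFiniteIntegral_iff_ofReal hg0]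
    exact hle.trans_lt ENNReal.ofReal_lt_top
  · rw [integral_eq_lintegral_of_nonneg_ae hg0 hgm]
    exact ENNReal.toReal_le_of_le_ofReal hB0 hle

variable {n : ℕ}

/-- By Tonelli: the masses of the slices are bounded uniformly in time, so only the time factor has
to be integrable. -/
theorem integrableOn_time_mul {W : ℝ → ℝ} {f : SpaceTime n → ℝ} {T B : ℝ}
    (hW : IntegrableOn W (Ioo 0 T))
    (hf : AEStronglyMeasurable f (volume.restrict (Ioo 0 T ×ˢ univ)))
    (hf0 : ∀ t ∈ Ioo 0 T, ∀ x, 0 ≤ f (t, x))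
    (hfi : ∀ t ∈ Ioo 0 T, Integrable fun x => f (t, x))
    (hB : ∀ t ∈ Ioo 0 T, ∫ x, f (t, x) ≤ B) :
    IntegrableOn (fun p : SpaceTime n => W p.1 * f p) (Ioo 0 T ×ˢ univ) := by
  rw [restrict_prod_univ] at hf
  rw [IntegrableOn, restrict_prod_univ]
  have hm : AEStronglyMeasurable (fun p : SpaceTime n => W p.1 * f p)
      ((volume.restrict (Ioo 0 T)).prod (volume : Measure (Space n))) :=
    hW.aestronglyMeasurable.comp_fst.mul hf
  rw [integrable_prod_iff hm]
  refine ⟨?_, ?_⟩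
  · filter_upwards [ae_restrict_mem measurableSet_Ioo] with t ht
    exact (hfi t ht).const_mul _
  · refine Integrable.mono' (hW.norm.mul_const B) hm.norm.integral_prod_right' ?_
    filter_upwards [ae_restrict_mem measurableSet_Ioo] with t ht
    rw [Real.norm_of_nonneg (integral_nonneg fun x => norm_nonneg _)]
    simp only [norm_mul]
    rw [integral_const_mul]
    refine mul_le_mul_of_nonneg_left ?_ (norm_nonneg _)
    refine le_trans (le_of_eq ?_) (hB t ht)
    exact integral_congr_ae (Eventually.of_forall fun x => Real.norm_of_nonneg (hf0 t ht x))

namespace IsFluxSolution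

variable {u : SpaceTime n → ℝ} {u₀ : Space n → ℝ} {F : SpaceTime n → Space n}

theorem aestronglyMeasurable (h : IsFluxSolution u u₀ F) (T : ℝ) :
    AEStronglyMeasurable u (volume.restrict (Ioo 0 T ×ˢ univ)) :=
  h.locallyIntegrableOn.aestronglyMeasurable.mono_measure
    (Measure.restrict_mono (prod_mono Ioo_subset_Ioi_self subset_rfl) le_rfl)

theorem slice_eq_setIntegral (h : IsFluxSolution u u₀ F) {ψ : Space n → ℝ} (hψ : ContDiff ℝ ∞ ψ)
    (hψc : HasCompactSupport ψ) {t : ℝ} (ht : 0 < t) :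
    ∫ x, u (t, x) * ψ x = (∫ x, u₀ x * ψ x)
      - ∫ p in Ioo 0 t ×ˢ univ, inner ℝ (F p) (gradient ψ p.2) := by
  rw [h.slice_eq hψ hψc ht]
  congr 1
  have hi := h.integrableOn_inner_snd ht (memLp_gradient hψ hψc)
  rw [IntegrableOn, restrict_prod_univ] at hi
  rw [restrict_prod_univ, integral_prod _ hi, intervalIntegral.integral_of_le ht.le,
    integral_Ioc_eq_integral_Ioo]

theorem integrableOn_norm_flux_mul_decayWeight (h : IsFluxSolution u u₀ F) (hn : 0 < n) {R : ℝ}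
    (hR : 0 < R) {T : ℝ} (hT : 0 < T) :
    IntegrableOn (fun p => ‖F p‖ * decayWeight n R p.2) (Ioo 0 T ×ˢ univ) := by
  refine (h.memLp_flux T hT).norm.integrable_mul (q := 2) ?_
  rw [restrict_prod_univ]
  exact (memLp_decayWeight hn hR).comp_snd _

/-- Passage from compactly supported cutoffs to the full weight. The flux terms converge because `F`
and the weight are both square integrable on the slab; Fatou's lemma then makes the slice
integrable, and only after that does dominated convergence apply to it. -/
theorem slice_decayWeight (h : IsFluxSolution u u₀ F) (hn : 0 < n) (hu₀ : Integrable u₀)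
    {R : ℝ} (hR : 0 < R) {t : ℝ} (ht : 0 < t) :
    Integrable (fun x => u (t, x) * decayWeight n R x) ∧
    ∫ x, u (t, x) * decayWeight n R x = (∫ x, u₀ x * decayWeight n R x)
      - ∫ p in Ioo 0 t ×ˢ univ, inner ℝ (F p) (gradient (decayWeight n R) p.2) := by
  obtain ⟨C, hC, ζ, hζ, hζc, hζ0, hζle, hζg, hζlim⟩ := exists_cutoff_decayWeight n hR
  have hdw := (contDiff_decayWeight (n := n) R).continuous
  have hflux := h.integrableOn_norm_flux_mul_decayWeight hn hR ht
  have hu₀R : Integrable (fun x => u₀ x * decayWeight n R x) := by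
    refine Integrable.mono' hu₀ (hu₀.aestronglyMeasurable.mul hdw.aestronglyMeasurable)
      (Eventually.of_forall fun x => ?_)
    rw [Real.norm_of_nonneg (mul_nonneg (h.nonneg_init x) (decayWeight_pos R x).le)]
    exact mul_le_of_le_one_right (h.nonneg_init x) (decayWeight_le_one R x)
  have lim1 : Tendsto (fun N => ∫ x, u₀ x * ζ N x) atTop
      (𝓝 (∫ x, u₀ x * decayWeight n R x)) := by
    refine tendsto_integral_of_dominated_convergence (fun x => u₀ x * decayWeight n R x)
      (fun N => hu₀.aestronglyMeasurable.mul (hζ N).continuous.aestronglyMeasurable) hu₀R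
      (fun N => Eventually.of_forall fun x => ?_) (Eventually.of_forall fun x => ?_)
    · rw [Real.norm_of_nonneg (mul_nonneg (h.nonneg_init x) (hζ0 N x))]
      exact mul_le_mul_of_nonneg_left (hζle N x) (h.nonneg_init x)
    · refine tendsto_const_nhds.mul (tendsto_const_nhds.congr' ?_)
      filter_upwards [hζlim x] with N hN using hN.1.symm
  have lim2 : Tendsto (fun N => ∫ p in Ioo 0 t ×ˢ univ, inner ℝ (F p) (gradient (ζ N) p.2)) atTop
      (𝓝 (∫ p in Ioo 0 t ×ˢ univ, inner ℝ (F p) (gradient (decayWeight n R) p.2))) := by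
    refine tendsto_integral_of_dominated_convergence
      (fun p => (n / R + C) * (‖F p‖ * decayWeight n R p.2))
      (fun N => (h.integrableOn_inner_snd ht (memLp_gradient (hζ N) (hζc N))).aestronglyMeasurable)
      (hflux.const_mul _) (fun N => Eventually.of_forall fun p => ?_)
      (Eventually.of_forall fun p => ?_)
    · refine (norm_inner_le_norm _ _).trans ?_
      have h1 := hζg N p.2
      have h2 : n / R * ζ N p.2 ≤ n / R * decayWeight n R p.2 :=
        mul_le_mul_of_nonneg_left (hζle N p.2) (by positivity)
      have h3 : C / ((N : ℝ) + 1) * decayWeight n R p.2 ≤ C * decayWeight n R p.2 := by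
        refine mul_le_mul_of_nonneg_right (div_le_self hC ?_) (decayWeight_pos R p.2).le
        have : (0 : ℝ) ≤ N := N.cast_nonneg
        linarith
      calc ‖F p‖ * ‖gradient (ζ N) p.2‖ ≤ ‖F p‖ * ((n / R + C) * decayWeight n R p.2) :=
            mul_le_mul_of_nonneg_left (by linarith) (norm_nonneg _)
        _ = _ := by ring
    · refine tendsto_const_nhds.congr' ?_
      filter_upwards [hζlim p.2] with N hN
      rw [hN.2]
  have lim3 := lim1.sub lim2
  have hlimu : ∀ x, Tendsto (fun N => u (t, x) * ζ N x) atTop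
      (𝓝 (u (t, x) * decayWeight n R x)) := fun x => by
    refine tendsto_const_nhds.mul (tendsto_const_nhds.congr' ?_)
    filter_upwards [hζlim x] with N hN using hN.1.symm
  have hInt : Integrable (fun x => u (t, x) * decayWeight n R x) :=
    (integrable_of_tendsto_of_integral_le
      (fun N => h.slice_integrable (hζ N).continuous (hζc N) ht)
      (fun N => Eventually.of_forall fun x => mul_nonneg (h.nonneg t ht x) (hζ0 N x))
      (Eventually.of_forall hlimu)
      (fun N => (h.slice_eq_setIntegral (hζ N) (hζc N) ht).le) lim3).1
  refine ⟨hInt, ?_⟩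
  have lim4 : Tendsto (fun N => ∫ x, u (t, x) * ζ N x) atTop
      (𝓝 (∫ x, u (t, x) * decayWeight n R x)) := by
    refine tendsto_integral_of_dominated_convergence (fun x => u (t, x) * decayWeight n R x)
      (fun N => (h.slice_integrable (hζ N).continuous (hζc N) ht).aestronglyMeasurable) hInt
      (fun N => Eventually.of_forall fun x => ?_) (Eventually.of_forall hlimu)
    rw [Real.norm_of_nonneg (mul_nonneg (h.nonneg t ht x) (hζ0 N x))]
    exact mul_le_mul_of_nonneg_left (hζle N x) (h.nonneg t ht x)
  refine tendsto_nhds_unique lim4 (lim3.congr fun N => ?_)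
  exact (h.slice_eq_setIntegral (hζ N) (hζc N) ht).symm

/-- Reduces conservation of mass to showing that the weighted flux grows more slowly than `R`. -/
theorem abs_slice_decayWeight_sub_le (h : IsFluxSolution u u₀ F) (hn : 0 < n)
    (hu₀ : Integrable u₀) {R : ℝ} (hR : 0 < R) {t T : ℝ} (ht : t ∈ Ioo 0 T) :
    |(∫ x, u (t, x) * decayWeight n R x) - ∫ x, u₀ x * decayWeight n R x|
      ≤ n / R * ∫ p in Ioo 0 T ×ˢ univ, ‖F p‖ * decayWeight n R p.2 := by
  rw [(h.slice_decayWeight hn hu₀ hR ht.1).2, sub_sub_cancel_left, abs_neg]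
  have hi := h.integrableOn_norm_flux_mul_decayWeight hn hR (ht.1.trans ht.2)
  have hsub : Ioo 0 t ×ˢ (univ : Set (Space n)) ⊆ Ioo 0 T ×ˢ univ :=
    prod_mono (Ioo_subset_Ioo le_rfl ht.2.le) subset_rfl
  calc |∫ p in Ioo 0 t ×ˢ univ, inner ℝ (F p) (gradient (decayWeight n R) p.2)|
      ≤ ∫ p in Ioo 0 t ×ˢ univ, n / R * (‖F p‖ * decayWeight n R p.2) := by
        rw [← Real.norm_eq_abs]
        refine norm_integral_le_of_norm_le ((hi.mono_set hsub).const_mul _)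
          (Eventually.of_forall fun p => (norm_inner_le_norm _ _).trans ?_)
        calc ‖F p‖ * ‖gradient (decayWeight n R) p.2‖
            ≤ ‖F p‖ * (n / R * decayWeight n R p.2) :=
              mul_le_mul_of_nonneg_left (norm_gradient_decayWeight_le hR p.2) (norm_nonneg _)
          _ = _ := by ring
    _ = n / R * ∫ p in Ioo 0 t ×ˢ univ, ‖F p‖ * decayWeight n R p.2 := integral_const_mul _ _
    _ ≤ _ := by
        refine mul_le_mul_of_nonneg_left ?_ (by positivity)
        exact setIntegral_mono_set hi (Eventually.of_forall fun p =>
          mul_nonneg (norm_nonneg _) (decayWeight_pos R p.2).le) hsub.eventuallyLE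

theorem integral_mul_decayWeight_le (h : IsFluxSolution u u₀ F) (hu₀ : Integrable u₀) (R : ℝ) :
    ∫ x, u₀ x * decayWeight n R x ≤ ∫ x, u₀ x := by
  refine integral_mono_of_nonneg (Eventually.of_forall fun x =>
    mul_nonneg (h.nonneg_init x) (decayWeight_pos R x).le) hu₀ (Eventually.of_forall fun x => ?_)
  exact mul_le_of_le_one_right (h.nonneg_init x) (decayWeight_le_one R x)

theorem exists_slice_decayWeight_le (h : IsFluxSolution u u₀ F) (hn : 0 < n)
    (hu₀ : Integrable u₀) {R : ℝ} (hR : 0 < R) (T : ℝ) :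
    ∃ B, ∀ t ∈ Ioo 0 T, ∫ x, u (t, x) * decayWeight n R x ≤ B := by
  refine ⟨(∫ x, u₀ x) + n / R * ∫ p in Ioo 0 T ×ˢ univ, ‖F p‖ * decayWeight n R p.2,
    fun t ht => ?_⟩
  have h1 := (abs_le.1 (h.abs_slice_decayWeight_sub_le hn hu₀ hR ht)).2
  have h2 := h.integral_mul_decayWeight_le hu₀ R
  linarith

theorem integrableOn_time_mul_decayWeight (h : IsFluxSolution u u₀ F) (hn : 0 < n)
    (hu₀ : Integrable u₀) {R : ℝ} (hR : 0 < R) {W : ℝ → ℝ} {T : ℝ}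
    (hW : IntegrableOn W (Ioo 0 T)) :
    IntegrableOn (fun p : SpaceTime n => W p.1 * (u p * decayWeight n R p.2))
      (Ioo 0 T ×ˢ univ) := by
  obtain ⟨B, hB⟩ := h.exists_slice_decayWeight_le hn hu₀ hR T
  exact integrableOn_time_mul hW ((h.aestronglyMeasurable T).mul
    ((contDiff_decayWeight R).continuous.comp continuous_snd).aestronglyMeasurable)
    (fun t ht x => mul_nonneg (h.nonneg t ht.1 x) (decayWeight_pos R x).le)
    (fun t ht => (h.slice_decayWeight hn hu₀ hR ht.1).1) hB

theorem integrableOn_mul_decayWeight (h : IsFluxSolution u u₀ F) (hn : 0 < n)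
    (hu₀ : Integrable u₀) {R : ℝ} (hR : 0 < R) (T : ℝ) :
    IntegrableOn (fun p : SpaceTime n => u p * decayWeight n R p.2) (Ioo 0 T ×ˢ univ) := by
  simpa using h.integrableOn_time_mul_decayWeight hn hu₀ hR (W := fun _ => 1) (T := T) (by simp)

/-- The flux against a small power of the solution is integrable with respect to the weight. -/
theorem integrableOn_rpow_mul_flux (h : IsFluxSolution u u₀ F) (hn : 0 < n)
    (hu₀ : Integrable u₀) {R : ℝ} (hR : 0 < R) {T : ℝ} (hT : 0 < T) {a : ℝ} (ha : 0 < a)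
    (ha2 : 2 * a ≤ 1) :
    IntegrableOn (fun p => u p ^ a * (‖F p‖ * decayWeight n R p.2)) (Ioo 0 T ×ˢ univ) := by
  have hF2 : IntegrableOn (fun p => ‖F p‖ ^ 2) (Ioo 0 T ×ˢ univ) :=
    (memLp_two_iff_integrable_sq_norm (h.memLp_flux T hT).aestronglyMeasurable).1
      (h.memLp_flux T hT)
  have hζ : IntegrableOn (fun p : SpaceTime n => decayWeight n R p.2) (Ioo 0 T ×ˢ univ) := by
    rw [IntegrableOn, restrict_prod_univ]
    exact (integrable_decayWeight hn hR).comp_snd _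
  have huζ := h.integrableOn_mul_decayWeight hn hu₀ hR T
  refine Integrable.mono' ((hF2.add hζ).add huζ) ?_ ?_
  · refine AEStronglyMeasurable.mul ?_ (h.integrableOn_norm_flux_mul_decayWeight hn hR hT).1
    exact ((h.aestronglyMeasurable T).aemeasurable.pow_const a).aestronglyMeasurable
  · filter_upwards [ae_restrict_mem (measurableSet_Ioo.prod MeasurableSet.univ)] with p hp
    have hu : 0 ≤ u p := h.nonneg p.1 hp.1.1 p.2
    have hz0 := (decayWeight_pos R p.2).le
    have hz1 := decayWeight_le_one R p.2
    have hua : 0 ≤ u p ^ a := Real.rpow_nonneg hu a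
    rw [Real.norm_of_nonneg (by positivity)]
    -- The condition `2 a ≤ 1` enters here: the square of `u^a` is integrable against the weight,
    -- and Young's inequality pairs it with `F ∈ L²`.
    have h2 : (u p ^ a) ^ 2 ≤ 1 + u p := by
      rw [← Real.rpow_natCast, ← Real.rpow_mul hu]
      rcases le_total (u p) 1 with h1 | h1
      · have := Real.rpow_le_one hu h1 (z := a * (2 : ℕ)) (by positivity)
        linarith
      · have := Real.rpow_le_rpow_of_exponent_le h1 (y := a * (2 : ℕ)) (z := 1) (by
          push_cast; linarith)
        rw [Real.rpow_one] at this
        linarith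
    have h3 : (u p ^ a) ^ 2 * decayWeight n R p.2 ≤ (1 + u p) * decayWeight n R p.2 :=
      mul_le_mul_of_nonneg_right h2 hz0
    have h4 : (u p ^ a) ^ 2 * decayWeight n R p.2 ^ 2 ≤ (u p ^ a) ^ 2 * decayWeight n R p.2 := by
      refine mul_le_mul_of_nonneg_left ?_ (sq_nonneg _)
      rw [sq]
      exact mul_le_of_le_one_left hz0 hz1
    simp only [Pi.add_apply]
    nlinarith [sq_nonneg (‖F p‖ - u p ^ a * decayWeight n R p.2), sq_nonneg ‖F p‖,
      sq_nonneg (u p ^ a * decayWeight n R p.2)]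

end IsFluxSolution

end WeightedMass

/-! ### Degenerate fluxes and the pointwise energy estimate. -/

section DegenerateFlux

variable {n : ℕ}

/-- The flux `F` is a degenerate diffusion flux for `u`, with weight `w` between `ν u ^ σ` and an
integrable function `W` of time. -/
structure IsDegenerateFlux (u : SpaceTime n → ℝ) (F G : SpaceTime n → Space n)
    (w : SpaceTime n → ℝ) (W : ℝ → ℝ) (c C ν σ : ℝ) : Prop where
  c_pos : 0 < c
  C_pos : 0 < C
  ν_pos : 0 < ν
  σ_pos : 0 < σ
  weakGrad : HasWeakSpaceGrad (Ioi 0 ×ˢ univ) u G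
  locallyIntegrableOn_grad : LocallyIntegrableOn G (Ioi 0 ×ˢ univ)
  aestronglyMeasurable_weight : AEStronglyMeasurable w (volume.restrict (Ioi 0 ×ˢ univ))
  W_nonneg : ∀ t, 0 ≤ W t
  integrableOn_W : ∀ T, IntegrableOn W (Ioo 0 T)
  weight_le : ∀ᵐ p ∂(volume.restrict (Ioi 0 ×ˢ univ)), w p ≤ W p.1
  le_weight : ∀ᵐ p ∂(volume.restrict (Ioi 0 ×ˢ univ)), ν * u p ^ σ ≤ w p
  coercive : ∀ᵐ p ∂(volume.restrict (Ioi 0 ×ˢ univ)),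
    w p * (c * ‖G p‖ ^ 2 - C * u p ^ 2) ≤ inner ℝ (F p) (G p)
  growth : ∀ᵐ p ∂(volume.restrict (Ioi 0 ×ˢ univ)), ‖F p‖ ≤ w p * (C * ‖G p‖ + C * u p)

theorem le_add_of_sq_le {x y z : ℝ} (hx : 0 ≤ x) (hy : 0 ≤ y) (h : z ^ 2 ≤ x * z + y ^ 2) :
    z ≤ x + y := by
  by_contra! hc
  have h1 : y < z - x := by linarith
  have h2 : 0 < z := by linarith
  nlinarith

/-- The inequality of arithmetic and geometric means, in the form in which the Young inequalities
below use it. -/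
theorem le_add_of_sq_le_four_mul {x y z : ℝ} (hx : 0 ≤ x) (hy : 0 ≤ y) (h : z ^ 2 ≤ 4 * x * y) :
    z ≤ x + y := by
  refine abs_le_of_sq_le_sq' ?_ (by positivity) |>.2
  nlinarith [sq_nonneg (x - y)]

/-- The coercive part of the energy density dominates the remaining terms up to controlled
errors. -/
theorem energy_density_le {E : Type*} [NormedAddCommGroup E] [InnerProductSpace ℝ E]
    {F G D : E} {a K N c C w V z ζ Z e : ℝ} {g h H : ℝ → ℝ} (ha : 0 < a)
    (hpr : IsPowerProfile a K N g h H) (hK : 0 ≤ K) (hN : 1 ≤ N) (hc : 0 < c) (hC : 0 < C)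
    (hw : 0 ≤ w) (hwV : w ≤ V) (hz : 0 ≤ z) (hζ : 0 ≤ ζ) (hζZ : ζ ≤ Z) (he : 0 ≤ e)
    (hD : ‖D‖ ≤ ζ + e * Z) (hco : w * (c * ‖G‖ ^ 2 - C * z ^ 2) ≤ inner ℝ F G)
    (hgr : ‖F‖ ≤ w * (C * ‖G‖ + C * z)) :
    c / 2 * (g z * w * ‖G‖ ^ 2 * ζ) ≤ inner ℝ F (ζ • g z • G + h z • D)
      + (a * C + C ^ 2 / (2 * c * a) + C) * K * (V * (H z * ζ))
      + (a * C + C ^ 2 / (2 * c * a) + C) * K * N ^ (-a) * (V * (z * Z))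
      + z ^ a * (‖F‖ * Z) * min 1 (z / N) + e * (z ^ a * (‖F‖ * Z)) := by
  obtain ⟨Cg, M, hp⟩ := hpr.exists_bounds
  -- The three summands come from the zeroth order term of coercivity, from Young's inequality
  -- against half of the coercive term, and from the zeroth order term of the growth bound.
  set L := a * C + C ^ 2 / (2 * c * a) + C with hL
  have hL0 : 0 ≤ L := by positivity
  have hZ : 0 ≤ Z := hζ.trans hζZ
  have hg := hp.g_nonneg z
  have hh := hpr.h_nonneg z hz
  have hH := hpr.H_nonneg z hz
  have hza : 0 ≤ z ^ a := Real.rpow_nonneg hz a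
  have hz1a : 0 ≤ z ^ (1 + a) := Real.rpow_nonneg hz _
  have hNa : 0 ≤ N ^ (-a) := Real.rpow_nonneg (by linarith) _
  have hV : 0 ≤ V := hw.trans hwV
  have hzz : z * z ^ a = z ^ (1 + a) := by
    rcases hz.eq_or_lt with h0 | h0
    · rw [← h0, zero_mul, Real.zero_rpow (by positivity)]
    · rw [Real.rpow_add h0, Real.rpow_one]
  have hgz : g z * z ^ 2 ≤ a * z ^ (1 + a) := by
    rcases hz.eq_or_lt with h0 | h0
    · rw [← h0, Real.zero_rpow (by positivity)]; simp
    · calc g z * z ^ 2 ≤ a * z ^ (a - 1) * z ^ 2 :=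
            mul_le_mul_of_nonneg_right (hpr.g_le_rpow z h0) (sq_nonneg z)
        _ = a * z ^ (1 + a) := by
            rw [mul_assoc, ← Real.rpow_natCast z 2, ← Real.rpow_add h0]
            congr 2
            push_cast
            ring
  have hmin : 0 ≤ min 1 (z / N) := le_min zero_le_one (by positivity)
  have e1 : inner ℝ F (ζ • g z • G + h z • D) = ζ * g z * inner ℝ F G + h z * inner ℝ F D := by
    rw [inner_add_right, inner_smul_right, inner_smul_right, inner_smul_right]; ring
  have h1 : ζ * g z * (w * (c * ‖G‖ ^ 2 - C * z ^ 2)) ≤ ζ * g z * inner ℝ F G :=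
    mul_le_mul_of_nonneg_left hco (by positivity)
  have h2 : - (h z * ‖F‖ * ζ + e * (z ^ a * (‖F‖ * Z))) ≤ h z * inner ℝ F D := by
    have h3 : -(‖F‖ * ‖D‖) ≤ inner ℝ F D := (abs_le.1 (abs_real_inner_le_norm F D)).1
    have h4 : h z * (-(‖F‖ * ‖D‖)) ≤ h z * inner ℝ F D := mul_le_mul_of_nonneg_left h3 hh
    have h5 : h z * ‖F‖ * ‖D‖ ≤ h z * ‖F‖ * (ζ + e * Z) :=
      mul_le_mul_of_nonneg_left hD (by positivity)
    have h6 : h z * (‖F‖ * e * Z) ≤ z ^ a * (‖F‖ * e * Z) :=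
      mul_le_mul_of_nonneg_right (hpr.h_le_rpow z hz) (by positivity)
    linarith
  -- the zeroth order terms are absorbed below level `2 N`
  have h7 : z ≤ 2 * N → L * (w * z ^ (1 + a) * ζ)
      ≤ L * K * (V * (H z * ζ)) + L * K * N ^ (-a) * (V * (z * Z)) := by
    intro hz2
    have h8 := hpr.rpow_le z hz hz2
    have h9 : w * z ^ (1 + a) * ζ ≤ V * (K * H z + K * N ^ (-a) * z) * ζ :=
      mul_le_mul_of_nonneg_right (mul_le_mul hwV h8 hz1a hV) hζ
    have h10 : L * K * N ^ (-a) * V * z * ζ ≤ L * K * N ^ (-a) * V * z * Z :=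
      mul_le_mul_of_nonneg_left hζZ (by positivity)
    have h11 := mul_le_mul_of_nonneg_left h9 hL0
    linarith
  have hpos : 0 ≤ L * K * (V * (H z * ζ)) + L * K * N ^ (-a) * (V * (z * Z)) := by positivity
  have hgw : ζ * w * (g z * z ^ 2) * C ≤ ζ * w * (a * z ^ (1 + a)) * C :=
    mul_le_mul_of_nonneg_right (mul_le_mul_of_nonneg_left hgz (by positivity)) hC.le
  rw [e1]
  -- Up to level `N` the profile satisfies `a h² ≤ g z^(1+a)`, so the cross term is absorbed. Above
  -- `N` that bound is not available and the term is left as the error `z^a |F| Z`; there `min 1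
  -- (z/N) = 1`, while in the limit `N → ∞` this factor makes the error vanish.
  rcases le_or_gt z N with hzN | hzN
  · have h12 := h7 (by linarith)
    have h13 : h z * ‖F‖ * ζ ≤ h z * (w * (C * ‖G‖ + C * z)) * ζ :=
      mul_le_mul_of_nonneg_right (mul_le_mul_of_nonneg_left hgr hh) hζ
    have h14 : C * (h z * ‖G‖) ≤ c / 2 * (g z * ‖G‖ ^ 2) + C ^ 2 / (2 * c * a) * z ^ (1 + a) := by
      have h15 := mul_le_mul_of_nonneg_right (hpr.h_sq_le z hz hzN) (sq_nonneg ‖G‖)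
      refine le_add_of_sq_le_four_mul (by positivity) (by positivity) ?_
      have : 4 * (c / 2 * (g z * ‖G‖ ^ 2)) * (C ^ 2 / (2 * c * a) * z ^ (1 + a))
          = C ^ 2 / a * (g z * z ^ (1 + a) * ‖G‖ ^ 2) := by field_simp; ring
      rw [this]
      calc (C * (h z * ‖G‖)) ^ 2 = C ^ 2 / a * (a * h z ^ 2 * ‖G‖ ^ 2) := by field_simp
        _ ≤ _ := mul_le_mul_of_nonneg_left h15 (by positivity)
    have h17 : h z * z ≤ z ^ (1 + a) := by
      rw [← hzz, mul_comm z]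
      exact mul_le_mul_of_nonneg_right (hpr.h_le_rpow z hz) hz
    have h18 : h z * ‖F‖ * ζ ≤ w * ζ * (c / 2 * (g z * ‖G‖ ^ 2)
        + C ^ 2 / (2 * c * a) * z ^ (1 + a) + C * z ^ (1 + a)) := by
      refine h13.trans ?_
      have h19 : C * (h z * z) ≤ C * z ^ (1 + a) := mul_le_mul_of_nonneg_left h17 hC.le
      calc h z * (w * (C * ‖G‖ + C * z)) * ζ = w * ζ * (C * (h z * ‖G‖) + C * (h z * z)) := by ring
        _ ≤ _ := mul_le_mul_of_nonneg_left (by linarith) (by positivity)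
    have h20 : 0 ≤ z ^ a * (‖F‖ * Z) * min 1 (z / N) := by positivity
    have h21 : L * (w * z ^ (1 + a) * ζ) = ζ * w * (a * z ^ (1 + a)) * C
        + w * ζ * (C ^ 2 / (2 * c * a) * z ^ (1 + a) + C * z ^ (1 + a)) := by rw [hL]; ring
    linarith
  · have hm1 : min 1 (z / N) = 1 := min_eq_left ((one_le_div (by linarith)).2 hzN.le)
    rw [hm1, mul_one]
    have h13 : h z * ‖F‖ * ζ ≤ z ^ a * (‖F‖ * Z) := by
      rw [mul_assoc]
      exact mul_le_mul (hpr.h_le_rpow z hz) (mul_le_mul_of_nonneg_left hζZ (norm_nonneg _))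
        (by positivity) hza
    have h22 : 0 ≤ c / 2 * (g z * w * ‖G‖ ^ 2 * ζ) := by positivity
    have h23 : ζ * w * (g z * z ^ 2) * C
        ≤ L * K * (V * (H z * ζ)) + L * K * N ^ (-a) * (V * (z * Z)) := by
      rcases le_or_gt z (2 * N) with hz2 | hz2
      · refine le_trans ?_ (h7 hz2)
        have : L * (w * z ^ (1 + a) * ζ) = ζ * w * (a * z ^ (1 + a)) * C
          + w * ζ * (C ^ 2 / (2 * c * a) * z ^ (1 + a) + C * z ^ (1 + a)) := by rw [hL]; ring
        have : 0 ≤ w * ζ * (C ^ 2 / (2 * c * a) * z ^ (1 + a) + C * z ^ (1 + a)) := by positivity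
        linarith
      · rw [hpr.g_eq_zero_of_ge z hz2.le]
        simpa using hpos
    linarith

namespace IsDegenerateFlux

variable {u w : SpaceTime n → ℝ} {u₀ : Space n → ℝ} {F G : SpaceTime n → Space n} {W : ℝ → ℝ}
  {c C ν σ a K N : ℝ} {g h H : ℝ → ℝ}

/-- On the support of `g` one has `1/N ≤ u ≤ 2N`. There `w` is bounded below through `ν u^σ`, and
coercivity gives a quadratic inequality for `‖G‖` that bounds it by a multiple of `‖F‖` plus a
constant. Hence `h(u)` has a locally square integrable gradient although `u` itself need not. -/
theorem memLp_profile_smul (hd : IsDegenerateFlux u F G w W c C ν σ) (hs : IsFluxSolution u u₀ F)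
    (hpr : IsPowerProfile a K N g h H) (hN : 1 ≤ N) {T : ℝ} (hT : 0 < T) (R : ℝ) :
    MemLp (fun p => g (u p) • G p) 2
      (volume.restrict (Ioo 0 T ×ˢ Metric.closedBall (0 : Space n) R)) := by
  obtain ⟨Cg, M, hp⟩ := hpr.exists_bounds
  have hsub : Ioo 0 T ×ˢ Metric.closedBall (0 : Space n) R ⊆ Ioi 0 ×ˢ univ :=
    prod_mono Ioo_subset_Ioi_self (subset_univ _)
  have hc := hd.c_pos
  have hCp := hd.C_pos
  have hν := hd.ν_pos
  have hN0 : 0 < N := by linarith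
  set w0 := ν * (1 / N) ^ σ with hw0
  have hw0p : 0 < w0 := by positivity
  have hCg : 0 ≤ Cg := (hp.g_nonneg 0).trans (hp.g_le 0)
  have hF : MemLp (fun p => Cg * (‖F p‖ / (c * w0) + √(C / c) * (2 * N))) 2
      (volume.restrict (Ioo 0 T ×ˢ Metric.closedBall (0 : Space n) R)) := by
    have h1 := ((hs.memLp_flux T hT).mono_measure (Measure.restrict_mono
      (prod_mono subset_rfl (subset_univ (Metric.closedBall (0 : Space n) R))) le_rfl)).norm
    have : IsFiniteMeasure (volume.restrict (Ioo 0 T ×ˢ Metric.closedBall (0 : Space n) R)) := by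
      refine ⟨?_⟩
      rw [Measure.restrict_apply_univ, Measure.volume_eq_prod, Measure.prod_prod]
      exact ENNReal.mul_lt_top (by simp) Metric.isBounded_closedBall.measure_lt_top
    refine ((h1.mul_const (c * w0)⁻¹).add (memLp_const (√(C / c) * (2 * N)))).const_mul Cg
  refine hF.mono' ?_ ?_
  · have hu : AEStronglyMeasurable u _ :=
      hs.locallyIntegrableOn.aestronglyMeasurable.mono_measure (Measure.restrict_mono hsub le_rfl)
    have hG : AEStronglyMeasurable G _ := hd.locallyIntegrableOn_grad.aestronglyMeasurable.mono_measure
      (Measure.restrict_mono hsub le_rfl)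
    exact (hp.continuous_g.comp_aestronglyMeasurable hu).smul hG
  · have hco := ae_restrict_of_ae_restrict_of_subset hsub hd.coercive
    have hle := ae_restrict_of_ae_restrict_of_subset hsub hd.le_weight
    filter_upwards [hco, hle, ae_restrict_mem
      (measurableSet_Ioo.prod Metric.isClosed_closedBall.measurableSet)] with p h1 h2 hpm
    rw [norm_smul, Real.norm_of_nonneg (hp.g_nonneg _)]
    have hpos : 0 ≤ ‖F p‖ / (c * w0) + √(C / c) * (2 * N) := by positivity
    rcases le_or_gt (u p) (1 / N) with h3 | h3
    · rw [hpr.g_eq_zero_of_le _ h3, zero_mul]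
      positivity
    rcases le_or_gt (2 * N) (u p) with h4 | h4
    · rw [hpr.g_eq_zero_of_ge _ h4, zero_mul]
      positivity
    refine mul_le_mul (hp.g_le _) ?_ (norm_nonneg _) hCg
    have hu0 : 0 < u p := lt_trans (by positivity) h3
    have hwp : w0 ≤ w p := by
      refine le_trans ?_ h2
      exact mul_le_mul_of_nonneg_left (Real.rpow_le_rpow (by positivity) h3.le hd.σ_pos.le) hν.le
    have hwpos : 0 < w p := lt_of_lt_of_le hw0p hwp
    have h5 : inner ℝ (F p) (G p) ≤ ‖F p‖ * ‖G p‖ := real_inner_le_norm _ _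
    have h6 : ‖G p‖ ≤ ‖F p‖ / (c * w p) + √(C / c) * u p := by
      refine le_add_of_sq_le (by positivity) (by positivity) ?_
      rw [mul_pow, Real.sq_sqrt (by positivity)]
      have h7 : w p * (c * ‖G p‖ ^ 2 - C * u p ^ 2) ≤ ‖F p‖ * ‖G p‖ := h1.trans h5
      have h8 : ‖F p‖ / (c * w p) * ‖G p‖ + C / c * u p ^ 2
          = (‖F p‖ * ‖G p‖ + w p * (C * u p ^ 2)) / (c * w p) := by field_simp
      rw [h8, le_div_iff₀ (by positivity)]
      nlinarith
    refine h6.trans (add_le_add ?_ ?_)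
    · gcongr
    · gcongr

end IsDegenerateFlux

end DegenerateFlux

/-! ### The weighted energy estimate, uniform in the radius. -/

section EnergyEstimate

variable {n : ℕ}

namespace IsDegenerateFlux

variable {u w : SpaceTime n → ℝ} {u₀ : Space n → ℝ} {F G : SpaceTime n → Space n} {W : ℝ → ℝ}
  {c C ν σ a K N : ℝ} {g h H : ℝ → ℝ}

theorem slab_subset (T : ℝ) : Ioo 0 T ×ˢ (univ : Set (Space n)) ⊆ Ioi 0 ×ˢ univ :=
  prod_mono Ioo_subset_Ioi_self subset_rfl

theorem aestronglyMeasurable_profile (hs : IsFluxSolution u u₀ F) {ζ : Space n → ℝ}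
    (hζ : Continuous ζ) {f : ℝ → ℝ} (hf : Continuous f) (T : ℝ) :
    AEStronglyMeasurable (fun p : SpaceTime n => f (u p) * ζ p.2)
      (volume.restrict (Ioo 0 T ×ˢ univ)) :=
  (hf.comp_aestronglyMeasurable (hs.aestronglyMeasurable T)).mul
    (hζ.comp continuous_snd).aestronglyMeasurable

/-- The truncated `H` has at most linear growth, so the weighted mass controls it. The bound
degenerates with the truncation; it only secures integrability and the a priori bound that starts
Gronwall's iteration. -/
theorem slice_profile (hs : IsFluxSolution u u₀ F) (hn : 0 < n) (hu₀ : Integrable u₀)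
    (hpr : IsPowerProfile a K N g h H) {R : ℝ} (hR : 0 < R) {ζ : Space n → ℝ} (hζ : Continuous ζ)
    (hζ0 : ∀ x, 0 ≤ ζ x) (hζle : ∀ x, ζ x ≤ decayWeight n R x) (T : ℝ) :
    (∀ t ∈ Ioo 0 T, Integrable fun x => H (u (t, x)) * ζ x) ∧
      ∃ B, ∀ t ∈ Ioo 0 T, ∫ x, H (u (t, x)) * ζ x ≤ B := by
  obtain ⟨Cg, M, hp⟩ := hpr.exists_bounds
  obtain ⟨B, hB⟩ := hs.exists_slice_decayWeight_le hn hu₀ hR T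
  have hM : 0 ≤ M := (abs_nonneg _).trans (hp.abs_h_le 0)
  have hle : ∀ t ∈ Ioo 0 T, ∀ x, H (u (t, x)) * ζ x ≤ M * (u (t, x) * decayWeight n R x) := by
    intro t ht x
    have hu := hs.nonneg t ht.1 x
    have h1 := (le_abs_self _).trans (hp.abs_H_le (u (t, x)))
    rw [abs_of_nonneg hu] at h1
    rw [← mul_assoc]
    exact mul_le_mul h1 (hζle x) (hζ0 x) (by positivity)
  have hInt : ∀ t ∈ Ioo 0 T, Integrable fun x => H (u (t, x)) * ζ x := by
    intro t ht
    refine Integrable.mono' ((hs.slice_decayWeight hn hu₀ hR ht.1).1.const_mul M) ?_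
      (Eventually.of_forall fun x => ?_)
    · exact (hp.continuous_H.comp_aestronglyMeasurable
        (hs.datum.slice_locallyIntegrable t ht.1).aestronglyMeasurable).mul
        hζ.aestronglyMeasurable
    · rw [Real.norm_of_nonneg (mul_nonneg (hpr.H_nonneg _ (hs.nonneg t ht.1 x)) (hζ0 x))]
      exact hle t ht x
  refine ⟨hInt, M * B, fun t ht => ?_⟩
  calc ∫ x, H (u (t, x)) * ζ x ≤ ∫ x, M * (u (t, x) * decayWeight n R x) :=
        integral_mono (hInt t ht) ((hs.slice_decayWeight hn hu₀ hR ht.1).1.const_mul M) (hle t ht)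
    _ = M * ∫ x, u (t, x) * decayWeight n R x := integral_const_mul _ _
    _ ≤ M * B := mul_le_mul_of_nonneg_left (hB t ht) hM

theorem ae_energy_density_le (hd : IsDegenerateFlux u F G w W c C ν σ)
    (hs : IsFluxSolution u u₀ F) (ha : 0 < a) (hpr : IsPowerProfile a K N g h H) (hK : 0 ≤ K)
    (hN : 1 ≤ N) {R : ℝ} {ζ : Space n → ℝ} (hζ0 : ∀ x, 0 ≤ ζ x)
    (hζle : ∀ x, ζ x ≤ decayWeight n R x) {e : ℝ} (he : 0 ≤ e)
    (hζg : ∀ x, ‖gradient ζ x‖ ≤ ζ x + e * decayWeight n R x) {L : ℝ}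
    (hL : L = a * C + C ^ 2 / (2 * c * a) + C) :
    ∀ᵐ p ∂(volume.restrict (Ioi 0 ×ˢ univ)),
      0 ≤ g (u p) * w p * ‖G p‖ ^ 2 * ζ p.2 ∧
      c / 2 * (g (u p) * w p * ‖G p‖ ^ 2 * ζ p.2)
        ≤ inner ℝ (F p) (ζ p.2 • g (u p) • G p + h (u p) • gradient ζ p.2)
          + L * K * (W p.1 * (H (u p) * ζ p.2))
          + L * K * N ^ (-a) * (W p.1 * (u p * decayWeight n R p.2))
          + u p ^ a * (‖F p‖ * decayWeight n R p.2) * min 1 (u p / N)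
          + e * (u p ^ a * (‖F p‖ * decayWeight n R p.2)) := by
  obtain ⟨Cg, M, hp⟩ := hpr.exists_bounds
  filter_upwards [hd.weight_le, hd.le_weight, hd.coercive, hd.growth,
    ae_restrict_mem (measurableSet_Ioi.prod MeasurableSet.univ)] with p h1 h2 h3 h4 hpm
  have hu : 0 ≤ u p := hs.nonneg p.1 hpm.1 p.2
  have hw : 0 ≤ w p := (mul_nonneg hd.ν_pos.le (Real.rpow_nonneg hu σ)).trans h2
  refine ⟨?_, ?_⟩
  · have := hp.g_nonneg (u p)
    have := hζ0 p.2
    positivity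
  · rw [hL]
    exact energy_density_le ha hpr hK hN hd.c_pos hd.C_pos hw h1 hu (hζ0 p.2) (hζle p.2) he
      (hζg p.2) h3 h4

/-- The energy inequality with the pointwise density bound inserted. The error terms are nonnegative
and are extended from `(0, t)` to `(0, T)`, so only the Gronwall integral still depends on `t` on
the right. -/
theorem profile_energy_le (hd : IsDegenerateFlux u F G w W c C ν σ) (hs : IsFluxSolution u u₀ F)
    (hn : 0 < n) (hu₀ : Integrable u₀) (ha : 0 < a) (ha2 : 2 * a ≤ 1)
    (hu₀a : Integrable fun x => u₀ x ^ (1 + a))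
    (hpr : IsPowerProfile a K N g h H) (hK : 0 ≤ K) (hN : 1 ≤ N) {T : ℝ} (hT : 0 < T)
    {R : ℝ} (hR : 0 < R) {ζ : Space n → ℝ} (hζ : ContDiff ℝ ∞ ζ) (hζc : HasCompactSupport ζ)
    (hζ0 : ∀ x, 0 ≤ ζ x) (hζle : ∀ x, ζ x ≤ decayWeight n R x) {e : ℝ} (he : 0 ≤ e)
    (hζg : ∀ x, ‖gradient ζ x‖ ≤ ζ x + e * decayWeight n R x) {L : ℝ}
    (hL : L = a * C + C ^ 2 / (2 * c * a) + C) :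
    ∀ᵐ t : ℝ, t ∈ Ioo 0 T →
      IntegrableOn (fun p => g (u p) * w p * ‖G p‖ ^ 2 * ζ p.2) (Ioo 0 t ×ˢ univ) ∧
      (∫ x, H (u (t, x)) * ζ x)
        + c / 2 * ∫ p in Ioo 0 t ×ˢ univ, g (u p) * w p * ‖G p‖ ^ 2 * ζ p.2
      ≤ (∫ x, u₀ x ^ (1 + a))
        + (L * K * N ^ (-a) * (∫ p in Ioo 0 T ×ˢ univ, W p.1 * (u p * decayWeight n R p.2))
          + (∫ p in Ioo 0 T ×ˢ univ,
              u p ^ a * (‖F p‖ * decayWeight n R p.2) * min 1 (u p / N))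
          + e * ∫ p in Ioo 0 T ×ˢ univ, u p ^ a * (‖F p‖ * decayWeight n R p.2))
        + ∫ s in Ioo 0 t, L * K * W s * ∫ x, H (u (s, x)) * ζ x := by
  obtain ⟨Cg, M, hp⟩ := hpr.exists_bounds
  have hc := hd.c_pos
  have hL0 : 0 ≤ L := by rw [hL]; have := hd.C_pos; positivity
  have hN0 : 0 < N := by linarith
  obtain ⟨hsl, B, hB⟩ := slice_profile hs hn hu₀ hpr hR hζ.continuous hζ0 hζle T
  have i1 : IntegrableOn (fun p : SpaceTime n => W p.1 * (H (u p) * ζ p.2)) (Ioo 0 T ×ˢ univ) :=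
    integrableOn_time_mul (hd.integrableOn_W T)
      (aestronglyMeasurable_profile hs hζ.continuous hp.continuous_H T)
      (fun t ht x => mul_nonneg (hpr.H_nonneg _ (hs.nonneg t ht.1 x)) (hζ0 x)) hsl hB
  have i2 := hs.integrableOn_time_mul_decayWeight hn hu₀ hR (hd.integrableOn_W T)
  have i4 := hs.integrableOn_rpow_mul_flux hn hu₀ hR hT ha ha2
  have hmem := ae_restrict_mem (μ := volume)
    (measurableSet_Ioo (a := (0 : ℝ)) (b := T) |>.prod (MeasurableSet.univ (α := Space n)))
  have hJ0 : ∀ᵐ p ∂(volume.restrict (Ioo 0 T ×ˢ univ)),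
      0 ≤ u p ∧ 0 ≤ u p ^ a * (‖F p‖ * decayWeight n R p.2) := by
    filter_upwards [hmem] with p hpm
    have hu : 0 ≤ u p := hs.nonneg p.1 hpm.1.1 p.2
    have := (decayWeight_pos R p.2).le
    exact ⟨hu, by positivity⟩
  have i3 : IntegrableOn (fun p => u p ^ a * (‖F p‖ * decayWeight n R p.2) * min 1 (u p / N))
      (Ioo 0 T ×ˢ univ) := by
    refine Integrable.mono' i4 (i4.aestronglyMeasurable.mul ?_) ?_
    · exact (continuous_const.min (continuous_id.div_const N)).comp_aestronglyMeasurable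
        (hs.aestronglyMeasurable T)
    · filter_upwards [hJ0] with p hpp
      rw [Real.norm_of_nonneg (mul_nonneg hpp.2 (le_min zero_le_one (div_nonneg hpp.1 hN0.le)))]
      exact mul_le_of_le_one_right hpp.2 (min_le_left _ _)
  have hgG := hd.memLp_profile_smul hs hpr hN hT
  have hdens := hd.ae_energy_density_le hs ha hpr hK hN hζ0 hζle he hζg hL
  filter_upwards [hs.energy_inequality hd.weakGrad hd.locallyIntegrableOn_grad hp hT hgG hζ hζc hζ0]
    with t hen ht
  obtain ⟨i0, hen⟩ := hen ht
  have hsub : Ioo 0 t ×ˢ (univ : Set (Space n)) ⊆ Ioo 0 T ×ˢ univ :=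
    prod_mono (Ioo_subset_Ioo le_rfl ht.2.le) subset_rfl
  have hdens' := ae_restrict_of_ae_restrict_of_subset (slab_subset t) hdens
  have j1 := (i1.mono_set hsub).const_mul (L * K)
  have j2 := (i2.mono_set hsub).const_mul (L * K * N ^ (-a))
  have j3 := i3.mono_set hsub
  have j4 := (i4.mono_set hsub).const_mul e
  have jj := (((i0.add j1).add j2).add j3).add j4
  have hQm : AEStronglyMeasurable (fun p => g (u p) * w p * ‖G p‖ ^ 2 * ζ p.2)
      (volume.restrict (Ioo 0 t ×ˢ univ)) := by
    have hw := hd.aestronglyMeasurable_weight.mono_measure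
      (Measure.restrict_mono (slab_subset (n := n) t) le_rfl)
    have hG := hd.locallyIntegrableOn_grad.aestronglyMeasurable.mono_measure
      (Measure.restrict_mono (slab_subset (n := n) t) le_rfl)
    exact (((hp.continuous_g.comp_aestronglyMeasurable (hs.aestronglyMeasurable t)).mul hw).mul
      (hG.norm.pow 2)).mul (hζ.continuous.comp continuous_snd).aestronglyMeasurable
  have hQ : IntegrableOn (fun p => g (u p) * w p * ‖G p‖ ^ 2 * ζ p.2) (Ioo 0 t ×ˢ univ) := by
    refine Integrable.mono' (jj.const_mul (2 / c)) hQm ?_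
    filter_upwards [hdens'] with p hpp
    rw [Real.norm_of_nonneg hpp.1, div_mul_eq_mul_div, le_div_iff₀ hc]
    have := hpp.2
    simp only [Pi.add_apply]
    linarith
  refine ⟨hQ, ?_⟩
  have key : c / 2 * ∫ p in Ioo 0 t ×ˢ univ, g (u p) * w p * ‖G p‖ ^ 2 * ζ p.2
      ≤ (∫ p in Ioo 0 t ×ˢ univ,
          inner ℝ (F p) (ζ p.2 • g (u p) • G p + h (u p) • gradient ζ p.2))
        + L * K * (∫ p in Ioo 0 t ×ˢ univ, W p.1 * (H (u p) * ζ p.2))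
        + L * K * N ^ (-a) * (∫ p in Ioo 0 t ×ˢ univ, W p.1 * (u p * decayWeight n R p.2))
        + (∫ p in Ioo 0 t ×ˢ univ, u p ^ a * (‖F p‖ * decayWeight n R p.2) * min 1 (u p / N))
        + e * ∫ p in Ioo 0 t ×ˢ univ, u p ^ a * (‖F p‖ * decayWeight n R p.2) := by
    rw [← integral_const_mul, ← integral_const_mul, ← integral_const_mul, ← integral_const_mul,
      ← integral_add' i0 j1, ← integral_add' (i0.add j1) j2,
      ← integral_add' ((i0.add j1).add j2) j3, ← integral_add' (((i0.add j1).add j2).add j3) j4]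
    refine integral_mono_ae (hQ.const_mul _) jj ?_
    filter_upwards [hdens'] with p hpp using hpp.2
  have m2 : ∫ p in Ioo 0 t ×ˢ univ, W p.1 * (u p * decayWeight n R p.2)
      ≤ ∫ p in Ioo 0 T ×ˢ univ, W p.1 * (u p * decayWeight n R p.2) := by
    refine setIntegral_mono_set i2 ?_ hsub.eventuallyLE
    filter_upwards [hJ0] with p hpp
    exact mul_nonneg (hd.W_nonneg _) (mul_nonneg hpp.1 (decayWeight_pos R p.2).le)
  have m3 : ∫ p in Ioo 0 t ×ˢ univ, u p ^ a * (‖F p‖ * decayWeight n R p.2) * min 1 (u p / N)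
      ≤ ∫ p in Ioo 0 T ×ˢ univ,
        u p ^ a * (‖F p‖ * decayWeight n R p.2) * min 1 (u p / N) := by
    refine setIntegral_mono_set i3 ?_ hsub.eventuallyLE
    filter_upwards [hJ0] with p hpp
    exact mul_nonneg hpp.2 (le_min zero_le_one (div_nonneg hpp.1 hN0.le))
  have m4 : ∫ p in Ioo 0 t ×ˢ univ, u p ^ a * (‖F p‖ * decayWeight n R p.2)
      ≤ ∫ p in Ioo 0 T ×ˢ univ, u p ^ a * (‖F p‖ * decayWeight n R p.2) := by
    refine setIntegral_mono_set i4 ?_ hsub.eventuallyLE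
    filter_upwards [hJ0] with p hpp using hpp.2
  have m2' := mul_le_mul_of_nonneg_left m2
    (show 0 ≤ L * K * N ^ (-a) from by positivity)
  have m4' := mul_le_mul_of_nonneg_left m4 he
  have e1 : L * K * (∫ p in Ioo 0 t ×ˢ univ, W p.1 * (H (u p) * ζ p.2))
      = ∫ s in Ioo 0 t, L * K * W s * ∫ x, H (u (s, x)) * ζ x := by
    have i1t := i1.mono_set hsub
    rw [IntegrableOn, restrict_prod_univ] at i1t
    rw [restrict_prod_univ, integral_prod _ i1t, ← integral_const_mul]
    simp only [integral_const_mul, mul_assoc]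
  have hA : ∫ x, H (u₀ x) * ζ x ≤ ∫ x, u₀ x ^ (1 + a) := by
    refine integral_mono_of_nonneg (Eventually.of_forall fun x =>
      mul_nonneg (hpr.H_nonneg _ (hs.nonneg_init x)) (hζ0 x)) hu₀a
      (Eventually.of_forall fun x => ?_)
    exact (mul_le_of_le_one_right (hpr.H_nonneg _ (hs.nonneg_init x))
      ((hζle x).trans (decayWeight_le_one R x))).trans (hpr.H_le_rpow _ (hs.nonneg_init x))
  linarith

/-- The weighted energy with the power `u ^ (a - 1)` is bounded uniformly in the radius. -/
theorem exists_energy_le (hd : IsDegenerateFlux u F G w W c C ν σ) (hs : IsFluxSolution u u₀ F)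
    (hn : 0 < n) (hu₀ : Integrable u₀) (ha : 0 < a) (ha2 : 2 * a ≤ 1)
    (hu₀a : Integrable fun x => u₀ x ^ (1 + a)) {T : ℝ} (hT : 0 < T) :
    ∃ E, ∀ R : ℝ, n ≤ R →
      IntegrableOn (fun p => w p * u p ^ (a - 1) * ‖G p‖ ^ 2 * decayWeight n R p.2)
        (Ioo 0 T ×ˢ univ) ∧
      ∫ p in Ioo 0 T ×ˢ univ, w p * u p ^ (a - 1) * ‖G p‖ ^ 2 * decayWeight n R p.2 ≤ E := by
  obtain ⟨K, hK, hprof⟩ := exists_isPowerProfile ha (by linarith)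
  obtain ⟨L, hL⟩ : ∃ L, L = a * C + C ^ 2 / (2 * c * a) + C := ⟨_, rfl⟩
  have hc := hd.c_pos
  have hL0 : 0 ≤ L := by rw [hL]; have := hd.C_pos; positivity
  -- The energy inequality holds at almost every time only. Working up to `T + 1` leaves room to
  -- choose a good time beyond `T` and then restrict.
  have hT1 : 0 < T + 1 := by linarith
  have hV : IntegrableOn (fun s => L * K * W s) (Ioo 0 (T + 1)) :=
    (hd.integrableOn_W (T + 1)).const_mul _
  have hV0 : ∀ s, 0 ≤ L * K * W s := fun s => mul_nonneg (by positivity) (hd.W_nonneg s)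
  obtain ⟨C₀, hC₀, hgron⟩ := exists_gronwall_const hV hV0
  set A := ∫ x, u₀ x ^ (1 + a) with hA
  have hA0 : 0 ≤ A := integral_nonneg fun x => Real.rpow_nonneg (hs.nonneg_init x) _
  set V₁ := ∫ s in Ioo 0 (T + 1), L * K * W s with hV₁
  have hV₁0 : 0 ≤ V₁ := integral_nonneg hV0
  refine ⟨2 / c * ((A + 0) * (1 + C₀ * V₁)) / a, fun R hnR => ?_⟩
  have hR : 0 < R := lt_of_lt_of_le (by exact_mod_cast hn) hnR
  obtain ⟨D, hD, ζ, hζ, hζc, hζ0, hζle, hζg, hζlim⟩ := exists_cutoff_decayWeight n hR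
  have hN : ∀ N : ℕ, (1 : ℝ) ≤ (N : ℝ) + 1 := fun N => by
    have : (0 : ℝ) ≤ N := N.cast_nonneg
    linarith
  choose g h H hpr using fun N : ℕ => hprof ((N : ℝ) + 1) (hN N)
  -- For `R ≥ n` the coefficient `n/R` is at most one, which makes the Gronwall kernel independent
  -- of `R`.
  have hζg' : ∀ N x, ‖gradient (ζ N) x‖
      ≤ ζ N x + D / ((N : ℝ) + 1) * decayWeight n R x := fun N x => by
    refine (hζg N x).trans (add_le_add ?_ le_rfl)
    exact mul_le_of_le_one_left (hζ0 N x) ((div_le_one hR).2 hnR)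
  set I₂ := ∫ p in Ioo 0 (T + 1) ×ˢ univ, W p.1 * (u p * decayWeight n R p.2) with hI₂
  set J : SpaceTime n → ℝ := fun p => u p ^ a * (‖F p‖ * decayWeight n R p.2) with hJ
  have hJi : IntegrableOn J (Ioo 0 (T + 1) ×ˢ univ) :=
    hs.integrableOn_rpow_mul_flux hn hu₀ hR hT1 ha ha2
  have hmem := ae_restrict_mem (μ := volume)
    (measurableSet_Ioo (a := (0 : ℝ)) (b := T + 1) |>.prod (MeasurableSet.univ (α := Space n)))
  have hJ0 : ∀ᵐ p ∂(volume.restrict (Ioo 0 (T + 1) ×ˢ univ)), 0 ≤ u p ∧ 0 ≤ J p := by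
    filter_upwards [hmem] with p hpm
    have hu : 0 ≤ u p := hs.nonneg p.1 hpm.1.1 p.2
    have := (decayWeight_pos R p.2).le
    exact ⟨hu, by simp only [hJ]; positivity⟩
  -- The index `N` governs both the truncation in the values of `u` and the cutoff in space. The
  -- resulting errors depend on `R`, but vanish as `N → ∞` with `R` fixed, so the limiting bound
  -- does not.
  set ε : ℕ → ℝ := fun N => L * K * ((N : ℝ) + 1) ^ (-a) * I₂
    + (∫ p in Ioo 0 (T + 1) ×ˢ univ, J p * min 1 (u p / ((N : ℝ) + 1)))
    + D / ((N : ℝ) + 1) * ∫ p in Ioo 0 (T + 1) ×ˢ univ, J p with hε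
  have htop : Tendsto (fun N : ℕ => (N : ℝ) + 1) atTop atTop :=
    tendsto_natCast_atTop_atTop.atTop_add tendsto_const_nhds
  have hε0 : ∀ N, 0 ≤ ε N := by
    intro N
    have hNN := hN N
    have h1 : 0 ≤ I₂ := by
      refine integral_nonneg_of_ae ?_
      filter_upwards [hJ0] with p hpp
      exact mul_nonneg (hd.W_nonneg _) (mul_nonneg hpp.1 (decayWeight_pos R p.2).le)
    have h2 : 0 ≤ ∫ p in Ioo 0 (T + 1) ×ˢ univ, J p * min 1 (u p / ((N : ℝ) + 1)) := by
      refine integral_nonneg_of_ae ?_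
      filter_upwards [hJ0] with p hpp
      exact mul_nonneg hpp.2 (le_min zero_le_one (div_nonneg hpp.1 (by linarith)))
    have h3 : 0 ≤ ∫ p in Ioo 0 (T + 1) ×ˢ univ, J p := by
      refine integral_nonneg_of_ae ?_
      filter_upwards [hJ0] with p hpp using hpp.2
    simp only [hε]
    positivity
  have hεlim : Tendsto ε atTop (𝓝 0) := by
    have l1 : Tendsto (fun N : ℕ => L * K * ((N : ℝ) + 1) ^ (-a) * I₂) atTop (𝓝 0) := by
      have := (((tendsto_rpow_neg_atTop ha).comp htop).const_mul (L * K)).mul_const I₂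
      simpa using this
    have l2 : Tendsto (fun N : ℕ => ∫ p in Ioo 0 (T + 1) ×ˢ univ,
        J p * min 1 (u p / ((N : ℝ) + 1))) atTop (𝓝 0) := by
      have := tendsto_integral_of_dominated_convergence
        (μ := volume.restrict (Ioo 0 (T + 1) ×ˢ univ))
        (F := fun (N : ℕ) p => J p * min 1 (u p / ((N : ℝ) + 1))) (f := fun _ => (0 : ℝ)) J
        (fun N => hJi.aestronglyMeasurable.mul
          ((continuous_const.min (continuous_id.div_const ((N : ℝ) + 1))).comp_aestronglyMeasurable
            (hs.aestronglyMeasurable (T + 1)))) hJi (fun N => ?_) ?_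
      · simpa using this
      · filter_upwards [hJ0] with p hpp
        rw [Real.norm_of_nonneg (mul_nonneg hpp.2 (le_min zero_le_one
          (div_nonneg hpp.1 (by linarith [hN N]))))]
        exact mul_le_of_le_one_right hpp.2 (min_le_left _ _)
      · refine Eventually.of_forall fun p => ?_
        have h1 : Tendsto (fun N : ℕ => u p / ((N : ℝ) + 1)) atTop (𝓝 0) :=
          tendsto_const_nhds.div_atTop htop
        have h2 := ((tendsto_const_nhds (x := (1 : ℝ))).min h1).const_mul (J p)
        simpa using h2
    have l3 : Tendsto (fun N : ℕ => D / ((N : ℝ) + 1) * ∫ p in Ioo 0 (T + 1) ×ˢ univ, J p)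
        atTop (𝓝 0) := by
      have := ((tendsto_const_nhds (x := D)).div_atTop htop).mul_const
        (∫ p in Ioo 0 (T + 1) ×ˢ univ, J p)
      simpa using this
    simpa using (l1.add l2).add l3
  have hstep : ∀ N : ℕ,
      IntegrableOn (fun p => g N (u p) * w p * ‖G p‖ ^ 2 * ζ N p.2) (Ioo 0 T ×ˢ univ) ∧
      ∫ p in Ioo 0 T ×ˢ univ, g N (u p) * w p * ‖G p‖ ^ 2 * ζ N p.2
        ≤ 2 / c * ((A + ε N) * (1 + C₀ * V₁)) := by
    intro N
    obtain ⟨Cg, M, hp⟩ := (hpr N).exists_bounds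
    have he : 0 ≤ D / ((N : ℝ) + 1) := div_nonneg hD (by linarith [hN N])
    have hes := hd.profile_energy_le hs hn hu₀ ha ha2 hu₀a (hpr N) hK.le (hN N) hT1 hR (hζ N) (hζc N)
      (hζ0 N) (hζle N) he (hζg' N) hL
    obtain ⟨hsl, B, hB⟩ := slice_profile hs hn hu₀ (hpr N) hR (hζ N).continuous (hζ0 N) (hζle N)
      (T + 1)
    have hQ0 : ∀ t, 0 ≤ ∫ p in Ioo 0 t ×ˢ univ, g N (u p) * w p * ‖G p‖ ^ 2 * ζ N p.2 := by
      intro t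
      refine integral_nonneg_of_ae ?_
      filter_upwards [ae_restrict_of_ae_restrict_of_subset (slab_subset t)
        (hd.ae_energy_density_le hs ha (hpr N) hK.le (hN N) (hζ0 N) (hζle N) he (hζg' N) hL)]
        with p hpp using hpp.1
    set Y : ℝ → ℝ := fun t => ∫ x, H N (u (t, x)) * ζ N x with hY
    have hYm : AEStronglyMeasurable Y (volume.restrict (Ioo 0 (T + 1))) := by
      have := aestronglyMeasurable_profile hs (hζ N).continuous hp.continuous_H (T + 1)
      rw [restrict_prod_univ] at this
      exact this.integral_prod_right'
    have hY0 : ∀ t ∈ Ioo 0 (T + 1), 0 ≤ Y t := fun t ht => integral_nonneg fun x =>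
      mul_nonneg ((hpr N).H_nonneg _ (hs.nonneg t ht.1 x)) (hζ0 N x)
    have hYle : ∀ᵐ t : ℝ, t ∈ Ioo 0 (T + 1) → Y t ≤ C₀ * (A + ε N) := by
      refine hgron Y (A + ε N) B (add_nonneg hA0 (hε0 N)) hYm
        (Eventually.of_forall fun t ht => ⟨hY0 t ht, hB t ht⟩) ?_
      filter_upwards [hes] with t ht htm
      have h1 := (ht htm).2
      have h2 := mul_nonneg (half_pos hc).le (hQ0 t)
      linarith
    have hfin : ∀ᵐ t : ℝ, t ∈ Ioo 0 (T + 1) →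
        IntegrableOn (fun p => g N (u p) * w p * ‖G p‖ ^ 2 * ζ N p.2) (Ioo 0 t ×ˢ univ) ∧
        ∫ p in Ioo 0 t ×ˢ univ, g N (u p) * w p * ‖G p‖ ^ 2 * ζ N p.2
          ≤ 2 / c * ((A + ε N) * (1 + C₀ * V₁)) := by
      filter_upwards [hes] with t ht htm
      obtain ⟨h1, h2⟩ := ht htm
      refine ⟨h1, ?_⟩
      have h3 : ∫ s in Ioo 0 t, L * K * W s * Y s ≤ C₀ * (A + ε N) * V₁ := by
        have hsub : Ioo 0 t ⊆ Ioo 0 (T + 1) := Ioo_subset_Ioo le_rfl htm.2.le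
        calc ∫ s in Ioo 0 t, L * K * W s * Y s
            ≤ ∫ s in Ioo 0 t, C₀ * (A + ε N) * (L * K * W s) := by
              refine integral_mono_of_nonneg ?_ ((hV.mono_set hsub).const_mul _) ?_
              · filter_upwards [ae_restrict_mem measurableSet_Ioo] with s hsm
                exact mul_nonneg (hV0 s) (hY0 s (hsub hsm))
              · filter_upwards [ae_restrict_mem measurableSet_Ioo, ae_restrict_of_ae hYle]
                  with s hsm hys
                rw [mul_comm]
                exact mul_le_mul_of_nonneg_right (hys (hsub hsm)) (hV0 s)
          _ = C₀ * (A + ε N) * ∫ s in Ioo 0 t, L * K * W s := integral_const_mul _ _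
          _ ≤ _ := by
              refine mul_le_mul_of_nonneg_left ?_ (mul_nonneg hC₀ (add_nonneg hA0 (hε0 N)))
              exact setIntegral_mono_set hV (Eventually.of_forall hV0) hsub.eventuallyLE
      have h4 := hY0 t htm
      rw [div_mul_eq_mul_div, le_div_iff₀ hc]
      have h5 : Y t + c / 2 * ∫ p in Ioo 0 t ×ˢ univ, g N (u p) * w p * ‖G p‖ ^ 2 * ζ N p.2
        ≤ A + ε N + ∫ s in Ioo 0 t, L * K * W s * Y s := h2
      linarith
    obtain ⟨t, htm, ht⟩ : ∃ t ∈ Ioo T (T + 1),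
        IntegrableOn (fun p => g N (u p) * w p * ‖G p‖ ^ 2 * ζ N p.2) (Ioo 0 t ×ˢ univ) ∧
        ∫ p in Ioo 0 t ×ˢ univ, g N (u p) * w p * ‖G p‖ ^ 2 * ζ N p.2
          ≤ 2 / c * ((A + ε N) * (1 + C₀ * V₁)) := by
      -- The interval has positive measure, so a property valid almost everywhere holds at some
      -- point of it.
      have hne : (ae (volume.restrict (Ioo T (T + 1)))).NeBot := by
        rw [ae_neBot, Ne, Measure.restrict_eq_zero, Real.volume_Ioo]
        simp
      have h1 := ae_restrict_of_ae (s := Ioo T (T + 1)) hfin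
      obtain ⟨t, ht1, ht2⟩ := (h1.and (ae_restrict_mem measurableSet_Ioo)).exists
      exact ⟨t, ht2, ht1 ⟨hT.trans ht2.1, ht2.2⟩⟩
    have hsub : Ioo 0 T ×ˢ (univ : Set (Space n)) ⊆ Ioo 0 t ×ˢ univ :=
      prod_mono (Ioo_subset_Ioo le_rfl htm.1.le) subset_rfl
    refine ⟨ht.1.mono_set hsub, le_trans ?_ ht.2⟩
    refine setIntegral_mono_set ht.1 ?_ hsub.eventuallyLE
    filter_upwards [ae_restrict_of_ae_restrict_of_subset (slab_subset t)
      (hd.ae_energy_density_le hs ha (hpr N) hK.le (hN N) (hζ0 N) (hζle N) he (hζg' N) hL)]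
      with p hpp using hpp.1
  have hlim : ∀ᵐ p ∂(volume.restrict (Ioo 0 T ×ˢ univ)),
      Tendsto (fun N => g N (u p) * w p * ‖G p‖ ^ 2 * ζ N p.2) atTop
        (𝓝 (a * (w p * u p ^ (a - 1) * ‖G p‖ ^ 2 * decayWeight n R p.2))) := by
    filter_upwards [ae_restrict_mem (measurableSet_Ioo.prod MeasurableSet.univ)] with p hpm
    have hu : 0 ≤ u p := hs.nonneg p.1 hpm.1.1 p.2
    refine tendsto_const_nhds.congr' ?_
    have hg : ∀ᶠ N : ℕ in atTop, g N (u p) = a * u p ^ (a - 1) := by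
      rcases hu.eq_or_lt with h0 | h0
      · refine Eventually.of_forall fun N => ?_
        have h1 := hN N
        -- At `u = 0` the convention `0 ^ (a - 1) = 0` of `Real.rpow` agrees with the vanishing of
        -- the profile.
        rw [← h0, Real.zero_rpow (by linarith), mul_zero]
        exact (hpr N).g_eq_zero_of_le 0 (by positivity)
      · have l1 : Tendsto (fun N : ℕ => 2 / ((N : ℝ) + 1)) atTop (𝓝 0) :=
          tendsto_const_nhds.div_atTop htop
        filter_upwards [l1.eventually_le_const h0, htop.eventually_ge_atTop (u p)] with N h1 h2
        exact (hpr N).g_eq_rpow _ h1 h2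
    filter_upwards [hg, hζlim p.2] with N h1 h2
    rw [h1, h2.1]
    ring
  have hB : Tendsto (fun N => 2 / c * ((A + ε N) * (1 + C₀ * V₁))) atTop
      (𝓝 (2 / c * ((A + 0) * (1 + C₀ * V₁)))) :=
    ((hεlim.const_add A).mul_const _).const_mul _
  obtain ⟨r1, r2⟩ := integrable_of_tendsto_of_integral_le (fun N => (hstep N).1) (fun N => by
      have he : 0 ≤ D / ((N : ℝ) + 1) := div_nonneg hD (by linarith [hN N])
      filter_upwards [ae_restrict_of_ae_restrict_of_subset (slab_subset T)
        (hd.ae_energy_density_le hs ha (hpr N) hK.le (hN N) (hζ0 N) (hζle N) he (hζg' N) hL)]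
        with p hpp using hpp.1) hlim (fun N => (hstep N).2) hB
  refine ⟨?_, ?_⟩
  · have := r1.const_mul a⁻¹
    refine this.congr (Eventually.of_forall fun p => ?_)
    simp only
    rw [inv_mul_cancel_left₀ ha.ne']
  · rw [integral_const_mul] at r2
    rw [le_div_iff₀ ha]
    linarith

end IsDegenerateFlux

end EnergyEstimate

/-! ### From the energy estimate to conservation of mass. -/

section MassConservation

variable {n : ℕ}

/-- If `√R z^a ≥ 1`, multiplying by it gives the first term. Otherwise `z^a < R^(-1/2)`, so
`z^(1-a)` is at most `R^(-(1-a)/(2a))`, and this is at most `R⁻ⁿ` exactly when `a (2n + 1) ≤ 1`. The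
power `R⁻ⁿ` is chosen to balance the total weight, of order `Rⁿ`. -/
theorem rpow_one_sub_le {a R z : ℝ} (ha : 0 < a) (han : a * (2 * n + 1) ≤ 1) (ha1 : a < 1)
    (hR : 1 ≤ R) (hz : 0 ≤ z) : z ^ (1 - a) ≤ √R * z + (R ^ n)⁻¹ := by
  have hR0 : 0 < R := by linarith
  rcases hz.eq_or_lt with h0 | h0
  · rw [← h0, Real.zero_rpow (by linarith)]
    positivity
  rcases le_or_gt 1 (√R * z ^ a) with h1 | h1
  · have h2 : z ^ (1 - a) * 1 ≤ z ^ (1 - a) * (√R * z ^ a) :=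
      mul_le_mul_of_nonneg_left h1 (Real.rpow_nonneg hz _)
    have h3 : z ^ (1 - a) * z ^ a = z := by
      rw [← Real.rpow_add h0, sub_add_cancel, Real.rpow_one]
    have h4 : 0 ≤ (R ^ n)⁻¹ := by positivity
    calc z ^ (1 - a) ≤ √R * (z ^ (1 - a) * z ^ a) := by linarith
      _ = √R * z := by rw [h3]
      _ ≤ _ := by linarith
  · have h2 : z ^ a ≤ R ^ (-(1 / 2) : ℝ) := by
      rw [Real.rpow_neg hR0.le, ← Real.sqrt_eq_rpow, ← one_div, le_div_iff₀ (by positivity)]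
      linarith
    have h3 : z ^ (1 - a) = (z ^ a) ^ ((1 - a) / a) := by
      rw [← Real.rpow_mul hz]
      congr 1
      field_simp
    have h4 : z ^ (1 - a) ≤ (R ^ n)⁻¹ := by
      calc z ^ (1 - a) ≤ (R ^ (-(1 / 2) : ℝ)) ^ ((1 - a) / a) := by
            rw [h3]
            exact Real.rpow_le_rpow (by positivity) h2 (div_nonneg (by linarith) ha.le)
        _ = R ^ (-(1 / 2) * ((1 - a) / a)) := by rw [← Real.rpow_mul hR0.le]
        _ ≤ R ^ (-(n : ℝ)) := by
            refine Real.rpow_le_rpow_of_exponent_le hR ?_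
            have : (n : ℝ) * 2 ≤ (1 - a) / a := by
              rw [le_div_iff₀ ha]
              nlinarith
            linarith
        _ = (R ^ n)⁻¹ := by rw [Real.rpow_neg hR0.le, Real.rpow_natCast]
    have h5 : 0 ≤ √R * z := by positivity
    linarith

theorem tendsto_integral_mul_decayWeight {f : Space n → ℝ} (hf : Integrable f) {R : ℕ → ℝ}
    (hR : Tendsto R atTop atTop) :
    Tendsto (fun j => ∫ x, f x * decayWeight n (R j) x) atTop (𝓝 (∫ x, f x)) := by
  refine tendsto_integral_of_dominated_convergence (fun x => ‖f x‖)
    (fun j => hf.aestronglyMeasurable.mul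
      (contDiff_decayWeight (R j)).continuous.aestronglyMeasurable) hf.norm
    (fun j => Eventually.of_forall fun x => ?_) (Eventually.of_forall fun x => ?_)
  · rw [norm_mul, Real.norm_of_nonneg (decayWeight_pos _ x).le]
    exact mul_le_of_le_one_right (norm_nonneg _) (decayWeight_le_one _ x)
  · simpa using (tendsto_decayWeight x hR).const_mul (f x)

namespace IsDegenerateFlux

variable {u w : SpaceTime n → ℝ} {u₀ : Space n → ℝ} {F G : SpaceTime n → Space n} {W : ℝ → ℝ}
  {c C ν σ a : ℝ}

/-- Young's inequality `‖G‖ ≤ u^(a-1)‖G‖² + u^(1-a)` where `u > 0`. On the set `u = 0` the negative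
power is useless, but there the weak gradient vanishes almost everywhere. -/
theorem ae_norm_flux_le (hd : IsDegenerateFlux u F G w W c C ν σ) (hs : IsFluxSolution u u₀ F)
    (ha : 0 < a) (ha1 : a < 1) (han : a * (2 * n + 1) ≤ 1) {R : ℝ} (hR : 1 ≤ R) :
    ∀ᵐ p ∂(volume.restrict (Ioi 0 ×ˢ univ)), ‖F p‖ * decayWeight n R p.2
      ≤ C * (w p * u p ^ (a - 1) * ‖G p‖ ^ 2 * decayWeight n R p.2)
        + (C * √R + C) * (W p.1 * (u p * decayWeight n R p.2))
        + C * (R ^ n)⁻¹ * (W p.1 * decayWeight n R p.2) := by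
  have hzero := hd.weakGrad.ae_eq_zero_of_eq_zero (isOpen_Ioi.prod isOpen_univ)
    hs.locallyIntegrableOn hd.locallyIntegrableOn_grad
  filter_upwards [hd.weight_le, hd.le_weight, hd.growth, ae_restrict_of_ae hzero,
    ae_restrict_mem (measurableSet_Ioi.prod MeasurableSet.univ)] with p h1 h2 h4 h5 hpm
  have hu : 0 ≤ u p := hs.nonneg p.1 hpm.1 p.2
  have hw : 0 ≤ w p := (mul_nonneg hd.ν_pos.le (Real.rpow_nonneg hu σ)).trans h2
  have hC := hd.C_pos
  have hZ := (decayWeight_pos R p.2).le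
  have hR0 : 0 < R := by linarith
  have hua : 0 ≤ u p ^ (a - 1) := Real.rpow_nonneg hu _
  have hub := rpow_one_sub_le ha han ha1 hR hu
  have hub0 : 0 ≤ u p ^ (1 - a) := Real.rpow_nonneg hu _
  have hG : ‖G p‖ ≤ u p ^ (a - 1) * ‖G p‖ ^ 2 + u p ^ (1 - a) := by
    rcases hu.eq_or_lt with h0 | h0
    · rw [h5 hpm h0.symm, norm_zero]
      positivity
    · refine le_add_of_sq_le_four_mul (by positivity) hub0 ?_
      have : u p ^ (a - 1) * u p ^ (1 - a) = 1 := by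
        rw [← Real.rpow_add h0]; simp
      have e : 4 * (u p ^ (a - 1) * ‖G p‖ ^ 2) * u p ^ (1 - a)
          = 4 * ‖G p‖ ^ 2 * (u p ^ (a - 1) * u p ^ (1 - a)) := by ring
      rw [e, this]
      nlinarith [sq_nonneg ‖G p‖]
  have h6 : ‖F p‖ ≤ C * (w p * u p ^ (a - 1) * ‖G p‖ ^ 2)
      + W p.1 * (C * (√R * u p + (R ^ n)⁻¹) + C * u p) := by
    have h7 : w p * (C * ‖G p‖ + C * u p)
        ≤ w p * (C * (u p ^ (a - 1) * ‖G p‖ ^ 2) + (C * (√R * u p + (R ^ n)⁻¹) + C * u p)) := by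
      refine mul_le_mul_of_nonneg_left ?_ hw
      have := mul_le_mul_of_nonneg_left (hG.trans (add_le_add le_rfl hub)) hC.le
      linarith
    have h8 : w p * (C * (√R * u p + (R ^ n)⁻¹) + C * u p)
        ≤ W p.1 * (C * (√R * u p + (R ^ n)⁻¹) + C * u p) :=
      mul_le_mul_of_nonneg_right h1 (by positivity)
    linarith
  have h9 := mul_le_mul_of_nonneg_right h6 hZ
  linarith

/-- At each time the weighted mass is at most the initial mass plus the weighted flux, a bound free
of `t` that can be integrated against `W`. It brings the flux back into its own estimate, with the
small factor `n/R`. -/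
theorem integral_time_mul_le (hd : IsDegenerateFlux u F G w W c C ν σ)
    (hs : IsFluxSolution u u₀ F) (hn : 0 < n) (hu₀ : Integrable u₀) {R T : ℝ} (hR : 0 < R) :
    ∫ p in Ioo 0 T ×ˢ univ, W p.1 * (u p * decayWeight n R p.2)
      ≤ (∫ s in Ioo 0 T, W s) * ((∫ x, u₀ x)
        + n / R * ∫ p in Ioo 0 T ×ˢ univ, ‖F p‖ * decayWeight n R p.2) := by
  have hi := hs.integrableOn_time_mul_decayWeight hn hu₀ hR (hd.integrableOn_W T)
  set B := (∫ x, u₀ x) + n / R * ∫ p in Ioo 0 T ×ˢ univ, ‖F p‖ * decayWeight n R p.2 with hB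
  rw [IntegrableOn, restrict_prod_univ] at hi
  rw [restrict_prod_univ, integral_prod _ hi, ← integral_mul_const]
  refine integral_mono_ae hi.integral_prod_left ((hd.integrableOn_W T).mul_const B) ?_
  filter_upwards [ae_restrict_mem measurableSet_Ioo] with t ht
  rw [integral_const_mul]
  refine mul_le_mul_of_nonneg_left ?_ (hd.W_nonneg t)
  have h1 := (abs_le.1 (hs.abs_slice_decayWeight_sub_le hn hu₀ hR ht)).2
  have h2 := hs.integral_mul_decayWeight_le hu₀ R
  linarith

theorem integral_norm_flux_le (hd : IsDegenerateFlux u F G w W c C ν σ)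
    (hs : IsFluxSolution u u₀ F) (hn : 0 < n) (hu₀ : Integrable u₀) (ha : 0 < a) (ha1 : a < 1)
    (han : a * (2 * n + 1) ≤ 1) {R T E : ℝ} (hR : 1 ≤ R) (hT : 0 < T)
    (hEi : IntegrableOn (fun p => w p * u p ^ (a - 1) * ‖G p‖ ^ 2 * decayWeight n R p.2)
        (Ioo 0 T ×ˢ univ))
    (hE : ∫ p in Ioo 0 T ×ˢ univ, w p * u p ^ (a - 1) * ‖G p‖ ^ 2 * decayWeight n R p.2 ≤ E) :
    ∫ p in Ioo 0 T ×ˢ univ, ‖F p‖ * decayWeight n R p.2 ≤ C * E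
      + (C * √R + C) * (∫ p in Ioo 0 T ×ˢ univ, W p.1 * (u p * decayWeight n R p.2))
      + C * ((∫ s in Ioo 0 T, W s) * ∫ x, decayWeight n 1 x) := by
  have hR0 : 0 < R := by linarith
  have i1 := hs.integrableOn_time_mul_decayWeight hn hu₀ hR0 (hd.integrableOn_W T)
  have i2 : IntegrableOn (fun p : SpaceTime n => W p.1 * decayWeight n R p.2)
      (Ioo 0 T ×ˢ univ) := by
    rw [IntegrableOn, restrict_prod_univ]
    exact (hd.integrableOn_W T).mul_prod (integrable_decayWeight hn hR0)
  have e2 : ∫ p in Ioo 0 T ×ˢ univ, W p.1 * decayWeight n R p.2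
      = (∫ s in Ioo 0 T, W s) * (R ^ n * ∫ x, decayWeight n 1 x) := by
    rw [restrict_prod_univ, integral_prod_mul, integral_decayWeight hR0]
  have j0 := hEi.const_mul C
  have j1 := i1.const_mul (C * √R + C)
  have j2 := i2.const_mul (C * (R ^ n)⁻¹)
  have key := integral_mono_ae (hs.integrableOn_norm_flux_mul_decayWeight hn hR0 hT)
    ((j0.add j1).add j2) (ae_restrict_of_ae_restrict_of_subset (slab_subset T)
      (hd.ae_norm_flux_le hs ha ha1 han hR))
  rw [integral_add' (j0.add j1) j2, integral_add' j0 j1, integral_const_mul, integral_const_mul,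
    integral_const_mul, e2] at key
  -- The factor `R⁻ⁿ` cancels the growth of the total weight.
  have e3 : C * (R ^ n)⁻¹ * ((∫ s in Ioo 0 T, W s) * (R ^ n * ∫ x, decayWeight n 1 x))
      = C * ((∫ s in Ioo 0 T, W s) * ∫ x, decayWeight n 1 x) := by
    field_simp
  have h1 := mul_le_mul_of_nonneg_left hE hd.C_pos.le
  linarith

/-- The bound for the weighted flux `f` contains `f` again, with coefficient `2 n C W₁ / √R`. Once
`√R ≥ 4 n C W₁` this is at most `1/2` and is absorbed, which leaves `f = O(√R)`. -/
theorem exists_radius_mul_flux_le (hd : IsDegenerateFlux u F G w W c C ν σ)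
    (hs : IsFluxSolution u u₀ F) (hn : 0 < n) (hu₀ : Integrable u₀) (ha : 0 < a)
    (han : a * (2 * n + 1) ≤ 1) (hu₀a : Integrable fun x => u₀ x ^ (1 + a)) {T : ℝ}
    (hT : 0 < T) :
    ∃ M R₀ : ℝ, ∀ R, R₀ ≤ R →
      n / R * ∫ p in Ioo 0 T ×ˢ univ, ‖F p‖ * decayWeight n R p.2 ≤ M / √R := by
  have hn1 : (1 : ℝ) ≤ n := by exact_mod_cast hn
  have ha2 : 2 * a ≤ 1 := by nlinarith
  obtain ⟨E, hE⟩ := hd.exists_energy_le hs hn hu₀ ha ha2 hu₀a hT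
  have hC := hd.C_pos
  set W₁ := ∫ s in Ioo 0 T, W s with hW₁
  have hW₁0 : 0 ≤ W₁ := integral_nonneg hd.W_nonneg
  set I₀ := ∫ x, u₀ x with hI₀
  have hI₀0 : 0 ≤ I₀ := integral_nonneg hs.nonneg_init
  set Z₁ := ∫ x, decayWeight n 1 x with hZ₁
  have hZ₁0 : 0 ≤ Z₁ := integral_nonneg fun x => (decayWeight_pos (n := n) 1 x).le
  set A₁ := C * |E| + C * (W₁ * Z₁) with hA₁
  have hA₁0 : 0 ≤ A₁ := by positivity
  refine ⟨2 * n * (A₁ + 2 * C * W₁ * I₀), max n ((4 * n * C * W₁) ^ 2), fun R hR => ?_⟩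
  have hnR : (n : ℝ) ≤ R := (le_max_left _ _).trans hR
  have hR1 : 1 ≤ R := hn1.trans hnR
  have hR0 : 0 < R := by linarith
  set r := √R with hr
  have hr1 : 1 ≤ r := Real.one_le_sqrt.2 hR1
  have hrr : R = r ^ 2 := (Real.sq_sqrt hR0.le).symm
  have hr4 : 4 * n * C * W₁ ≤ r := Real.le_sqrt_of_sq_le ((le_max_right _ _).trans hR)
  set f := ∫ p in Ioo 0 T ×ˢ univ, ‖F p‖ * decayWeight n R p.2 with hf
  have hf0 : 0 ≤ f := integral_nonneg fun p =>
    mul_nonneg (norm_nonneg _) (decayWeight_pos R p.2).le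
  have h1 := hd.integral_norm_flux_le hs hn hu₀ ha (by linarith) han hR1 hT (hE R hnR).1
    ((hE R hnR).2.trans (le_abs_self E))
  have h2 := hd.integral_time_mul_le hs hn hu₀ (T := T) hR0
  rw [← hf, ← hr] at h1
  rw [← hf] at h2
  have h3 : (C * r + C) * (∫ p in Ioo 0 T ×ˢ univ, W p.1 * (u p * decayWeight n R p.2))
      ≤ 2 * C * r * (W₁ * (I₀ + n / R * f)) := by
    refine mul_le_mul (by nlinarith) h2 (setIntegral_nonneg
      (measurableSet_Ioo.prod MeasurableSet.univ) fun p hp => ?_) (by positivity)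
    exact mul_nonneg (hd.W_nonneg _) (mul_nonneg (hs.nonneg p.1 hp.1.1 p.2)
      (decayWeight_pos R p.2).le)
  have h4 : 2 * C * r * (W₁ * (n / R * f)) ≤ f / 2 := by
    have e : 2 * C * r * (W₁ * (n / R * f)) = (4 * n * C * W₁) * f / (2 * r) := by
      rw [hrr]; field_simp; ring
    rw [e, div_le_div_iff₀ (by positivity) two_pos]
    have := mul_le_mul_of_nonneg_right hr4 hf0
    nlinarith
  have h5 : f ≤ 2 * (A₁ + 2 * C * W₁ * I₀ * r) := by
    have e : 2 * C * r * (W₁ * (I₀ + n / R * f))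
        = 2 * C * W₁ * I₀ * r + 2 * C * r * (W₁ * (n / R * f)) := by ring
    rw [hA₁]
    linarith
  have h6 : f ≤ 2 * (A₁ + 2 * C * W₁ * I₀) * r := by
    have := mul_le_mul_of_nonneg_left hr1 hA₁0
    linarith
  calc n / R * f ≤ n / R * (2 * (A₁ + 2 * C * W₁ * I₀) * r) :=
        mul_le_mul_of_nonneg_left h6 (by positivity)
    _ = _ := by rw [hrr]; field_simp

/-- A solution driven by a degenerate flux conserves its mass. -/
theorem mass_eq (hd : IsDegenerateFlux u F G w W c C ν σ)
    (hs : IsFluxSolution u u₀ F) (hn : 0 < n) (hu₀ : Integrable u₀) (ha : 0 < a)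
    (han : a * (2 * n + 1) ≤ 1) (hu₀a : Integrable fun x => u₀ x ^ (1 + a)) {t : ℝ}
    (ht : 0 < t) : Integrable (fun x => u (t, x)) ∧ ∫ x, u (t, x) = ∫ x, u₀ x := by
  obtain ⟨M, R₀, hM⟩ := hd.exists_radius_mul_flux_le hs hn hu₀ ha han hu₀a
    (show 0 < t + 1 by linarith)
  set R : ℕ → ℝ := fun j => (j : ℝ) + 1 with hR
  have hRtop : Tendsto R atTop atTop := tendsto_natCast_atTop_atTop.atTop_add tendsto_const_nhds
  have hR0 : ∀ j, 0 < R j := fun j => by simp only [hR]; positivity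
  have lim0 : Tendsto (fun j => M / √(R j)) atTop (𝓝 0) :=
    tendsto_const_nhds.div_atTop (Real.tendsto_sqrt_atTop.comp hRtop)
  have lim1 : Tendsto (fun j => (∫ x, u (t, x) * decayWeight n (R j) x)
      - ∫ x, u₀ x * decayWeight n (R j) x) atTop (𝓝 0) := by
    refine squeeze_zero_norm' ?_ lim0
    filter_upwards [hRtop.eventually_ge_atTop R₀] with j hj
    exact (hs.abs_slice_decayWeight_sub_le hn hu₀ (hR0 j) ⟨ht, by linarith⟩).trans (hM _ hj)
  have lim2 := tendsto_integral_mul_decayWeight hu₀ hRtop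
  have lim3 : Tendsto (fun j => ∫ x, u (t, x) * decayWeight n (R j) x) atTop
      (𝓝 (∫ x, u₀ x)) := by simpa using lim1.add lim2
  have hInt : Integrable (fun x => u (t, x)) :=
    (integrable_of_tendsto_of_integral_le
      (fun j => (hs.slice_decayWeight hn hu₀ (hR0 j) ht).1)
      (fun j => Eventually.of_forall fun x =>
        mul_nonneg (hs.nonneg t ht x) (decayWeight_pos _ x).le)
      (Eventually.of_forall fun x => by
        simpa using (tendsto_decayWeight x hRtop).const_mul (u (t, x)))
      (fun j => le_rfl) lim3).1
  exact ⟨hInt, tendsto_nhds_unique (tendsto_integral_mul_decayWeight hInt hRtop) lim3⟩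

end IsDegenerateFlux

end MassConservation

/-! ### Reduction of the system to a single equation with a degenerate flux. -/

section Reduction

variable {n k : ℕ}

theorem integrable_rpow_of_mul_rpow_le {α : Type*} [MeasurableSpace α] {μ : Measure α}
    {f g : α → ℝ} {lam β r : ℝ} (hlam : 0 < lam) (hr : 0 < r) (hf0 : ∀ x, 0 ≤ f x)
    (hf : AEStronglyMeasurable f μ) (hle : ∀ᵐ x ∂μ, lam * f x ^ β ≤ g x)
    (hg : MemLp g (ENNReal.ofReal r) μ) : Integrable (fun x => f x ^ (β * r)) μ := by
  have h1 : Integrable (fun x => ‖g x‖ ^ r) μ := by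
    have := hg.integrable_norm_rpow (by simpa using hr) ENNReal.ofReal_ne_top
    rwa [ENNReal.toReal_ofReal hr.le] at this
  refine Integrable.mono' (h1.const_mul ((lam ^ r)⁻¹))
    (hf.aemeasurable.pow_const _).aestronglyMeasurable ?_
  filter_upwards [hle] with x hx
  have h2 : 0 ≤ f x ^ β := Real.rpow_nonneg (hf0 x) β
  rw [Real.norm_of_nonneg (Real.rpow_nonneg (hf0 x) _), Real.rpow_mul (hf0 x),
    inv_mul_eq_div, le_div_iff₀ (Real.rpow_pos_of_pos hlam r), mul_comm,
    ← Real.mul_rpow hlam.le h2]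
  exact Real.rpow_le_rpow (by positivity) (hx.trans (le_abs_self _)) hr.le

theorem LocallyIntegrableOn.of_forall_slab {V : Type*} [NormedAddCommGroup V]
    {f : SpaceTime n → V} (h : ∀ T : ℝ, 0 < T → LocallyIntegrableOn f (Ioo 0 T ×ˢ univ)) :
    LocallyIntegrableOn f (Ioi 0 ×ˢ univ) := by
  intro p hp
  have hp1 : 0 < p.1 := hp.1
  have hm : p ∈ Ioo 0 (p.1 + 1) ×ˢ (univ : Set (Space n)) := ⟨⟨hp1, by linarith⟩, mem_univ _⟩
  have := h (p.1 + 1) (by linarith) p hm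
  rwa [(isOpen_Ioo.prod isOpen_univ).nhdsWithin_eq hm,
    ← (isOpen_Ioi.prod isOpen_univ).nhdsWithin_eq hp] at this

theorem IsTestFunction.exists_slab {φ : SpaceTime n → ℝ} (hφ : IsTestFunction (Ioi 0 ×ˢ univ) φ) :
    ∃ T : ℝ, 0 < T ∧ IsTestFunction (Ioo 0 T ×ˢ univ) φ := by
  obtain ⟨h1, h2, h3⟩ := hφ
  obtain ⟨T, hT⟩ := (h2.isCompact.image continuous_fst).bddAbove
  refine ⟨max T 0 + 1, by positivity, h1, h2, fun p hp => ⟨⟨(h3 hp).1, ?_⟩, mem_univ _⟩⟩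
  have := hT (mem_image_of_mem Prod.fst hp)
  have := le_max_left T 0
  linarith

namespace ParabolicSystem

variable {S : ParabolicSystem n k} {u : Fin k → SpaceTime n → ℝ}
  {G : Fin k → SpaceTime n → Space n} {u₀ : Fin k → Space n → ℝ}

theorem IsWeakSolution.hasWeakSpaceGrad (hsol : ∀ T : ℝ, 0 < T → S.IsWeakSolution univ T u G)
    (i : Fin k) : HasWeakSpaceGrad (Ioi 0 ×ˢ univ) (u i) (G i) := by
  intro φ hφ
  obtain ⟨T, hT, hφT⟩ := hφ.exists_slab
  have h := ((hsol T hT).weakGrad i).integral_eq φ hφT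
  rwa [setIntegral_eq_integral_of_forall_compl_eq_zero,
    setIntegral_eq_integral_of_forall_compl_eq_zero] at h
  · intro p hp
    rw [image_eq_zero_of_notMem_tsupport fun h' => hp (hφT.2.2 h'), zero_smul]
  · intro p hp
    rw [spaceGrad_eq_zero_of_notMem_tsupport fun h' => hp (hφT.2.2 h'), smul_zero]

theorem isFluxSolution (hu₀ : ∀ j x, 0 ≤ u₀ j x)
    (hu : ∀ j, ∀ t : ℝ, 0 < t → ∀ x, 0 ≤ u j (t, x))
    (hsol : ∀ T : ℝ, 0 < T → S.IsWeakSolution univ T u G)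
    (hinit : ∀ j, HasInitialDatum (u j) (u₀ j)) (hstruct : S.StructureConditions u G)
    (hC₅ : S.C₅ = 0) (i : Fin k) :
    IsFluxSolution (u i) (u₀ i) fun p => (S.m * S.Uu u p ^ (S.m - 1)) • S.Au u G i p where
  nonneg := hu i
  nonneg_init := hu₀ i
  locallyIntegrableOn :=
    LocallyIntegrableOn.of_forall_slab fun T hT => ((hsol T hT).weakGrad i).locallyIntegrable
  memLp_flux T hT := by
    have := ((hsol T hT).flux_memLp i).const_smul S.m
    refine (memLp_congr_ae (Eventually.of_forall fun p => ?_)).1 this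
    simp only [Pi.smul_apply, smul_smul]
  datum := hinit i
  integral_eq_zero φ hφ := by
    obtain ⟨T, hT, hφT⟩ := hφ.exists_slab
    have h := (hsol T hT).integral_eq_zero i φ hφT
    -- With `C₅ = 0` the growth condition on `B` forces it to vanish along the solution.
    have hB : ∀ᵐ p ∂(volume.restrict (Ioo 0 T ×ˢ (univ : Set (Space n)))), S.Bu u i p = 0 := by
      have hsub := IsDegenerateFlux.slab_subset (n := n) T
      filter_upwards [ae_restrict_of_ae_restrict_of_subset hsub hstruct.A7,
        ae_restrict_mem (measurableSet_Ioo.prod MeasurableSet.univ)] with p hp hpm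
      have := hp (u i p) (hu i p.1 hpm.1.1 p.2)
      rw [hC₅, zero_mul] at this
      exact norm_le_zero_iff.1 this
    rw [← h]
    rw [← setIntegral_eq_integral_of_forall_compl_eq_zero (s := Ioo 0 T ×ˢ (univ : Set (Space n)))]
    · refine integral_congr_ae ?_
      filter_upwards [hB] with p hp
      rw [hp, inner_zero_left, add_zero, real_inner_smul_left]
    · intro p hp
      have hp' : p ∉ tsupport φ := fun h' => hp (hφT.2.2 h')
      rw [spaceGrad_eq_zero_of_notMem_tsupport hp', inner_zero_right,
        timeDeriv_eq_fderiv (hφ.1.differentiable (by simp) p),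
        fderiv_of_notMem_tsupport ℝ hp']
      simp

theorem antitone_K (S : ParabolicSystem n k) (u : Fin k → SpaceTime n → ℝ) :
    Antitone (S.K u) := fun s t hst =>
  essSup_mono_measure (Measure.absolutelyContinuous_of_le
    (Measure.restrict_mono (prod_mono (Ici_subset_Ici.2 hst) subset_rfl) le_rfl))

theorem exists_lintegral_K_lt_top
    (hK : Tendsto (fun t : ℝ => ∫⁻ τ in Ioo 0 t, S.K u τ ^ (S.m - 1)) (𝓝[>] 0) (𝓝 0)) :
    ∃ t₀ : ℝ, 0 < t₀ ∧ ∫⁻ τ in Ioo 0 t₀, S.K u τ ^ (S.m - 1) < ⊤ := by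
  obtain ⟨t₀, h1, h2⟩ := ((hK.eventually_lt_const (show (0 : ℝ≥0∞) < 1 by simp)).and
    self_mem_nhdsWithin).exists
  exact ⟨t₀, h2, h1.trans ENNReal.one_lt_top⟩

/-- As `K` is antitone, an infinite value at `t` would make it infinite on all of `(0, t)`, against
the finiteness of the integral near zero. -/
theorem K_lt_top (hm : 1 < S.m)
    (hK : Tendsto (fun t : ℝ => ∫⁻ τ in Ioo 0 t, S.K u τ ^ (S.m - 1)) (𝓝[>] 0) (𝓝 0))
    {t : ℝ} (ht : 0 < t) : S.K u t < ⊤ := by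
  obtain ⟨t₀, ht₀, hfin⟩ := exists_lintegral_K_lt_top hK
  have hmeas : Measurable fun τ => S.K u τ ^ (S.m - 1) :=
    (S.antitone_K u).measurable.pow_const _
  have hae := ae_lt_top hmeas hfin.ne
  have hsub : Ioo 0 (min t t₀) ⊆ Ioo 0 t₀ := Ioo_subset_Ioo le_rfl (min_le_right _ _)
  have hae' := ae_restrict_of_ae_restrict_of_subset hsub hae
  have hne : (ae (volume.restrict (Ioo 0 (min t t₀)))).NeBot := by
    rw [ae_neBot, Ne, Measure.restrict_eq_zero, Real.volume_Ioo]
    simp [ht, ht₀]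
  obtain ⟨s, hs1, hs2⟩ := (hae'.and (ae_restrict_mem measurableSet_Ioo)).exists
  have hs3 : S.K u s < ⊤ := by
    by_contra hcon
    rw [not_lt, top_le_iff] at hcon
    rw [hcon, ENNReal.top_rpow_of_pos (by linarith)] at hs1
    exact lt_irrefl _ hs1
  exact ((S.antitone_K u) (hs2.2.le.trans (min_le_left _ _))).trans_lt hs3

/-- The smallness hypothesis covers times near zero; afterwards `K` is bounded by its finite value
at `t₀`. -/
theorem integrableOn_K (hm : 1 < S.m)
    (hK : Tendsto (fun t : ℝ => ∫⁻ τ in Ioo 0 t, S.K u τ ^ (S.m - 1)) (𝓝[>] 0) (𝓝 0))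
    (T : ℝ) : IntegrableOn (fun τ => (S.K u τ).toReal ^ (S.m - 1)) (Ioo 0 T) := by
  obtain ⟨t₀, ht₀, hfin⟩ := exists_lintegral_K_lt_top hK
  have hmeas : Measurable fun τ => S.K u τ ^ (S.m - 1) :=
    (S.antitone_K u).measurable.pow_const _
  have hle : ∫⁻ τ in Ioo 0 T, S.K u τ ^ (S.m - 1) < ⊤ := by
    have hsub : Ioo 0 T ⊆ Ioo 0 t₀ ∪ Icc t₀ T := by
      intro s hs
      rcases lt_or_ge s t₀ with h | h
      · exact Or.inl ⟨hs.1, h⟩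
      · exact Or.inr ⟨h, hs.2.le⟩
    refine (lintegral_mono_set hsub).trans_lt ((lintegral_union_le _ _ _).trans_lt ?_)
    refine ENNReal.add_lt_top.2 ⟨hfin, ?_⟩
    calc ∫⁻ τ in Icc t₀ T, S.K u τ ^ (S.m - 1) ≤ ∫⁻ _ in Icc t₀ T, S.K u t₀ ^ (S.m - 1) := by
          refine setLIntegral_mono measurable_const fun s hs => ?_
          exact ENNReal.rpow_le_rpow ((S.antitone_K u) hs.1) (by linarith)
      _ < ⊤ := by
          rw [setLIntegral_const]
          exact ENNReal.mul_lt_top (ENNReal.rpow_lt_top_of_nonneg (by linarith)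
            (K_lt_top hm hK ht₀).ne) (by simp)
  have := integrable_toReal_of_lintegral_ne_top hmeas.aemeasurable hle.ne
  refine this.congr (Eventually.of_forall fun τ => ?_)
  exact (ENNReal.toReal_rpow _ _).symm

/-- The bound by the essential supremum from a fixed time holds off a null set, which can be chosen
common to all rational times. An antitone function is continuous off a countable set of times, and
at a continuity point rational times approaching from the left give the bound with `K` at the time
of the point itself. -/
theorem ae_le_K (S : ParabolicSystem n k) (u : Fin k → SpaceTime n → ℝ) :
    ∀ᵐ p ∂(volume.restrict (Ioi 0 ×ˢ (univ : Set (Space n)))),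
      ENNReal.ofReal |S.Uu u p| ≤ S.K u p.1 := by
  have h1 : ∀ᵐ p : SpaceTime n, ∀ q : ℚ, (q : ℝ) ≤ p.1 →
      ENNReal.ofReal |S.Uu u p| ≤ S.K u q := by
    rw [ae_all_iff]
    intro q
    have : ∀ᵐ p ∂(volume.restrict (Ici (q : ℝ) ×ˢ (univ : Set (Space n)))),
        ENNReal.ofReal |S.Uu u p| ≤ S.K u q := ae_le_essSup
    rw [ae_restrict_iff' (measurableSet_Ici.prod MeasurableSet.univ)] at this
    filter_upwards [this] with p hp hq
    exact hp ⟨hq, mem_univ _⟩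
  have h2 : ∀ᵐ p : SpaceTime n, ContinuousAt (S.K u) p.1 := by
    have h3 : ∀ᵐ t : ℝ, ContinuousAt (S.K u) t := by
      have := (S.antitone_K u).countable_not_continuousAt.measure_zero volume
      exact this
    rw [Measure.volume_eq_prod]
    exact Measure.quasiMeasurePreserving_fst.ae h3
  refine ae_restrict_of_ae ?_
  filter_upwards [h1, h2] with p hp1 hp2
  by_contra! hlt
  obtain ⟨l, hl, hl2⟩ := exists_Ioc_subset_of_mem_nhds (hp2.eventually_lt_const hlt)
    (exists_lt p.1)
  obtain ⟨q, hq1, hq2⟩ := exists_rat_btwn hl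
  exact absurd (hp1 q hq2.le) (not_le.2 (hl2 ⟨hq1, hq2.le⟩))

theorem aestronglyMeasurable_Uu (hu : ∀ j, ∀ t : ℝ, 0 < t → ∀ x, 0 ≤ u j (t, x))
    (hsol : ∀ T : ℝ, 0 < T → S.IsWeakSolution univ T u G)
    (hU : ContinuousOn S.U (Ici 0)) :
    AEStronglyMeasurable (S.Uu u) (volume.restrict (Ioi 0 ×ˢ (univ : Set (Space n)))) := by
  -- `U` is continuous on the orthant only, so it is composed with the projection onto the orthant,
  -- which fixes the values of the solution.
  have hc : Continuous fun ξ : Fin k → ℝ => S.U (ξ ⊔ 0) :=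
    hU.comp_continuous
      (continuous_pi fun j => (continuous_apply j).max continuous_const)
      fun ξ => mem_Ici.2 le_sup_right
  have hv : AEMeasurable (vec u) (volume.restrict (Ioi 0 ×ˢ (univ : Set (Space n)))) := by
    refine aemeasurable_pi_iff.2 fun j => ?_
    exact (LocallyIntegrableOn.of_forall_slab fun T hT =>
      ((hsol T hT).weakGrad j).locallyIntegrable).aestronglyMeasurable.aemeasurable
  have := (hc.measurable.comp_aemeasurable hv).aestronglyMeasurable
  refine this.congr ?_
  filter_upwards [ae_restrict_mem (measurableSet_Ioi.prod MeasurableSet.univ)] with p hp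
  have h0 : (0 : Fin k → ℝ) ≤ vec u p := fun j => hu j p.1 hp.1 p.2
  simp only [Function.comp_apply, sup_of_le_left h0, Uu]

/-- Multiplying (A5) and (A6) by `m U^(m-1)` gives coercivity and growth, with one constant `C₂ + C₃
+ C₄` large enough for both. Raising `λ u^β ≤ U` to the power `m - 1` gives the lower bound for the
weight, and `U ≤ K` the upper one. -/
theorem isDegenerateFlux (hu : ∀ j, ∀ t : ℝ, 0 < t → ∀ x, 0 ≤ u j (t, x))
    (hsol : ∀ T : ℝ, 0 < T → S.IsWeakSolution univ T u G) (hstruct : S.StructureConditions u G)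
    (i : Fin k) (hβ : 0 < S.beta i) (hm : 1 < S.m)
    (hK : Tendsto (fun t : ℝ => ∫⁻ τ in Ioo 0 t, S.K u τ ^ (S.m - 1)) (𝓝[>] 0) (𝓝 0)) :
    IsDegenerateFlux (u i) (fun p => (S.m * S.Uu u p ^ (S.m - 1)) • S.Au u G i p) (G i)
      (fun p => S.m * S.Uu u p ^ (S.m - 1)) (fun τ => S.m * (S.K u τ).toReal ^ (S.m - 1))
      S.c (S.C₂ + S.C₃ + S.C₄) (S.m * S.lam i ^ (S.m - 1)) (S.beta i * (S.m - 1)) := by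
  have h2 := hstruct.one_le_C₂
  have h3 := hstruct.one_le_C₃
  have h4 := hstruct.one_le_C₄
  have hlam := hstruct.lam_pos i
  have hmem := ae_restrict_mem (μ := volume)
    (measurableSet_Ioi (a := (0 : ℝ)) |>.prod (MeasurableSet.univ (α := Space n)))
  have hU0 : ∀ᵐ p ∂(volume.restrict (Ioi 0 ×ˢ (univ : Set (Space n)))), 0 ≤ S.Uu u p := by
    filter_upwards [hstruct.lower_bound i, hmem] with p hp hpm
    exact (mul_nonneg hlam.le (Real.rpow_nonneg (hu i p.1 hpm.1 p.2) _)).trans hp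
  refine ⟨hstruct.c_pos, by linarith, by positivity, mul_pos hβ (by linarith),
    IsWeakSolution.hasWeakSpaceGrad hsol i,
    LocallyIntegrableOn.of_forall_slab fun T hT => ((hsol T hT).weakGrad i).locallyIntegrable_grad,
    ?_, fun t => by positivity, fun T => (integrableOn_K hm hK T).const_mul _, ?_, ?_, ?_, ?_⟩
  · exact (((aestronglyMeasurable_Uu hu hsol hstruct.continuous_U).aemeasurable.pow_const
      _).const_mul _).aestronglyMeasurable
  · filter_upwards [S.ae_le_K u, hU0, hmem] with p hp hp0 hpm
    have h5 : S.Uu u p ≤ (S.K u p.1).toReal := by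
      have := ENNReal.toReal_mono (K_lt_top hm hK hpm.1).ne hp
      rwa [ENNReal.toReal_ofReal (abs_nonneg _), abs_of_nonneg hp0] at this
    exact mul_le_mul_of_nonneg_left (Real.rpow_le_rpow hp0 h5 (by linarith)) (by linarith)
  · filter_upwards [hstruct.lower_bound i, hmem] with p hp hpm
    have hup := hu i p.1 hpm.1 p.2
    have h5 : 0 ≤ u i p ^ S.beta i := Real.rpow_nonneg hup _
    rw [mul_assoc, Real.rpow_mul hup, ← Real.mul_rpow hlam.le h5]
    exact mul_le_mul_of_nonneg_left (Real.rpow_le_rpow (by positivity) hp (by linarith))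
      (by linarith)
  · filter_upwards [hstruct.A5, hU0, hmem] with p hp hp0 hpm
    have hup := hu i p.1 hpm.1 p.2
    rw [real_inner_smul_left]
    refine mul_le_mul_of_nonneg_left (le_trans ?_ (hp (G i p) (u i p) hup)) (by positivity)
    have : S.C₂ * u i p ^ 2 ≤ (S.C₂ + S.C₃ + S.C₄) * u i p ^ 2 :=
      mul_le_mul_of_nonneg_right (by linarith) (sq_nonneg _)
    linarith
  · filter_upwards [hstruct.A6, hU0, hmem] with p hp hp0 hpm
    have hup := hu i p.1 hpm.1 p.2
    have hw : 0 ≤ S.m * S.Uu u p ^ (S.m - 1) := by positivity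
    rw [norm_smul, Real.norm_of_nonneg hw]
    refine mul_le_mul_of_nonneg_left ((hp (G i p) (u i p) hup).trans (add_le_add ?_ ?_)) hw
    · exact mul_le_mul_of_nonneg_right (by linarith) (norm_nonneg _)
    · exact mul_le_mul_of_nonneg_right (by linarith) hup

end ParabolicSystem

end Reduction

/-! ### The theorem: integrability of the data and choice of the exponent. -/

theorem theorem1p3 {n k : ℕ} (hn : 2 ≤ n) (S : ParabolicSystem n k)
    (u₀ : Fin k → Space n → ℝ)
    (u : Fin k → SpaceTime n → ℝ) (G : Fin k → SpaceTime n → Space n)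
    (hu₀ : ∀ j x, 0 ≤ u₀ j x)
    (hu : ∀ j, ∀ t : ℝ, 0 < t → ∀ x, 0 ≤ u j (t, x))
    (hsol : ∀ T : ℝ, 0 < T → S.IsWeakSolution univ T u G)
    (hinit : ∀ j, HasInitialDatum (u j) (u₀ j))
    (hstruct : S.StructureConditions u G)
    (hlower₀ : ∀ j, ∀ᵐ x : Space n,
      S.lam j * (u₀ j x) ^ (S.beta j) ≤ S.U (fun l => u₀ l x))
    (hC₅ : S.C₅ = 0)
    (i : Fin k) (hβ : 0 < S.beta i)
    (hm : max 1 (2 - 1 / S.beta i) < S.m)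
    (hU₀ : MemLp (fun x => S.U (fun l => u₀ l x))
      (ENNReal.ofReal (1 / S.beta i)) volume)
    (hU₀' : MemLp (fun x => S.U (fun l => u₀ l x))
      (ENNReal.ofReal (S.m - 1 + 1 / S.beta i)) volume)
    (hK : Tendsto (fun t : ℝ => ∫⁻ τ in Ioo 0 t, (S.K u τ) ^ (S.m - 1)) (𝓝[>] 0) (𝓝 0)) :
    Integrable (u₀ i) volume ∧
    ∀ t : ℝ, 0 < t →
      Integrable (fun x => u i (t, x)) volume ∧
      ∫ x, u i (t, x) = ∫ x, u₀ i x := by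
  have hm1 : 1 < S.m := (le_max_left _ _).trans_lt hm
  have hlam := hstruct.lam_pos i
  have hum := (hinit i).initial_locallyIntegrable.aestronglyMeasurable
  -- Here `u₀ = (u₀^β)^(1/β)` is dominated by `(U₀/λ)^(1/β)`.
  have hInt : Integrable (u₀ i) := by
    have := integrable_rpow_of_mul_rpow_le hlam (by positivity) (hu₀ i) hum (hlower₀ i) hU₀
    simpa only [mul_one_div_cancel hβ.ne', Real.rpow_one] using this
  refine ⟨hInt, fun t ht => ?_⟩
  set σ := S.beta i * (S.m - 1) with hσ
  have hσ0 : 0 < σ := mul_pos hβ (by linarith)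
  have hInt' : Integrable (fun x => u₀ i x ^ (1 + σ)) := by
    have hpos : 0 < 1 / S.beta i := by positivity
    have := integrable_rpow_of_mul_rpow_le hlam (by linarith) (hu₀ i) hum (hlower₀ i) hU₀'
    have e : S.beta i * (S.m - 1 + 1 / S.beta i) = 1 + σ := by
      rw [hσ]; field_simp; ring
    rwa [e] at this
  -- The bound `1/(2n+1)` is what the flux estimate requires; the bound `σ` places `1 + a` between
  -- the exponents `1` and `1 + σ`, for which `u₀` is known to be integrable.
  set a := min (1 / (2 * (n : ℝ) + 1)) σ with ha
  have ha0 : 0 < a := lt_min (by positivity) hσ0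
  have han : a * (2 * n + 1) ≤ 1 := by
    have : a ≤ 1 / (2 * (n : ℝ) + 1) := min_le_left _ _
    rwa [le_div_iff₀ (by positivity)] at this
  have hInt'' : Integrable (fun x => u₀ i x ^ (1 + a)) := by
    refine Integrable.mono' (hInt.add hInt') (hum.aemeasurable.pow_const _).aestronglyMeasurable
      (Eventually.of_forall fun x => ?_)
    have h0 := hu₀ i x
    rw [Real.norm_of_nonneg (Real.rpow_nonneg h0 _)]
    simp only [Pi.add_apply]
    have h1 : 0 ≤ u₀ i x ^ (1 + σ) := Real.rpow_nonneg h0 _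
    rcases le_total (u₀ i x) 1 with h | h
    · have : u₀ i x ^ (1 + a) ≤ u₀ i x := Real.rpow_le_self_of_le_one h0 h (by linarith)
      linarith
    · have : u₀ i x ^ (1 + a) ≤ u₀ i x ^ (1 + σ) :=
        Real.rpow_le_rpow_of_exponent_le h (by linarith [min_le_right (1 / (2 * (n : ℝ) + 1)) σ])
      linarith
  exact (S.isDegenerateFlux hu hsol hstruct i hβ hm1 hK).mass_eq
    (S.isFluxSolution hu₀ hu hsol hinit hstruct hC₅ i) (by linarith) hInt ha0 han hInt'' ht
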